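/- **Conventions.** Let $C$ be a purely one-dimensional scheme of finite type over $\mathbb C$ (possibly nonreduced or reducible). Its *intersection graph* $\Gamma(C)$ is the bipartite multigraph whose green vertices $G(C)$ are the irreducible components of $C$, whose yellow vertices $Y(C)$ are the points at which $C$ has at least two analytic branches, and whose edges joining $g\in G(C)$ to $y\in Y(C)$ are the analytic branches of $g$ at $y$. The multiplicity $m(g)$ of $g\in G(C)$ is the length of the local ring of $C$ at the generic point of $g$; the component is reduced if $m(g)=1$ and doubled if $m(g)=2$. For a finite map of curves $\varphi\colon C_1\to C_2$, the component injectivity failure at $g\in G(C_1)$ is $\zeta_\varphi(g)=\deg(g^{\mathrm{red}}\to\varphi(g)^{\mathrm{red}})-1$. For $y\in Y(C_1)$, the branch injectivity failure $\zeta_\varphi(y)$ is the number of branches of $C_1$ at $y$ minus the number of distinct branches of $C_2$ at $\varphi(y)$ that are their images if there are at least two such images, and $\zeta_\varphi(y)=0$ if there is only one. **Setting.** Let $T$ be a smooth complex curve with a closed point $0\in T$. Let $D^{CY}$ be an integral S2 surface with a flat and proper (for example, flat and projective) morphism to $T$, such that the nonnormal locus of $D^{CY}$ is contained in the scheme-theoretic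 central fibre $D^{CY}_0$. Let $D^{norm}\to D^{CY}$ be the normalization, assume that its central fibre $D^{norm}_0$ is reduced, and let $\nu\colon D^{norm}_0\to D^{CY}_0$ be the induced map. Consider the hypotheses - (H1)=(H1$\star$): $\Gamma(D^{norm}_0)$ is a tree. - (H2)=(H2$\star$): if $D^{CY}_0$ is nonreduced, then $\zeta_\nu(v)>0$ for some $v\in G(D^{norm}_0)$ or some $v\in Y(D^{norm}_0)$. - (H3): every component of $D^{CY}_0$ has multiplicity at most $2$. (H3$\star$): $D^{CY}_0$ is reduced. - (H4): every closed point of $D^{CY}_0$ has (Hilbert–Samuel) multiplicity at most $4$. (H4$\star$): every closed point of $D^{CY}_0$ has multiplicity at most $3$. - (H5)=(H5$\star$): any two distinct green vertices of $\Gamma(D^{CY}_0)$ have graph distance $2$. - (H6)=(H6$\star$): at least one component of $D^{CY}_0$ is reduced. **Theorem.** Under (H1)–(H6), $D^{CY}_0$ has between $1$ and $4$ components, and its intersection graph, with its green vertices labelled by the multiplicities of the components, is one of the following seven: 1. ($\star$) a single green vertex with label $1$, with no yellow vertex and no edge; 2. ($\star$) the star with one yellow vertex joined by one edge to each of two green vertices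 with labels $1,1$; 3. the same star with labels $2,1$; 4. ($\star$) the star with one yellow vertex joined by one edge to each of three green vertices with labels $1,1,1$; 5. the same star with labels $2,1,1$; 6. the hexagon in which three green vertices with labels $2,2,1$ alternate with three yellow vertices; 7. the star with one yellow vertex joined by one edge to each of four green vertices with labels $1,1,1,1$. Under (H1$\star$)–(H6$\star$), $D^{CY}_0$ has between $1$ and $3$ components, and its labelled intersection graph is one of the three graphs marked ($\star$). -/

import Mathlib

open CategoryTheory CategoryTheory.Limits AlgebraicGeometry Filter
open scoped ENNReal

noncomputable section

universe u u₁ u₂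

/-! ## Local rings: completion, functoriality of the completion, multiplicity -/

/-- The ring homomorphism `Â → B̂` between the maximal-adic completions that is induced by a local
homomorphism `φ : A → B` of local rings: the limit of the maps `A / m_A ^ n → B / m_B ^ n`. -/
def completionMap {A B : Type u} [CommRing A] [CommRing B] [IsLocalRing A] [IsLocalRing B]
    (φ : A →+* B) [IsLocalHom φ] :
    AdicCompletion (IsLocalRing.maximalIdeal A) A →+*
      AdicCompletion (IsLocalRing.maximalIdeal B) B :=
  have hle (n : ℕ) : IsLocalRing.maximalIdeal A ^ n ≤
      (IsLocalRing.maximalIdeal B ^ n).comap φ := by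
    have h : IsLocalRing.maximalIdeal A ≤ (IsLocalRing.maximalIdeal B).comap φ :=
      (IsLocalRing.maximalIdeal_comap φ).ge
    exact (Ideal.pow_right_mono h n).trans (Ideal.le_comap_pow φ n)
  AdicCompletion.liftRingHom (IsLocalRing.maximalIdeal B)
    (fun n => (Ideal.quotientMap (IsLocalRing.maximalIdeal B ^ n) φ (hle n)).comp
      (AdicCompletion.evalₐ (IsLocalRing.maximalIdeal A) n :
        AdicCompletion (IsLocalRing.maximalIdeal A) A →+*
          A ⧸ IsLocalRing.maximalIdeal A ^ n))
    (by
      intro m n hmn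
      ext x
      obtain ⟨s, rfl⟩ := AdicCompletion.mk_surjective _ _ x
      have hs : Ideal.Quotient.mk (IsLocalRing.maximalIdeal A ^ m) (s.val n) =
          Ideal.Quotient.mk (IsLocalRing.maximalIdeal A ^ m) (s.val m) := by
        have h := s.property hmn
        rw [SModEq.sub_mem] at h
        rw [eq_comm, Ideal.Quotient.eq]
        simpa using h
      have hs' := congrArg (Ideal.quotientMap (IsLocalRing.maximalIdeal B ^ m) φ (hle m)) hs
      simpa [AdicCompletion.evalₐ_mk] using hs')

/-- The (Hilbert–Samuel) multiplicity of a one-dimensional Noetherian local ring `A`: the limit of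
`length (A / m ^ n) / n` as `n` tends to infinity. (The limit exists for every such `A`; it is
written as an upper limit so as to be defined without proof.) -/
def samuelMultiplicity (A : Type u) [CommRing A] [IsLocalRing A] : ℝ≥0∞ :=
  limsup (fun n : ℕ =>
    ((Module.length A (A ⧸ IsLocalRing.maximalIdeal A ^ n) : ℕ∞) : ℝ≥0∞) / (n : ℝ≥0∞)) atTop

/-! ## Bipartite multigraphs -/

/-- A bipartite multigraph: green vertices, yellow vertices and edges, each of which joins
a green vertex to a yellow vertex. Several edges may have the same end points. -/
structure BipartiteMultigraph where
  /-- the green vertices -/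
  Green : Type u
  /-- the yellow vertices -/
  Yellow : Type u
  /-- the edges -/
  Edge : Type u
  /-- the green end point of an edge -/
  green : Edge → Green
  /-- the yellow end point of an edge -/
  yellow : Edge → Yellow

namespace BipartiteMultigraph

/-- The simple graph on all vertices in which two vertices are adjacent if and only if
at least one edge joins them. -/
def toSimpleGraph (Γ : BipartiteMultigraph.{u}) : SimpleGraph (Γ.Green ⊕ Γ.Yellow) :=
  SimpleGraph.fromRel fun v w => ∃ e : Γ.Edge, v = Sum.inl (Γ.green e) ∧ w = Sum.inr (Γ.yellow e)

/-- The multigraph is a tree: it is connected and has no cycle; two parallel edges count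
as a cycle. -/
def IsTree (Γ : BipartiteMultigraph.{u}) : Prop :=
  Γ.toSimpleGraph.IsTree ∧ Function.Injective fun e => (Γ.green e, Γ.yellow e)

/-- The graph distance of two green vertices. -/
def greenDist (Γ : BipartiteMultigraph.{u}) (g₁ g₂ : Γ.Green) : ℕ :=
  Γ.toSimpleGraph.dist (Sum.inl g₁) (Sum.inl g₂)

/-- `Γ`, with its green vertices labelled by `m`, is isomorphic to `Γ'`, with its green vertices
labelled by `m'`: there is an isomorphism of multigraphs that keeps the colours and the labels. -/
def LabelledIso (Γ : BipartiteMultigraph.{u₁}) (m : Γ.Green → ℕ∞)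
    (Γ' : BipartiteMultigraph.{u₂}) (m' : Γ'.Green → ℕ∞) : Prop :=
  ∃ (φ : Γ.Green ≃ Γ'.Green) (ψ : Γ.Yellow ≃ Γ'.Yellow) (χ : Γ.Edge ≃ Γ'.Edge),
    (∀ e, Γ'.green (χ e) = φ (Γ.green e)) ∧ (∀ e, Γ'.yellow (χ e) = ψ (Γ.yellow e)) ∧
      ∀ g, m' (φ g) = m g

/-- A single green vertex, no yellow vertex and no edge. -/
def point : BipartiteMultigraph.{0} where
  Green := Fin 1
  Yellow := Empty
  Edge := Empty
  green := Empty.elim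
  yellow := Empty.elim

/-- The star with one yellow vertex in the centre, joined by one edge to each of `n` green
vertices. -/
def star (n : ℕ) : BipartiteMultigraph.{0} where
  Green := Fin n
  Yellow := Unit
  Edge := Fin n
  green := id
  yellow := fun _ => ()

/-- The hexagon: three green and three yellow vertices in a cycle, with alternating colours.
The green vertex `i` is joined to the yellow vertices `i` and `i + 1` (modulo 3). -/
def hexagon : BipartiteMultigraph.{0} where
  Green := Fin 3
  Yellow := Fin 3
  Edge := Fin 3 × Fin 2
  green := fun e => e.1
  yellow := fun e => if e.2 = 0 then e.1 else e.1 + 1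

end BipartiteMultigraph

/-! ## Curves and their intersection graphs -/

namespace CurveGraph

/-- The completed local ring of a scheme at a point. -/
abbrev CompletedStalk (C : Scheme.{u}) (p : C) : Type u :=
  AdicCompletion (IsLocalRing.maximalIdeal (C.presheaf.stalk p)) (C.presheaf.stalk p)

/-- The analytic branches of the curve `C` at the point `p`: the minimal primes of the completed
local ring. -/
def branches (C : Scheme.{u}) (p : C) : Set (Ideal (CompletedStalk C p)) :=
  minimalPrimes (CompletedStalk C p)

/-- The branch `b` at `p` is a branch of the irreducible component with generic point `g`:
the prime ideal of the local ring at `p` below `b` is the one that corresponds to `g`. -/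
def IsBranchOf {C : Scheme.{u}} {p : C} (b : Ideal (CompletedStalk C p)) (g : C) : Prop :=
  ∃ q : PrimeSpectrum (C.presheaf.stalk p),
    q.asIdeal = b.comap (algebraMap (C.presheaf.stalk p) (CompletedStalk C p)) ∧
      C.fromSpecStalk p q = g

/-- The intersection graph of a purely one-dimensional scheme `C`. The green vertices are the
irreducible components of `C` (given by their generic points), the yellow vertices are the points
at which `C` has more than one analytic branch, and the edges that join the green vertex `g` to
the yellow vertex `y` are the analytic branches of `g` at `y`. -/
def intersectionGraph (C : Scheme.{u}) : BipartiteMultigraph.{u} where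
  Green := {g : C // g ∈ genericPoints C}
  Yellow := {y : C // (branches C y).Nontrivial}
  Edge := Σ (g : {g : C // g ∈ genericPoints C}) (y : {y : C // (branches C y).Nontrivial}),
    {b : Ideal (CompletedStalk C y.1) // b ∈ branches C y.1 ∧ IsBranchOf b g.1}
  green := fun e => e.1
  yellow := fun e => e.2.1

/-- The multiplicity of a component: the length of the local ring at its generic point. -/
def componentMultiplicity (C : Scheme.{u}) (g : (intersectionGraph C).Green) : ℕ∞ :=
  Module.length (C.presheaf.stalk g.1) (C.presheaf.stalk g.1)

/-- The multiplicity of the curve `C` at a closed point `p`. -/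
def pointMultiplicity (C : Scheme.{u}) (p : C) : ℝ≥0∞ :=
  samuelMultiplicity (C.presheaf.stalk p)

/-- The branches of the target at `φ p` that are images of branches of the source at `p`. -/
def branchImage {C₁ C₂ : Scheme.{u}} (φ : C₁ ⟶ C₂) (p : C₁) :
    Set (Ideal (CompletedStalk C₂ (φ p))) :=
  Ideal.comap (completionMap (φ.stalkMap p).hom) '' branches C₁ p

open Classical in
/-- The branch injectivity failure of a finite map of curves at a yellow vertex `y`: the number
of branches at `y` minus the number of their images if there are at least two images (so that `y`
is mapped to a yellow vertex); zero if all branches at `y` have the same image (so that `y` is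
mapped to a green vertex). -/
def branchFailure {C₁ C₂ : Scheme.{u}} (φ : C₁ ⟶ C₂) (y : (intersectionGraph C₁).Yellow) : ℕ :=
  if (branchImage φ y.1).Nontrivial then
    (branches C₁ y.1).ncard - (branchImage φ y.1).ncard
  else 0

/-- The component injectivity failure of a finite map of curves at a green vertex: the degree of
the map from the (reduced) component onto its image, minus one. The degree is that of
the extension of the residue fields at the generic points. -/
def componentFailure {C₁ C₂ : Scheme.{u}} (φ : C₁ ⟶ C₂) (g : (intersectionGraph C₁).Green) : ℕ :=
  φ.residueDegree g.1 - 1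

/-- The hypotheses on a map `φ : C₁ ⟶ C₂` of curves (in the application, `C₁` is the central fibre
of the normalization of a family of curves and `C₂` is the central fibre of the family) under
which double components and points of multiplicity four are allowed. -/
structure DoubleCurveHypotheses {C₁ C₂ : Scheme.{u}} (φ : C₁ ⟶ C₂) : Prop where
  tree : (intersectionGraph C₁).IsTree
  failure : ¬ IsReduced C₂ →
    (∃ g, 0 < componentFailure φ g) ∨ ∃ y, 0 < branchFailure φ y
  componentMultiplicity_le : ∀ g, componentMultiplicity C₂ g ≤ 2
  pointMultiplicity_le : ∀ p : C₂, IsClosed {p} → pointMultiplicity C₂ p ≤ 4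
  greenDist_eq : ∀ g₁ g₂, g₁ ≠ g₂ → (intersectionGraph C₂).greenDist g₁ g₂ = 2
  exists_reduced : ∃ g, componentMultiplicity C₂ g = 1

/-- The stronger hypotheses, under which `C₂` is reduced and its points have multiplicity
at most three. -/
structure ReducedCurveHypotheses {C₁ C₂ : Scheme.{u}} (φ : C₁ ⟶ C₂) : Prop where
  tree : (intersectionGraph C₁).IsTree
  failure : ¬ IsReduced C₂ →
    (∃ g, 0 < componentFailure φ g) ∨ ∃ y, 0 < branchFailure φ y
  reduced : IsReduced C₂
  pointMultiplicity_le : ∀ p : C₂, IsClosed {p} → pointMultiplicity C₂ p ≤ 3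
  greenDist_eq : ∀ g₁ g₂, g₁ ≠ g₂ → (intersectionGraph C₂).greenDist g₁ g₂ = 2
  exists_reduced : ∃ g, componentMultiplicity C₂ g = 1

/-- The intersection graph of `C`, labelled by the multiplicities of the components, is `Γ`,
labelled by `m`. -/
def HasGraph (C : Scheme.{u}) (Γ : BipartiteMultigraph.{0}) (m : Γ.Green → ℕ∞) : Prop :=
  (intersectionGraph C).LabelledIso (componentMultiplicity C) Γ m

/-- The number of irreducible components of `C` (as an extended natural number). -/
def numComponents (C : Scheme.{u}) : ℕ∞ := (irreducibleComponents C).encard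

end CurveGraph

/-! ## Families of curves over a pointed curve -/

namespace CurveFamily

/-- The map between the fibres of `ν ≫ f` and of `f` over a point, that is induced by `ν`. -/
def fiberMap {X' X T : Scheme.{u}} (ν : X' ⟶ X) (f : X ⟶ T) (t : T) :
    (ν ≫ f).fiber t ⟶ f.fiber t :=
  pullback.lift ((ν ≫ f).fiberι t ≫ ν) ((ν ≫ f).fiberToSpecResidueField t)
    (by rw [Category.assoc, Scheme.Hom.fiber_fac])

/-- The scheme `X` is normal at the point `x`. -/
def IsNormalAt (X : Scheme.{u}) (x : X) : Prop :=
  IsDomain (X.presheaf.stalk x) ∧ IsIntegrallyClosed (X.presheaf.stalk x)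

/-- Serre's condition S2: each local ring has depth at least `min 2 dim`, that is, it has
a regular sequence of at least that length in its maximal ideal. -/
def SatisfiesS2 (X : Scheme.{u}) : Prop :=
  ∀ x : X, ∃ rs : List (X.presheaf.stalk x),
    (∀ r ∈ rs, r ∈ IsLocalRing.maximalIdeal (X.presheaf.stalk x)) ∧
      RingTheory.Sequence.IsRegular (X.presheaf.stalk x) rs ∧
        min 2 (ringKrullDim (X.presheaf.stalk x)) ≤ (rs.length : WithBot ℕ∞)

/-- The scheme `X` has pure dimension two: each closed point has a two-dimensional local ring. -/
def IsSurface (X : Scheme.{u}) : Prop :=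
  ∀ x : X, IsClosed {x} → ringKrullDim (X.presheaf.stalk x) = 2

/-- The morphism `ν : X' ⟶ X` of integral schemes is the normalization of `X`: it is finite and
birational, and `X'` is normal. -/
structure IsNormalization {X' X : Scheme.{u}} [AlgebraicGeometry.IsIntegral X']
    [AlgebraicGeometry.IsIntegral X] (ν : X' ⟶ X) : Prop where
  finite : IsFinite ν
  map_genericPoint : ν (genericPoint X') = genericPoint X
  birational : IsIso (ν.stalkMap (genericPoint X'))
  normal : ∀ x : X', IsNormalAt X' x

end CurveFamily

end

open CurveGraph CurveFamily

open IsLocalRing TensorProduct CurveGraph CurveFamily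

set_option linter.unusedSectionVars false

/-! The central fibre is recovered from the normalized one by gluing components, points and
branches. The proof extracts from the family a finite list of facts about this gluing, recorded in
`GluingData`, and then solves a problem about forests.

Let `A` be a local ring of the total space at a point of the central fibre, `t` a uniformizer of the
base, and `B` the semilocal ring of the normalization over `A`. At the generic point of a component,
`B/A` has finite length because it is killed by a power of `t`. Hence `B/tB` and `A/tA` have equal
length, and the degrees of the components above a given one sum to at most its multiplicity
(`sum_residueDegree_le`). So a double component has at most two preimages, and one preimage if the
degree exceeds one. A component of multiplicity one makes `t` generate the maximal ideal there, so
the total space is already normal at its generic point; it has at most one preimage, and each of its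
branches has at most one (`sigma_eq_of_comap_fiberStalkMap_eq`).

At a closed point, the completed base change of `B` is the product of the completed local rings of
the normalization. A set of points closed under sharing an image branch defines an idempotent of
this product that is trivial over every nonmaximal prime containing `t`. Depth two extends it to an
element of the completion of `A`, which is local, so the idempotent is trivial
(`eq_zero_or_one_of_forall_nonmaximal`, `mem_of_saturated`). Thus the points over a given point are
connected through branches with common image. Finally, the Hilbert–Samuel multiplicity of a point
bounds the sum of the multiplicities of its branches (`sum_length_le_samuelMultiplicity`).

For the combinatorics, connectedness and the bound four show that a doubled branch and any other
branch at the same point lift to a common point upstairs (`exists_lift`). Meetings of components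
downstairs therefore become adjacencies in a tree, where pairwise adjacent triples are concurrent
(`adj_tri`) and quadrilaterals do not exist (`adj_quad`). If all multiplicities are one, everything
passes through one point. Otherwise the injectivity failure provides a doubled component `h` with
only one preimage among the components carrying branches: directly if a component maps with degree
at least two, and after gluing two components of the tree at the failing point if two branches are
identified (`contract`). If `h` is the only doubled component, the graph is a star, and `2 + 1 + 1 =
4` leaves room for at most two reduced components. If `k` is another doubled component and `r` a
reduced one, the three cannot be concurrent since `2 + 2 + 1 > 4`. So `k` splits into two preimages,
at the ends of a path through those of `r` and `h`; identifying these ends produces the hexagon, and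
a fourth component would create a forbidden cycle or a point of too large multiplicity
(`isNode_of_special`). -/

/-! ## Combinatorics of gluing branches of curves -/

/-- Depth functions on the vertices of a bipartite multigraph, with green vertices in `G` and yellow
vertices in `P`, that exhibit it as a rooted forest: adjacent vertices have different depths, and
each vertex has at most one edge that leads to a vertex of smaller depth. -/
structure IsForestDepth {G P E : Type*} (gr : E → G) (pt : E → P) (d : G → ℕ) (d' : P → ℕ) :
    Prop where
  ne : ∀ e, d (gr e) ≠ d' (pt e)
  green : ∀ e f, gr e = gr f → d' (pt e) < d (gr e) → d' (pt f) < d (gr f) → e = f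
  yellow : ∀ e f, pt e = pt f → d (gr e) < d' (pt e) → d (gr f) < d' (pt f) → e = f

/-- The combinatorial shadow of a finite map of curves: `G`, `P`, `E` are the components, points and
branches of the source, and `G'`, `P'`, `E'` those of the target, whose components have
multiplicities `m`. -/
structure GluingData (G P E G' P' E' : Type*) where
  gr : E → G
  pt : E → P
  gr' : E' → G'
  pt' : E' → P'
  νG : G → G'
  νP : P → P'
  νE : E → E'
  m : G' → ℕ
  gr'_νE : ∀ e, gr' (νE e) = νG (gr e)
  pt'_νE : ∀ e, pt' (νE e) = νP (pt e)
  surjective : Function.Surjective νE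
  m_eq : ∀ h, m h = 1 ∨ m h = 2
  -- The next three fields come from comparing degrees with multiplicities, `connected` from
  -- condition S2 and `sum_le` from the Hilbert–Samuel multiplicity. Components of the source enter
  -- only through their branches.
  eq_of_m_eq_one : ∀ e f, m (gr' (νE e)) = 1 → νE e = νE f → e = f
  gr_eq_of_m_eq_one : ∀ e f, m (νG (gr e)) = 1 → νG (gr e) = νG (gr f) → gr e = gr f
  gr_eq_of_three : ∀ e f g, νG (gr e) = νG (gr f) → νG (gr e) = νG (gr g) →
    gr e = gr f ∨ gr e = gr g ∨ gr f = gr g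
  connected : ∀ (y : P') (S : Set P),
    (∀ e f, νE e = νE f → νP (pt e) = y → (pt e ∈ S ↔ pt f ∈ S)) →
    ∀ p q, νP p = y → νP q = y → p ∈ S → q ∈ S
  sum_le : ∀ (y : P') (F : Finset E'), (∀ b ∈ F, pt' b = y) → ∑ b ∈ F, m (gr' b) ≤ 4
  meet : ∀ h k, h ≠ k → ∃ b c, pt' b = pt' c ∧ gr' b = h ∧ gr' c = k
  exists_m_eq_one : ∃ h, m h = 1
  exists_forestDepth : ∃ d d', IsForestDepth gr pt d d'

namespace GluingData

variable {G P E G' P' E' : Type*} (D : GluingData G P E G' P' E')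

/-- The components `x` and `z` of the source both have a branch at `p`. -/
def Adj (x z : G) (p : P) : Prop :=
  ∃ e f, D.gr e = x ∧ D.gr f = z ∧ D.pt e = p ∧ D.pt f = p

/-- The component `k` of the target has a branch at `y`. -/
def On (k : G') (y : P') : Prop := ∃ b, D.pt' b = y ∧ D.gr' b = k

variable {D}

lemma Adj.symm {x z : G} {p : P} (h : D.Adj x z p) : D.Adj z x p := by
  obtain ⟨e, f, h1, h2, h3, h4⟩ := h
  exact ⟨f, e, h2, h1, h4, h3⟩

lemma Adj.on_left {x z : G} {p : P} (h : D.Adj x z p) : D.On (D.νG x) (D.νP p) := by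
  obtain ⟨e, f, rfl, rfl, rfl, h4⟩ := h
  exact ⟨D.νE e, D.pt'_νE e, D.gr'_νE e⟩

lemma Adj.on_right {x z : G} {p : P} (h : D.Adj x z p) : D.On (D.νG z) (D.νP p) := h.symm.on_left

/-- A forest has no double edges: the deeper of the two end points has only one edge towards the
root. -/
lemma eq_of_pt_eq_of_gr_eq {e f : E} (hp : D.pt e = D.pt f) (hg : D.gr e = D.gr f) : e = f := by
  obtain ⟨d, d', hd⟩ := D.exists_forestDepth
  have h1 := hd.ne e
  have h2 := hd.green e f hg
  have h3 := hd.yellow e f hp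
  rw [← hp, ← hg] at h2 h3
  rcases lt_or_gt_of_ne h1 with h | h
  exacts [h3 h h, h2 h h]

/-- Two common points would close a 4-cycle `x p z q` in the forest; its deepest vertex would have
two edges leading upwards. -/
lemma Adj.eq {x z : G} {p q : P} (hxz : x ≠ z) (h : D.Adj x z p) (h' : D.Adj x z q) : p = q := by
  obtain ⟨d, d', hd⟩ := D.exists_forestDepth
  obtain ⟨e, f, rfl, rfl, rfl, hf⟩ := h
  obtain ⟨e', f', he', hf', rfl, hp⟩ := h'
  by_contra hpq
  have h1 := hd.yellow e f hf.symm
  have h2 := hd.yellow e' f' hp.symm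
  have h3 := hd.green e e' he'.symm
  have h4 := hd.green f f' hf'.symm
  have n1 : e ≠ f := fun h => hxz (h ▸ rfl)
  have n2 : e' ≠ f' := fun h => hxz (by rw [← he', ← hf', h])
  have n3 : e ≠ e' := fun h => hpq (h ▸ rfl)
  have n4 : f ≠ f' := fun h => hpq (by rw [← hf, ← hp, h])
  have := hd.ne e
  have := hd.ne f
  have := hd.ne e'
  have := hd.ne f'
  simp only [he', hf', hf, hp, n1, n2, n3, n4, imp_false, not_lt] at *
  omega

/-- A closed walk without backtracking cannot exist in a forest: after one step away from the root,
every further step must lead away from the root. Only consecutive components and points are required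
to differ. -/
lemma adj_quad {x₁ x₂ x₃ x₄ : G} {p₁ p₂ p₃ p₄ : P} (h₁ : D.Adj x₁ x₂ p₁) (h₂ : D.Adj x₂ x₃ p₂)
    (h₃ : D.Adj x₃ x₄ p₃) (h₄ : D.Adj x₄ x₁ p₄) (hx₁ : x₁ ≠ x₂) (hx₂ : x₂ ≠ x₃) (hx₃ : x₃ ≠ x₄)
    (hx₄ : x₄ ≠ x₁) (hp₁ : p₁ ≠ p₂) (hp₂ : p₂ ≠ p₃) (hp₃ : p₃ ≠ p₄) (hp₄ : p₄ ≠ p₁) : False := by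
  obtain ⟨d, d', hd⟩ := D.exists_forestDepth
  have key : ∀ {x z : G} {p : P}, D.Adj x z p → x ≠ z →
      d x ≠ d' p ∧ d z ≠ d' p ∧ (d x < d' p → ¬ d z < d' p) := by
    rintro x z p ⟨e, f, rfl, rfl, rfl, hf⟩ hxz
    refine ⟨hd.ne e, hf ▸ hd.ne f, fun he hf' => hxz ?_⟩
    rw [hd.yellow e f hf.symm he (hf.symm ▸ hf')]
  have key' : ∀ {x y z : G} {p q : P}, D.Adj x y p → D.Adj y z q → p ≠ q →
      (d' p < d y → ¬ d' q < d y) := by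
    rintro x y z p q ⟨e, f, rfl, rfl, rfl, hf⟩ ⟨e', f', he', rfl, rfl, hf'⟩ hpq h h'
    refine hpq ?_
    rw [← hf, hd.green f e' he'.symm (hf ▸ h) (he' ▸ h')]
  have a₁ := key h₁ hx₁
  have a₂ := key h₂ hx₂
  have a₃ := key h₃ hx₃
  have a₄ := key h₄ hx₄
  have b₁ := key' h₁ h₂ hp₁
  have b₂ := key' h₂ h₃ hp₂
  have b₃ := key' h₃ h₄ hp₃
  have b₄ := key' h₄ h₁ hp₄
  clear key key'
  -- If the first step descends, the whole walk descends and cannot return; otherwise the same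
  -- argument applies to the reversed walk.
  rcases lt_or_gt_of_ne a₁.1 with h | h
  · have c1 : d' p₁ < d x₂ := by omega
    have c2 : d x₂ < d' p₂ := by have := b₁ c1; omega
    have c3 : d' p₂ < d x₃ := by have := a₂.2.2 c2; omega
    have c4 : d x₃ < d' p₃ := by have := b₂ c3; omega
    have c5 : d' p₃ < d x₄ := by have := a₃.2.2 c4; omega
    have c6 : d x₄ < d' p₄ := by have := b₃ c5; omega
    have c7 : d' p₄ < d x₁ := by have := a₄.2.2 c6; omega
    omega
  · have c1 : ¬ d' p₄ < d x₁ := fun h' => b₄ h' h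
    have c2 : ¬ d x₄ < d' p₄ := fun h' => a₄.2.2 h' (by omega)
    have c3 : ¬ d' p₃ < d x₄ := fun h' => b₃ h' (by omega)
    have c4 : ¬ d x₃ < d' p₃ := fun h' => a₃.2.2 h' (by omega)
    have c5 : ¬ d' p₂ < d x₃ := fun h' => b₂ h' (by omega)
    have c6 : ¬ d x₂ < d' p₂ := fun h' => a₂.2.2 h' (by omega)
    have c7 : ¬ d' p₁ < d x₂ := fun h' => b₁ h' (by omega)
    omega

lemma adj_tri_aux {x₁ x₂ x₃ : G} {p₁ p₂ p₃ : P} (h₁ : D.Adj x₁ x₂ p₁) (h₂ : D.Adj x₂ x₃ p₂)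
    (h₃ : D.Adj x₃ x₁ p₃) (hx₁ : x₁ ≠ x₂) (hx₂ : x₂ ≠ x₃) (hx₃ : x₃ ≠ x₁)
    (hp₁ : p₁ ≠ p₂) (hp₂ : p₂ ≠ p₃) (hp₃ : p₃ ≠ p₁) : False := by
  obtain ⟨d, d', hd⟩ := D.exists_forestDepth
  have key : ∀ {x z : G} {p : P}, D.Adj x z p → x ≠ z →
      d x ≠ d' p ∧ d z ≠ d' p ∧ (d x < d' p → ¬ d z < d' p) := by
    rintro x z p ⟨e, f, rfl, rfl, rfl, hf⟩ hxz
    refine ⟨hd.ne e, hf ▸ hd.ne f, fun he hf' => hxz ?_⟩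
    rw [hd.yellow e f hf.symm he (hf.symm ▸ hf')]
  have key' : ∀ {x y z : G} {p q : P}, D.Adj x y p → D.Adj y z q → p ≠ q →
      (d' p < d y → ¬ d' q < d y) := by
    rintro x y z p q ⟨e, f, rfl, rfl, rfl, hf⟩ ⟨e', f', he', rfl, rfl, hf'⟩ hpq h h'
    refine hpq ?_
    rw [← hf, hd.green f e' he'.symm (hf ▸ h) (he' ▸ h')]
  have a₁ := key h₁ hx₁
  have a₂ := key h₂ hx₂
  have a₃ := key h₃ hx₃
  have b₁ := key' h₁ h₂ hp₁
  have b₂ := key' h₂ h₃ hp₂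
  have b₃ := key' h₃ h₁ hp₃
  clear key key'
  omega

/-- If two of the three points coincide, all three do, because two components share at most one
point. If none do, there is a cycle of length six. -/
lemma adj_tri {x₁ x₂ x₃ : G} {p₁ p₂ p₃ : P} (h₁ : D.Adj x₁ x₂ p₁) (h₂ : D.Adj x₂ x₃ p₂)
    (h₃ : D.Adj x₃ x₁ p₃) (hx₁ : x₁ ≠ x₂) (hx₂ : x₂ ≠ x₃) (hx₃ : x₃ ≠ x₁) :
    p₁ = p₂ ∧ p₂ = p₃ := by
  have aux : ∀ {x₁ x₂ x₃ : G} {p q : P}, D.Adj x₁ x₂ p → D.Adj x₂ x₃ p → D.Adj x₃ x₁ q →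
      x₃ ≠ x₁ → p = q := by
    rintro x₁ x₂ x₃ p q ⟨e, -, he, -, hep, -⟩ ⟨-, f, -, hf, -, hfp⟩ h hx
    exact Adj.eq hx ⟨f, e, hf, he, hfp, hep⟩ h
  by_cases h12 : p₁ = p₂
  · subst h12
    exact ⟨rfl, aux h₁ h₂ h₃ hx₃⟩
  by_cases h23 : p₂ = p₃
  · subst h23
    exact absurd (aux h₂ h₃ h₁ hx₁).symm h12
  by_cases h31 : p₃ = p₁
  · subst h31
    exact absurd (aux h₃ h₁ h₂ hx₂) h12
  exact (adj_tri_aux h₁ h₂ h₃ hx₁ hx₂ hx₃ h12 h23 h31).elim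

lemma sum_le_of_three {b c a : E'} (hbc : b ≠ c) (hba : b ≠ a) (hca : c ≠ a)
    (h : D.pt' b = D.pt' c) (h' : D.pt' b = D.pt' a) :
    D.m (D.gr' b) + (D.m (D.gr' c) + D.m (D.gr' a)) ≤ 4 := by
  classical
  have := D.sum_le (D.pt' b) {b, c, a} (by simp [h, ← h'])
  rwa [Finset.sum_insert (by simp [hbc, hba]), Finset.sum_pair hca] at this

/-- The branch multiplicities would add up to at least `2 + 2 + 1 = 5`. -/
lemma not_on_three {h k l : G'} {y : P'} (hh : D.m h = 2) (hk : D.m k = 2)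
    (hhk : h ≠ k) (hhl : h ≠ l) (hkl : k ≠ l) (h1 : D.On h y) (h2 : D.On k y) (h3 : D.On l y) :
    False := by
  obtain ⟨b, hb, rfl⟩ := h1
  obtain ⟨c, hc, rfl⟩ := h2
  obtain ⟨a, ha, rfl⟩ := h3
  have := sum_le_of_three (D := D) (b := b) (c := c) (a := a) (fun h => hhk (h ▸ rfl))
    (fun h => hhl (h ▸ rfl)) (fun h => hkl (h ▸ rfl)) (hb.trans hc.symm) (hb.trans ha.symm)
  have := D.m_eq (D.gr' a)
  omega

/-- Two branches at a point of the target that include all branches of doubled components have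
preimages at a common point. -/
lemma exists_lift_of_forall {b c : E'} (hbc : b ≠ c) (h : D.pt' b = D.pt' c)
    (hd : ∀ a, D.pt' a = D.pt' b → D.m (D.gr' a) = 2 → a = b ∨ a = c) :
    ∃ e f, D.νE e = b ∧ D.νE f = c ∧ D.pt e = D.pt f := by
  by_contra! H
  obtain ⟨e, rfl⟩ := D.surjective b
  obtain ⟨f, rfl⟩ := D.surjective c
  -- The set consists of the points that carry a preimage of `b`. If no point carries preimages of
  -- both `b` and `c`, it is saturated: branches of multiplicity one have unique preimages, and the
  -- only doubled branches are among `b` and `c`. Connectedness then puts a preimage of `c` into it.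
  have := D.connected (D.νP (D.pt e)) {p | ∃ e', D.νE e' = D.νE e ∧ D.pt e' = p} ?_
    (D.pt e) (D.pt f) rfl (by rw [← D.pt'_νE, ← D.pt'_νE, h]) ⟨e, rfl, rfl⟩
  · obtain ⟨e', he', hp⟩ := this
    exact H e' f he' rfl hp
  · intro a a' haa hy
    rw [← D.pt'_νE, ← D.pt'_νE] at hy
    rcases D.m_eq (D.gr' (D.νE a)) with h1 | h2
    · rw [D.eq_of_m_eq_one a a' h1 haa]
    · rcases hd _ hy h2 with h' | h'
      · exact ⟨fun _ => ⟨a', haa ▸ h', rfl⟩, fun _ => ⟨a, h', rfl⟩⟩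
      · constructor
        · rintro ⟨e', he', hp⟩
          exact (H e' a he' h' hp).elim
        · rintro ⟨e', he', hp⟩
          exact (H e' a' he' (haa ▸ h') hp).elim

/-- A doubled branch besides `b` and `c` would raise the sum of multiplicities to at least five, so
these two already include all doubled branches at their point. -/
lemma exists_lift {b c : E'} (hbc : b ≠ c) (h : D.pt' b = D.pt' c) (hb : D.m (D.gr' b) = 2) :
    ∃ e f, D.νE e = b ∧ D.νE f = c ∧ D.pt e = D.pt f := by
  refine exists_lift_of_forall hbc h fun a ha hm => ?_
  by_contra! hne
  have := sum_le_of_three hbc hne.1.symm hne.2.symm h ha.symm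
  have := D.m_eq (D.gr' c)
  omega

lemma exists_adj_of_on {h k : G'} {y : P'} (hm : D.m h = 2) (hhk : h ≠ k) (h1 : D.On h y)
    (h2 : D.On k y) :
    ∃ x z p, D.Adj x z p ∧ D.νG x = h ∧ D.νG z = k ∧ D.νP p = y := by
  obtain ⟨b, hb, rfl⟩ := h1
  obtain ⟨c, hc, rfl⟩ := h2
  obtain ⟨e, f, rfl, rfl, hp⟩ := exists_lift (D := D) (b := b) (c := c) (fun h => hhk (h ▸ rfl))
    (hb.trans hc.symm) hm
  refine ⟨D.gr e, D.gr f, D.pt e, ⟨e, f, rfl, rfl, rfl, hp.symm⟩, (D.gr'_νE e).symm,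
    (D.gr'_νE f).symm, ?_⟩
  rw [← D.pt'_νE, hb]

lemma exists_adj {h k : G'} (hm : D.m h = 2) (hhk : h ≠ k) :
    ∃ x z p, D.Adj x z p ∧ D.νG x = h ∧ D.νG z = k := by
  obtain ⟨b, c, hp, rfl, rfl⟩ := D.meet h k hhk
  obtain ⟨x, z, p, h1, h2, h3, -⟩ := exists_adj_of_on (D := D) hm hhk ⟨b, rfl, rfl⟩
    ⟨c, hp.symm, rfl⟩
  exact ⟨x, z, p, h1, h2, h3⟩

/-- Two branches of a component with multiplicity one, at a point without doubled branches. -/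
lemma eq_of_gr'_eq_of_forall {b c : E'} (h : D.pt' b = D.pt' c) (hg : D.gr' b = D.gr' c)
    (hm : D.m (D.gr' b) = 1) (hd : ∀ a, D.pt' a = D.pt' b → D.m (D.gr' a) = 1) : b = c := by
  by_contra hbc
  obtain ⟨e, f, rfl, rfl, hp⟩ := exists_lift_of_forall hbc h
    (fun a ha h2 => by have := hd a ha; omega)
  rw [D.gr'_νE] at hm
  rw [D.gr'_νE, D.gr'_νE] at hg
  exact hbc (congrArg D.νE (eq_of_pt_eq_of_gr_eq hp (D.gr_eq_of_m_eq_one e f hm hg)))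

/-- A component of multiplicity one meets a component `h` of multiplicity two in only one branch,
if there is only one component `x` of the source that it meets over `h`. -/
lemma eq_of_gr'_eq_of_adj {a b c : E'} {x : G} (hab : D.pt' a = D.pt' b) (hac : D.pt' a = D.pt' c)
    (hg : D.gr' b = D.gr' c) (hm : D.m (D.gr' b) = 1) (ha : D.m (D.gr' a) = 2)
    (hx : ∀ e f, D.pt e = D.pt f → D.νE e = a → D.gr' (D.νE f) = D.gr' b → D.gr e = x) :
    b = c := by
  obtain ⟨e, f, he, rfl, hp⟩ := exists_lift (D := D) (b := a) (c := b)
    (fun h => by rw [h] at ha; omega) hab ha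
  obtain ⟨e', f', he', rfl, hp'⟩ := exists_lift (D := D) (b := a) (c := c)
    (fun h => by rw [h, ← hg] at ha; omega) hac ha
  have h1 := hx e f hp he rfl
  have h2 := hx e' f' hp' he' hg.symm
  have h3 : D.gr f = D.gr f' := by
    rw [D.gr'_νE] at hm
    rw [D.gr'_νE, D.gr'_νE] at hg
    exact D.gr_eq_of_m_eq_one f f' hm hg
  have hne : x ≠ D.gr f := by
    rintro rfl
    rw [D.gr'_νE, ← h1, ← D.gr'_νE, he] at hm
    omega
  have := Adj.eq hne ⟨e, f, h1, rfl, hp, rfl⟩ ⟨e', f', h2, h3.symm, hp', rfl⟩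
  exact congrArg D.νE (eq_of_pt_eq_of_gr_eq this h3)

end GluingData

/-! ### Star-shaped targets and doubled components with a single preimage -/

namespace GluingData

variable {G P E G' P' E' : Type*} {D : GluingData G P E G' P' E'}

/-- All points of the target with several branches are equal to `y`, and every component has exactly
one branch at `y`. -/
def IsStarCentre (D : GluingData G P E G' P' E') (y : P') : Prop :=
  (∀ b c, b ≠ c → D.pt' b = D.pt' c → D.pt' b = y) ∧ ∀ k, ∃! b, D.pt' b = y ∧ D.gr' b = k

/-- The branches of the target at `y` are exactly one branch of `k` and one branch of `l`. -/
def IsNode (D : GluingData G P E G' P' E') (k l : G') (y : P') : Prop :=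
  (∀ b, D.pt' b = y → D.gr' b = k ∨ D.gr' b = l) ∧
    (∃! b, D.pt' b = y ∧ D.gr' b = k) ∧ ∃! b, D.pt' b = y ∧ D.gr' b = l

/-- One branch of each component at `y` contributes at least one to a sum bounded by four. -/
lemma finite_and_card_le {y : P'} (hy : ∀ k, D.On k y) : Finite G' ∧ Nat.card G' ≤ 4 := by
  classical
  choose b hb hb' using hy
  have key : ∀ F : Finset G', F.card ≤ 4 := fun F => by
    have h := D.sum_le y (F.image b) (by simp [hb])
    rw [Finset.sum_image fun x _ z _ hxz => by rw [← hb' x, ← hb' z, hxz]] at h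
    refine le_trans ?_ h
    rw [Finset.card_eq_sum_ones]
    exact Finset.sum_le_sum fun k _ => by have := D.m_eq (D.gr' (b k)); omega
  have hfin : Finite G' := by
    by_contra hinf
    rw [not_finite_iff_infinite] at hinf
    obtain ⟨F, hF⟩ := Infinite.exists_subset_card_eq G' 5
    have := key F
    omega
  have := Fintype.ofFinite G'
  exact ⟨hfin, by rw [Nat.card_eq_fintype_card]; exact key Finset.univ⟩

/-- Without doubled branches, any two branches at a point lift to a common point. Components that
meet are therefore adjacent upstairs, where their preimages are unique. Concurrency of triangles in
the forest forces all of them through a single point. -/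
theorem isStarCentre_of_forall_m_eq_one (hm : ∀ k, D.m k = 1) :
    (Subsingleton G' ∧ ∀ b c, D.pt' b = D.pt' c → b = c) ∨
      (Nontrivial G' ∧ Finite G' ∧ Nat.card G' ≤ 4 ∧ ∃ y, D.IsStarCentre y) := by
  have huniq : ∀ b c, D.pt' b = D.pt' c → D.gr' b = D.gr' c → b = c := fun b c h h' =>
    eq_of_gr'_eq_of_forall h h' (hm _) fun _ _ => hm _
  have hlift : ∀ b c, D.gr' b ≠ D.gr' c → D.pt' b = D.pt' c →
      ∃ e f, D.νE e = b ∧ D.νE f = c ∧ D.pt e = D.pt f := fun b c hbc h =>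
    exists_lift_of_forall (fun h' => hbc (h' ▸ rfl)) h (fun a _ h2 => by have := hm (D.gr' a); omega)
  have hgr : ∀ e f, D.νG (D.gr e) = D.νG (D.gr f) → D.gr e = D.gr f := fun e f =>
    D.gr_eq_of_m_eq_one e f (hm _)
  rcases subsingleton_or_nontrivial G' with hs | hn
  · exact Or.inl ⟨hs, fun b c h => huniq b c h (Subsingleton.elim _ _)⟩
  · right
    obtain ⟨k, l, hkl⟩ := hn.exists_pair_ne
    have hadj : ∀ k l, k ≠ l → ∃ e f, D.pt e = D.pt f ∧ D.νG (D.gr e) = k ∧ D.νG (D.gr f) = l := by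
      intro k l hkl
      obtain ⟨b, c, hp, rfl, rfl⟩ := D.meet k l hkl
      obtain ⟨e, f, rfl, rfl, h⟩ := hlift b c hkl hp
      exact ⟨e, f, h, (D.gr'_νE e).symm, (D.gr'_νE f).symm⟩
    obtain ⟨e, f, hef, he, hf⟩ := hadj k l hkl
    -- Fix a point where `k` and `l` meet upstairs. Any third component forms a triangle with them
    -- and so passes through this point.
    have hall : ∀ j, ∃ e', D.pt e' = D.pt e ∧ D.νG (D.gr e') = j := by
      intro j
      by_cases hjk : k = j
      · exact ⟨e, rfl, he.trans hjk⟩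
      by_cases hjl : l = j
      · exact ⟨f, hef.symm, hf.trans hjl⟩
      obtain ⟨e₁, f₁, h₁, he₁, hf₁⟩ := hadj l j hjl
      obtain ⟨e₂, f₂, h₂, he₂, hf₂⟩ := hadj j k (Ne.symm hjk)
      have := adj_tri (D := D) (x₁ := D.gr e) (x₂ := D.gr f) (x₃ := D.gr f₁)
        ⟨e, f, rfl, rfl, rfl, hef.symm⟩ ⟨e₁, f₁, hgr _ _ (he₁.trans hf.symm), rfl, rfl, h₁.symm⟩
        ⟨e₂, f₂, hgr _ _ (he₂.trans hf₁.symm), hgr _ _ (hf₂.trans he.symm), rfl, h₂.symm⟩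
        (fun h => hkl (by rw [← he, ← hf, h])) (fun h => hjl (by rw [← hf, ← hf₁, h]))
        (fun h => hjk (by rw [← he, ← hf₁, h]))
      exact ⟨f₁, by rw [← h₁, this.1], hf₁⟩
    have hon : ∀ j, D.On j (D.νP (D.pt e)) := fun j => by
      obtain ⟨e', h, h'⟩ := hall j
      exact ⟨D.νE e', by rw [D.pt'_νE, h], by rw [D.gr'_νE, h']⟩
    obtain ⟨h1, h2⟩ := finite_and_card_le hon
    refine ⟨hn, h1, h2, D.νP (D.pt e), fun b c hbc hp => ?_, fun j => ?_⟩
    · have hne : D.gr' b ≠ D.gr' c := fun h => hbc (huniq b c hp h)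
      obtain ⟨e', f', rfl, rfl, h⟩ := hlift b c hne hp
      obtain ⟨e₁, h₁, he₁⟩ := hall (D.νG (D.gr e'))
      obtain ⟨f₁, h₁', hf₁⟩ := hall (D.νG (D.gr f'))
      rw [D.gr'_νE, D.gr'_νE] at hne
      have := Adj.eq (D := D) (fun h => hne (congrArg D.νG h)) ⟨e', f', rfl, rfl, rfl, h.symm⟩
        ⟨e₁, f₁, hgr _ _ he₁, hgr _ _ hf₁, h₁, h₁'⟩
      rw [D.pt'_νE, this]
    · obtain ⟨b, hb, hb'⟩ := hon j
      exact ⟨b, ⟨hb, hb'⟩, fun c hc => huniq c b (hc.1.trans hb.symm) (hc.2.trans hb'.symm)⟩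

section Special

variable {h : G'} (hh : D.m h = 2)
  (hs : ∀ e f, D.νG (D.gr e) = h → D.νG (D.gr f) = h → D.gr e = D.gr f)

include hh hs

lemma gr_eq_of_special {k : G'} (hk : k = h ∨ D.m k = 1) {e f : E} (he : D.νG (D.gr e) = k)
    (hf : D.νG (D.gr f) = k) : D.gr e = D.gr f := by
  rcases hk with rfl | hk
  · exact hs e f he hf
  · exact D.gr_eq_of_m_eq_one e f (by rw [he, hk]) (he.trans hf.symm)

/-- Adjacency over a component with one preimage. -/
lemma Adj.left_unique {k : G'} (hk : k = h ∨ D.m k = 1) {x x' z z' : G} {p p' : P}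
    (h1 : D.Adj x z p) (h2 : D.Adj x' z' p') (hx : D.νG x = k) (hx' : D.νG x' = k) : x = x' := by
  obtain ⟨e, -, rfl, -, -, -⟩ := h1
  obtain ⟨e', -, rfl, -, -, -⟩ := h2
  exact gr_eq_of_special hh hs hk hx hx'

/-- Two branches of `h` at one point would lift to a common point of the single component over `h`,
giving a double edge of the forest. -/
lemma eq_of_gr'_eq_special {b c : E'} (hp : D.pt' b = D.pt' c) (hb : D.gr' b = h)
    (hc : D.gr' c = h) : b = c := by
  by_contra hbc
  obtain ⟨e, f, rfl, rfl, hef⟩ := exists_lift hbc hp (by rw [hb, hh])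
  rw [D.gr'_νE] at hb hc
  exact hbc (congrArg D.νE (eq_of_pt_eq_of_gr_eq hef (hs e f hb hc)))

/-- A point on both `h` and a component `r` of multiplicity one has one branch of each of them. -/
lemma existsUnique_of_on {r : G'} {y : P'} (hr : D.m r = 1) (hy : D.On h y) (hy' : D.On r y) :
    (∃! b, D.pt' b = y ∧ D.gr' b = h) ∧ ∃! b, D.pt' b = y ∧ D.gr' b = r := by
  obtain ⟨a, ha, ha'⟩ := hy
  obtain ⟨b, hb, hb'⟩ := hy'
  refine ⟨⟨a, ⟨ha, ha'⟩, fun c hc => eq_of_gr'_eq_special hh hs (hc.1.trans ha.symm) hc.2 ha'⟩,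
    b, ⟨hb, hb'⟩, fun c hc => ?_⟩
  obtain ⟨e₀, he₀⟩ := D.surjective a
  refine (eq_of_gr'_eq_of_adj (D := D) (a := a) (x := D.gr e₀) (ha.trans hb.symm)
    (ha.trans hc.1.symm) (hb'.trans hc.2.symm) (by rw [hb', hr]) (by rw [ha', hh]) ?_).symm
  intro e f _ he _
  exact hs e e₀ (by rw [← D.gr'_νE, he, ha']) (by rw [← D.gr'_νE, he₀, ha'])

/-- The points on both `h` and a component of multiplicity one are unique. -/
lemma on_unique {k l : G'} {y y' : P'} (hk : k = h ∨ D.m k = 1) (hl : l = h ∨ D.m l = 1)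
    (hkl : k ≠ l) (hk2 : D.m k = 2) (h1 : D.On k y) (h2 : D.On l y) (h3 : D.On k y')
    (h4 : D.On l y') : y = y' := by
  obtain ⟨x, z, p, ha, hx, hz, rfl⟩ := exists_adj_of_on hk2 hkl h1 h2
  obtain ⟨x', z', p', ha', hx', hz', rfl⟩ := exists_adj_of_on hk2 hkl h3 h4
  obtain rfl := Adj.left_unique hh hs hk ha ha' hx hx'
  obtain rfl := Adj.left_unique hh hs hl ha.symm ha'.symm hz hz'
  rw [Adj.eq (fun hxz => hkl (by rw [← hx, ← hz, hxz])) ha ha']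

/-- Each reduced component meets `h` in exactly one point, since adjacency upstairs is with the
single preimage of `h`. Two reduced components that meet form a triangle with that preimage, so they
meet on `h`; hence all these points agree. -/
theorem isStarCentre_of_special (h1 : ∀ k, k ≠ h → D.m k = 1) :
    ∃ r, D.m r = 1 ∧ r ≠ h ∧ (∃ y, D.IsStarCentre y) ∧
      ((∀ k, k = h ∨ k = r) ∨ ∃ r', D.m r' = 1 ∧ r' ≠ h ∧ r' ≠ r ∧ ∀ k, k = h ∨ k = r ∨ k = r') := by
  have hor : ∀ k, k = h ∨ D.m k = 1 := fun k => or_iff_not_imp_left.mpr (h1 k)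
  obtain ⟨r, hr⟩ := D.exists_m_eq_one
  have hne : ∀ k, D.m k = 1 → h ≠ k := by rintro k hk rfl; omega
  obtain ⟨x, z, p, ha, hx, hz⟩ := exists_adj hh (hne r hr)
  have huniq : ∀ {k y y'}, k ≠ h → D.On h y → D.On k y → D.On h y' → D.On k y' → y = y' :=
    fun hk => on_unique hh hs (Or.inl rfl) (hor _) hk.symm hh
  -- a point with branches of two components other than `h` lies on `h`
  have hon : ∀ {k l y}, k ≠ h → l ≠ h → k ≠ l → D.On k y → D.On l y → D.On h y := by
    rintro k l y hk hl hkl ⟨b, hb, rfl⟩ ⟨c, hc, rfl⟩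
    by_contra hno
    obtain ⟨e, f, rfl, rfl, hp⟩ := exists_lift_of_forall (D := D) (b := b) (c := c)
      (fun h => hkl (h ▸ rfl)) (hb.trans hc.symm) fun a ha h2 => by
        rcases hor (D.gr' a) with h' | h'
        · exact (hno ⟨a, ha.trans hb, h'⟩).elim
        · omega
    obtain ⟨x₁, z₁, p₁, ha₁, hx₁, hz₁⟩ := exists_adj hh hk.symm
    obtain ⟨x₂, z₂, p₂, ha₂, hx₂, hz₂⟩ := exists_adj hh hl.symm
    obtain rfl := Adj.left_unique hh hs (hor h) ha₁ ha₂ hx₁ hx₂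
    have ha₃ : D.Adj (D.gr e) (D.gr f) (D.pt e) := ⟨e, f, rfl, rfl, rfl, hp.symm⟩
    rw [D.gr'_νE] at hz₁ hz₂
    obtain rfl := Adj.left_unique hh hs (hor _) ha₁.symm ha₃ hz₁ rfl
    obtain rfl := Adj.left_unique hh hs (hor _) ha₂.symm ha₃.symm hz₂ rfl
    have := adj_tri ha₁ ha₃ ha₂.symm (fun h' => hk (by rw [D.gr'_νE, ← h', hx₁]))
      (fun h' => hkl (by rw [D.gr'_νE, D.gr'_νE, h'])) (fun h' => hl (by rw [D.gr'_νE, h', hx₁]))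
    apply hno
    rw [← hb, D.pt'_νE, ← this.1, ← hx₁]
    exact ha₁.on_left
  have hy : D.On h (D.νP p) := hx ▸ ha.on_left
  have hy' : D.On r (D.νP p) := hz ▸ ha.on_right
  have hall : ∀ k, D.On k (D.νP p) := by
    intro k
    by_cases hkh : k = h
    · exact hkh ▸ hy
    by_cases hkr : k = r
    · exact hkr ▸ hy'
    obtain ⟨b, c, hp, hb, hc⟩ := D.meet k r hkr
    have h1 : D.On k (D.pt' b) := ⟨b, rfl, hb⟩
    have h2 : D.On r (D.pt' b) := ⟨c, hp.symm, hc⟩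
    have h3 := hon hkh (hne r hr).symm hkr h1 h2
    rwa [← huniq (hne r hr).symm h3 h2 hy hy']
  refine ⟨r, hr, (hne r hr).symm, ⟨D.νP p, ?_, ?_⟩, ?_⟩
  · intro b c hbc hp
    have hb : D.On (D.gr' b) (D.pt' b) := ⟨b, rfl, rfl⟩
    have hc : D.On (D.gr' c) (D.pt' b) := ⟨c, hp.symm, rfl⟩
    have hkey : ∀ {k}, k ≠ h → D.On h (D.pt' b) → D.On k (D.pt' b) → D.pt' b = D.νP p :=
      fun hk h1 h2 => huniq hk h1 h2 hy (hall _)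
    by_cases hbh : D.gr' b = h
    · by_cases hch : D.gr' c = h
      · exact (hbc (eq_of_gr'_eq_special hh hs hp hbh hch)).elim
      · exact hkey hch (hbh ▸ hb) hc
    · by_cases hch : D.gr' c = h
      · exact hkey hbh (hch ▸ hc) hb
      by_cases hbc' : D.gr' b = D.gr' c
      · by_cases hno : D.On h (D.pt' b)
        · exact hkey hbh hno hb
        · refine (hbc (eq_of_gr'_eq_of_forall hp hbc' (h1 _ hbh) fun a ha => h1 _ ?_)).elim
          rintro h'
          exact hno ⟨a, ha, h'⟩
      · exact hkey hbh (hon hbh hch hbc' hb hc) hb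
  · intro k
    by_cases hkh : k = h
    · subst hkh
      exact (existsUnique_of_on hh hs hr hy hy').1
    · exact (existsUnique_of_on hh hs (h1 k hkh) hy (hall k)).2
  -- Three reduced components besides `h` would give `2 + 1 + 1 + 1 = 5` at the centre.
  · by_contra! hcon
    obtain ⟨⟨r', hr'⟩, hcon⟩ := hcon
    obtain ⟨r'', hr''⟩ := hcon r' (h1 _ hr'.1) hr'.1 hr'.2
    classical
    choose b hb hb' using hall
    have hinj : Function.Injective b := fun x z hxz => by rw [← hb' x, ← hb' z, hxz]
    have := D.sum_le (D.νP p) (({h, r, r', r''} : Finset G').image b) (by simp [hb])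
    rw [Finset.sum_image fun x _ z _ hxz => hinj hxz, Finset.sum_insert, Finset.sum_insert,
      Finset.sum_pair] at this
    · simp only [hb', hh, hr, h1 _ hr'.1, h1 _ hr''.1] at this
      omega
    · exact hr''.2.2.symm
    · simp [hr'.2.symm, hr''.2.1.symm]
    · simp [hne r hr, hr'.1.symm, hr''.1.symm]

/-- The structure of a second component of multiplicity two. -/
lemma exists_pair_of_special {k r : G'} (hk : D.m k = 2) (hkh : k ≠ h) (hr : D.m r = 1) :
    ∃ g r₀ x z s q u, D.νG g = h ∧ D.νG r₀ = r ∧ D.νG x = k ∧ D.νG z = k ∧ D.Adj g r₀ s ∧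
      D.Adj r₀ x q ∧ D.Adj g z u ∧ x ≠ z ∧ (∀ e, D.νG (D.gr e) = k → D.gr e = x ∨ D.gr e = z) ∧
      s ≠ q ∧ q ≠ u ∧ u ≠ s ∧ (∀ w, ¬ D.Adj g x w) ∧ ∀ w, ¬ D.Adj r₀ z w := by
  have hne : ∀ k, D.m k = 2 → k ≠ r := by rintro k hk rfl; omega
  obtain ⟨g, r₀, s, hs', hg, hr₀⟩ := exists_adj hh (hne h hh)
  obtain ⟨x, r₁, q, hq, hx, hr₁⟩ := exists_adj hk (hne k hk)
  obtain ⟨g₁, z, u, hu, hg₁, hz⟩ := exists_adj hh hkh.symm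
  obtain rfl := Adj.left_unique hh hs (Or.inr hr) hs'.symm hq.symm hr₀ hr₁
  obtain rfl := Adj.left_unique hh hs (Or.inl rfl) hs' hu hg hg₁
  have h1 : D.On h (D.νP s) := hg ▸ hs'.on_left
  have h2 : D.On r (D.νP s) := hr₀ ▸ hs'.on_right
  have h3 : D.On r (D.νP q) := hr₀ ▸ hq.on_right
  have h4 : D.On k (D.νP q) := hx ▸ hq.on_left
  have h5 : D.On h (D.νP u) := hg ▸ hu.on_left
  have h6 : D.On k (D.νP u) := hz ▸ hu.on_right
  have hcon : ∀ {y}, D.On h y → D.On k y → D.On r y → False := fun a b c =>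
    not_on_three hh hk hkh.symm (hne h hh) (hne k hk) a b c
  have n1 : g ≠ r₀ := by rintro rfl; exact hne h hh (hg ▸ hr₀)
  have nr : ∀ {x}, D.νG x = k → r₀ ≠ x := by rintro _ h' rfl; exact hne k hk (h' ▸ hr₀)
  have ng : ∀ {x}, D.νG x = k → x ≠ g := by rintro _ h' rfl; exact hkh (h'.symm.trans hg)
  -- A preimage of `k` adjacent to both `g` and `r₀` would make the triangle concurrent, placing
  -- `h`, `k` and `r` on one point.
  have c1 : ∀ {x w w'}, D.νG x = k → D.Adj r₀ x w → D.Adj g x w' → False := by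
    intro x w w' hx' hw hw'
    have := adj_tri hs' hw hw'.symm n1 (nr hx') (ng hx')
    refine hcon h1 ?_ h2
    rw [this.1, ← hx']
    exact hw.on_right
  have hxz : x ≠ z := by
    rintro rfl
    exact c1 hx hq.symm hu
  refine ⟨g, r₀, x, z, s, q, u, hg, hr₀, hx, hz, hs', hq.symm, hu, hxz, fun e he => ?_, ?_, ?_, ?_,
    fun w hw => c1 hx hq.symm hw, fun w hw => c1 hz hw hu⟩
  · obtain ⟨e₁, -, rfl, -, -, -⟩ := hq
    obtain ⟨-, e₂, -, rfl, -, -⟩ := hu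
    rcases D.gr_eq_of_three e e₁ e₂ (he.trans hx.symm) (he.trans hz.symm) with h' | h' | h'
    exacts [Or.inl h', Or.inr h', (hxz h').elim]
  · rintro rfl; exact hcon h1 h4 h2
  · rintro rfl; exact hcon h5 h6 h3
  · rintro rfl; exact hcon h1 h6 h2

end Special

end GluingData

/-! ### The hexagon, and reduction of branch failure to a doubled component with a single preimage
-/

namespace GluingData

variable {G P E G' P' E' : Type*} {D : GluingData G P E G' P' E'}

/-- Upstairs the preimages form a path `x`, `r₀`, `g`, `z`, with `x` and `z` over `k`, `r₀` over `r`
and `g` over `h`. Its three meeting points have distinct images, and acyclicity of the forest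
excludes any further meeting point or component. -/
theorem isNode_of_special {h k : G'} (hh : D.m h = 2)
    (hs : ∀ e f, D.νG (D.gr e) = h → D.νG (D.gr f) = h → D.gr e = D.gr f)
    (hk : D.m k = 2) (hkh : k ≠ h) :
    ∃ r, D.m r = 1 ∧ (∀ l, l = h ∨ l = k ∨ l = r) ∧ ∃ y₁ y₂ y₃, D.IsNode h r y₁ ∧
      D.IsNode k r y₂ ∧ D.IsNode h k y₃ ∧
      ∀ b c, b ≠ c → D.pt' b = D.pt' c → D.pt' b = y₁ ∨ D.pt' b = y₂ ∨ D.pt' b = y₃ := by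
  obtain ⟨r, hr⟩ := D.exists_m_eq_one
  have hne : ∀ k, D.m k = 2 → k ≠ r := by rintro k hk rfl; omega
  have hhr := hne h hh
  have hkr := hne k hk
  obtain ⟨g, r₀, x, z, s, q, u, hg, hr₀, hx, hz, hgr, hrx, hgz, hxz, hor, hsq, hqu, hus, hgx, hrz⟩ :=
    exists_pair_of_special hh hs hk hkh hr
  have hgr0 : g ≠ r₀ := by rintro rfl; exact hhr (hg ▸ hr₀)
  have hr0 : ∀ {x}, D.νG x = k → r₀ ≠ x := by rintro _ h' rfl; exact hkr (h' ▸ hr₀)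
  have hg0 : ∀ {x}, D.νG x = k → x ≠ g := by rintro _ h' rfl; exact hkh (h'.symm.trans hg)
  have ymem : ∀ {x' w w'}, D.νG x' = k → D.Adj x' w w' → x' = x ∨ x' = z := by
    rintro x' w w' hx' ⟨e, -, rfl, -, -, -⟩
    exact hor e hx'
  have hsh : D.On h (D.νP s) := hg ▸ hgr.on_left
  have hsr : D.On r (D.νP s) := hr₀ ▸ hgr.on_right
  have hqr : D.On r (D.νP q) := hr₀ ▸ hrx.on_left
  have hqk : D.On k (D.νP q) := hx ▸ hrx.on_right
  have huh : D.On h (D.νP u) := hg ▸ hgz.on_left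
  have huk : D.On k (D.νP u) := hz ▸ hgz.on_right
  have hcon : ∀ {y}, D.On h y → D.On k y → D.On r y → False := fun a b c =>
    not_on_three hh hk hkh.symm hhr hkr a b c
  have hall : ∀ l, l = h ∨ l = k ∨ l = r := by
    intro l
    by_contra! hl
    obtain ⟨hlh, hlk, hlr⟩ := hl
    rcases D.m_eq l with hl | hl
    -- A second reduced component `l` would again have `x` next to its preimage `r₁` and `r₁` next
    -- to `g`, closing the quadrilateral `r₀`, `x`, `r₁`, `g`.
    · obtain ⟨g', r₁, x', z', s', q', u', hg', hr₁, hx', hz', hgr', hrx', hgz', hxz', -, hsq', -, -,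
        -, -⟩ := exists_pair_of_special hh hs hk hkh hl
      obtain rfl := Adj.left_unique hh hs (Or.inl rfl) hgr hgr' hg hg'
      obtain rfl : z' = z := (ymem hz' hgz'.symm).resolve_left (by rintro rfl; exact hgx _ hgz')
      obtain rfl : x' = x := (ymem hx' hrx'.symm).resolve_right hxz'
      have hrr : r₁ ≠ r₀ := by rintro rfl; exact hlr (by rw [← hr₁, hr₀])
      have hgr1 : r₁ ≠ g := by rintro rfl; exact hlh (by rw [← hr₁, hg])
      have hxr1 : x' ≠ r₁ := by rintro rfl; exact hlk (by rw [← hr₁, hx])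
      refine adj_quad hrx hrx'.symm hgr'.symm hgr (hr0 hx) hxr1 hgr1 hgr0 ?_ hsq'.symm ?_ hsq
      · rintro rfl
        obtain ⟨e, -, he, -, hp, -⟩ := hrx
        obtain ⟨e', -, he', -, hp', -⟩ := hrx'
        have := adj_tri hgr.symm hgr' ⟨e', e, he', he, hp', hp⟩ hgr0.symm hgr1.symm hrr
        exact hsq (this.1.trans this.2)
      · rintro rfl
        obtain ⟨-, e, -, he, -, hp⟩ := hgr
        obtain ⟨-, e', -, he', -, hp'⟩ := hgr'
        have := adj_tri hrx hrx'.symm ⟨e', e, he', he, hp', hp⟩ (hr0 hx) hxr1 hrr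
        exact hsq (this.1.trans this.2).symm
    -- A third doubled component `l` has its own pair `x'` next to `r₀` and `z'` next to `g`. Since
    -- `k` and `l` meet, one of `x`, `z` is adjacent to one of `x'`, `z'`; each case gives a
    -- concurrent triangle or a quadrilateral.
    · obtain ⟨g', r₁, x', z', s', q', u', hg', hr₁, hx', hz', hgr', hrx', hgz', hxz', hor', hsq', hqu',
        hus', hgx', hrz'⟩ := exists_pair_of_special hh hs hl hlh hr
      obtain rfl := Adj.left_unique hh hs (Or.inl rfl) hgr hgr' hg hg'
      obtain rfl := Adj.left_unique hh hs (Or.inr hr) hgr.symm hgr'.symm hr₀ hr₁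
      obtain rfl := Adj.eq hgr0 hgr hgr'
      obtain ⟨a, c, v, hac, ha, hc⟩ := exists_adj hk hlk.symm
      have hvk : D.On k (D.νP v) := ha ▸ hac.on_left
      have hvl : D.On l (D.νP v) := hc ▸ hac.on_right
      have hql' : D.On l (D.νP q') := hx' ▸ hrx'.on_right
      have hqr' : D.On r (D.νP q') := hr₁ ▸ hrx'.on_left
      have hul' : D.On l (D.νP u') := hz' ▸ hgz'.on_right
      have huh' : D.On h (D.νP u') := hg' ▸ hgz'.on_left
      have hca : c = x' ∨ c = z' := by
        obtain ⟨-, e, -, rfl, -, -⟩ := hac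
        exact hor' e hc
      have nac : a ≠ c := by rintro rfl; exact hlk (by rw [← ha, hc])
      have nrc : c ≠ r₀ := by rintro rfl; exact hlr (by rw [← hc, hr₀])
      have ngc : c ≠ g := by rintro rfl; exact hlh (by rw [← hc, hg])
      have hkl := hlk.symm
      rcases ymem ha hac with rfl | rfl <;> rcases hca with rfl | rfl
      · have := adj_tri hrx hac hrx'.symm (hr0 ha) nac nrc
        rw [← this.1] at hvl
        exact not_on_three hk hl hkl hkr hlr hqk hvl hqr
      · refine adj_quad hrx.symm hgr.symm hgz' hac.symm (hr0 ha).symm hgr0.symm ngc.symm nac.symm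
          hsq.symm hus'.symm ?_ ?_
        · rintro rfl
          exact not_on_three hh hk hkh.symm hlh.symm hkl huh' hvk hvl
        · rintro rfl
          exact not_on_three hk hl hkl hkr hlr hqk hvl hqr
      · refine adj_quad hgz.symm hgr hrx' hac.symm (hg0 ha) hgr0 nrc.symm nac.symm hus hsq' ?_ ?_
        · rintro rfl
          exact not_on_three hk hl hkl hkr hlr hvk hvl hqr'
        · rintro rfl
          exact not_on_three hh hk hkh.symm hlh.symm hkl huh huk hvl
      · have := adj_tri hgz hac hgz'.symm (hg0 ha).symm nac ngc
        rw [← this.1] at hvl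
        exact not_on_three hh hk hkh.symm hlh.symm hkl huh huk hvl
  have hws : ∀ {w}, D.On h w → D.On r w → w = D.νP s := fun h1 h2 =>
    on_unique hh hs (Or.inl rfl) (Or.inr hr) hhr hh h1 h2 hsh hsr
  have hwq : ∀ {w}, D.On k w → D.On r w → w = D.νP q := fun h1 h2 => by
    obtain ⟨a, c, p, hac, ha, hc, rfl⟩ := exists_adj_of_on hk hkr h1 h2
    obtain rfl := Adj.left_unique hh hs (Or.inr hr) hrx hac.symm hr₀ hc
    rcases ymem ha hac with rfl | rfl
    · rw [Adj.eq (hr0 hx) hrx hac.symm]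
    · exact (hrz _ hac.symm).elim
  have hwu : ∀ {w}, D.On h w → D.On k w → w = D.νP u := fun h1 h2 => by
    obtain ⟨a, c, p, hac, ha, hc, rfl⟩ := exists_adj_of_on hh hkh.symm h1 h2
    obtain rfl := Adj.left_unique hh hs (Or.inl rfl) hgr hac hg ha
    rcases ymem hc hac.symm with rfl | rfl
    · exact (hgx _ hac).elim
    · rw [Adj.eq (hg0 hz).symm hgz hac]
  -- Two different doubled branches leave no room for a branch of a third kind at the same point.
  have hsum : ∀ {b c a}, D.pt' b = D.pt' c → D.pt' b = D.pt' a → D.m (D.gr' b) = 2 →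
      D.m (D.gr' c) = 2 → D.gr' a ≠ D.gr' b → D.gr' a ≠ D.gr' c → b = c := by
    intro b c a h1 h2 h3 h4 h5 h6
    by_contra hbc
    have := sum_le_of_three hbc (fun h => h5 (h ▸ rfl)) (fun h => h6 (h ▸ rfl)) h1 h2
    have := D.m_eq (D.gr' a)
    omega
  refine ⟨r, hr, hall, D.νP s, D.νP q, D.νP u, ⟨?_, existsUnique_of_on hh hs hr hsh hsr⟩,
    ⟨?_, ?_, ?_⟩, ⟨?_, ?_, ?_⟩, ?_⟩
  · intro b hb
    rcases hall (D.gr' b) with h' | h' | h'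
    exacts [Or.inl h', (hcon hsh ⟨b, hb, h'⟩ hsr).elim, Or.inr h']
  · intro b hb
    rcases hall (D.gr' b) with h' | h' | h'
    exacts [(hcon ⟨b, hb, h'⟩ hqk hqr).elim, Or.inl h', Or.inr h']
  · obtain ⟨b, hb, hb'⟩ := hqk
    obtain ⟨a, ha, ha'⟩ := hqr
    exact ⟨b, ⟨hb, hb'⟩, fun c hc => hsum (hc.1.trans hb.symm) (hc.1.trans ha.symm)
      (by rw [hc.2, hk]) (by rw [hb', hk]) (by rw [ha', hc.2]; exact hkr.symm)
      (by rw [ha', hb']; exact hkr.symm)⟩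
  · obtain ⟨b, hb, hb'⟩ := hqk
    obtain ⟨a, ha, ha'⟩ := hqr
    refine ⟨a, ⟨ha, ha'⟩, fun c hc => ?_⟩
    refine eq_of_gr'_eq_of_adj (D := D) (a := b) (x := x) (hb.trans hc.1.symm) (hb.trans ha.symm)
      (hc.2.trans ha'.symm) (by rw [hc.2, hr]) (by rw [hb', hk]) ?_
    intro e f hp he hf
    rw [hc.2, D.gr'_νE] at hf
    have hadj : D.Adj (D.gr e) (D.gr f) (D.pt f) := ⟨e, f, rfl, rfl, hp, rfl⟩
    have hrf := Adj.left_unique hh hs (Or.inr hr) hrx hadj.symm hr₀ hf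
    refine (hor e (by rw [← D.gr'_νE, he, hb'])).resolve_right fun hez => ?_
    rw [← hrf, hez] at hadj
    exact hrz _ hadj.symm
  · intro b hb
    rcases hall (D.gr' b) with h' | h' | h'
    exacts [Or.inl h', Or.inr h', (hcon huh huk ⟨b, hb, h'⟩).elim]
  · obtain ⟨b, hb, hb'⟩ := huh
    obtain ⟨a, ha, ha'⟩ := huk
    exact ⟨b, ⟨hb, hb'⟩, fun c hc => hsum (hc.1.trans hb.symm) (hc.1.trans ha.symm)
      (by rw [hc.2, hh]) (by rw [hb', hh]) (by rw [ha', hc.2]; exact hkh) (by rw [ha', hb']; exact hkh)⟩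
  · obtain ⟨b, hb, hb'⟩ := huh
    obtain ⟨a, ha, ha'⟩ := huk
    exact ⟨a, ⟨ha, ha'⟩, fun c hc => hsum (hc.1.trans ha.symm) (hc.1.trans hb.symm)
      (by rw [hc.2, hk]) (by rw [ha', hk]) (by rw [hb', hc.2]; exact hkh.symm)
      (by rw [ha', hb']; exact hkh.symm)⟩
  · intro b c hbc hp
    have onb : D.On (D.gr' b) (D.pt' b) := ⟨b, rfl, rfl⟩
    have onc : D.On (D.gr' c) (D.pt' b) := ⟨c, hp.symm, rfl⟩
    rcases hall (D.gr' b) with hb | hb | hb <;> rcases hall (D.gr' c) with hc | hc | hc <;>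
      rw [hb] at onb <;> rw [hc] at onc
    · exact (hbc (eq_of_gr'_eq_special hh hs hp hb hc)).elim
    · exact Or.inr (Or.inr (hwu onb onc))
    · exact Or.inl (hws onb onc)
    · exact Or.inr (Or.inr (hwu onc onb))
    -- Two branches of `k` at one point lift to a common point of the components `x` and `z`, since
    -- no component has two branches at a point. This closes the path `x`, `r₀`, `g`, `z` to a
    -- quadrilateral.
    · exfalso
      obtain ⟨e, f, rfl, rfl, hef⟩ := exists_lift hbc hp (by rw [hb, hk])
      have hb' := hb
      have hc' := hc
      rw [D.gr'_νE] at hb' hc'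
      have hne' : D.gr e ≠ D.gr f := fun h' =>
        hbc (congrArg D.νE (eq_of_pt_eq_of_gr_eq hef h'))
      have hzx : D.Adj z x (D.pt e) := by
        rcases hor e hb' with h1 | h1 <;> rcases hor f hc' with h2 | h2
        · exact (hne' (h1.trans h2.symm)).elim
        · exact ⟨f, e, h2, h1, hef.symm, rfl⟩
        · exact ⟨e, f, h1, h2, rfl, hef.symm⟩
        · exact (hne' (h1.trans h2.symm)).elim
      refine adj_quad hgr.symm hgz hzx hrx.symm hgr0.symm (hg0 hz).symm hxz.symm (hr0 hx).symm
        hus.symm ?_ ?_ hsq.symm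
      · rintro rfl
        obtain ⟨a, ha, ha'⟩ := huh
        exact hbc (hsum hp (by rw [ha, D.pt'_νE]) (by rw [hb, hk]) (by rw [hc, hk])
          (by rw [ha', hb]; exact hkh.symm) (by rw [ha', hc]; exact hkh.symm))
      · rintro rfl
        obtain ⟨a, ha, ha'⟩ := hqr
        exact hbc (hsum hp (by rw [ha, D.pt'_νE]) (by rw [hb, hk]) (by rw [hc, hk])
          (by rw [ha', hb]; exact hkr.symm) (by rw [ha', hc]; exact hkr.symm))
    · exact Or.inr (Or.inl (hwq onb onc))
    · exact Or.inl (hws onc onb)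
    · exact Or.inr (Or.inl (hwq onc onb))
    · by_cases h1 : D.On h (D.pt' b)
      · exact Or.inl (hws h1 onb)
      by_cases h2 : D.On k (D.pt' b)
      · exact Or.inr (Or.inl (hwq h2 onb))
      refine (hbc (eq_of_gr'_eq_of_forall hp (hb.trans hc.symm) (by rw [hb, hr]) fun a ha => ?_)).elim
      rcases hall (D.gr' a) with h' | h' | h'
      exacts [(h1 ⟨a, ha, h'⟩).elim, (h2 ⟨a, ha, h'⟩).elim, by rw [h', hr]]

open Classical in
/-- Gluing two components of the source along two branches at the root that have the same image. -/
noncomputable def contract (D : GluingData G P E G' P' E') (e₁ e₂ : E) (hp : D.pt e₁ = D.pt e₂) (hne : e₁ ≠ e₂)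
    (hν : D.νE e₁ = D.νE e₂) (d : G → ℕ) (d' : P → ℕ) (hd : IsForestDepth D.gr D.pt d d')
    (hd0 : ∀ e, d' (D.pt e) = 0 → D.pt e = D.pt e₁)
    (h1 : d (D.gr e₁) = 1) (h2 : d (D.gr e₂) = 1) :
    GluingData G P {e // e ≠ e₂} G' P' E' where
  gr e := if D.gr e = D.gr e₂ then D.gr e₁ else D.gr e
  pt e := D.pt e
  gr' := D.gr'
  pt' := D.pt'
  νG := D.νG
  νP := D.νP
  νE e := D.νE e
  m := D.m
  gr'_νE e := by
    split_ifs with h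
    · rw [D.gr'_νE, h, ← D.gr'_νE, ← hν, D.gr'_νE]
    · exact D.gr'_νE e
  pt'_νE e := D.pt'_νE e
  surjective b := by
    obtain ⟨e, rfl⟩ := D.surjective b
    by_cases h : e = e₂
    · exact ⟨⟨e₁, hne⟩, hν.trans (congrArg D.νE h.symm)⟩
    · exact ⟨⟨e, h⟩, rfl⟩
  m_eq := D.m_eq
  eq_of_m_eq_one e f h h' := Subtype.ext (D.eq_of_m_eq_one e f h h')
  gr_eq_of_m_eq_one e f h h' := by
    have h12 : D.νG (D.gr e₁) = D.νG (D.gr e₂) := by rw [← D.gr'_νE, hν, D.gr'_νE]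
    have key : ∀ e, D.νG (if D.gr e = D.gr e₂ then D.gr e₁ else D.gr e) = D.νG (D.gr e) := by
      intro e
      split_ifs with h
      · rw [h, h12]
      · rfl
    rw [key] at h
    rw [key, key] at h'
    rw [D.gr_eq_of_m_eq_one e f h h']
  gr_eq_of_three e f g h h' := by
    have h12 : D.νG (D.gr e₁) = D.νG (D.gr e₂) := by rw [← D.gr'_νE, hν, D.gr'_νE]
    have key : ∀ e, D.νG (if D.gr e = D.gr e₂ then D.gr e₁ else D.gr e) = D.νG (D.gr e) := by
      intro e
      split_ifs with h
      · rw [h, h12]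
      · rfl
    rw [key, key] at h h'
    rcases D.gr_eq_of_three e f g h h' with h | h | h <;> simp [h]
  -- The omitted branch `e₂` has the same point and the same image as `e₁`, so `e₁` replaces it in
  -- every saturation condition.
  connected y S hS := D.connected y S fun e f hef hy => by
    have hS' : ∀ a, a ≠ e₂ → ∀ c, c ≠ e₂ → D.νE a = D.νE c → D.νP (D.pt a) = y →
        (D.pt a ∈ S ↔ D.pt c ∈ S) := fun a ha c hc => hS ⟨a, ha⟩ ⟨c, hc⟩
    by_cases he : e = e₂ <;> by_cases hf : f = e₂
    · rw [he, hf]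
    · have := hS' e₁ hne f hf ((hν.trans (congrArg D.νE he.symm)).trans hef) (by rw [hp, ← he, hy])
      rwa [he, ← hp]
    · have := hS' e he e₁ hne (hef.trans ((congrArg D.νE hf).trans hν.symm)) hy
      rwa [hf, ← hp]
    · exact hS' e he f hf hef hy
  sum_le := D.sum_le
  meet := D.meet
  exists_m_eq_one := D.exists_m_eq_one
  -- The old depth functions still work. Both glued components have depth one, so a branch of either
  -- that leads upwards ends at the root and is `e₁` or `e₂`; only `e₁` is kept.
  exists_forestDepth := by
    have key : ∀ e, d (if D.gr e = D.gr e₂ then D.gr e₁ else D.gr e) = d (D.gr e) := by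
      intro e
      split_ifs with h
      · rw [h, h1, h2]
      · rfl
    have hroot' : ∀ {e}, D.gr e = D.gr e₁ ∨ D.gr e = D.gr e₂ → d' (D.pt e) < d (D.gr e) →
        e = e₁ ∨ e = e₂ := by
      rintro e h hlt
      have h0 : d (D.gr e) = 1 := by rcases h with h | h <;> rw [h] <;> assumption
      have hpe := hd0 e (by omega)
      refine h.imp (eq_of_pt_eq_of_gr_eq hpe) (eq_of_pt_eq_of_gr_eq (hpe.trans hp))
    refine ⟨d, d', ?_, ?_, ?_⟩
    · intro e
      simpa only [key] using hd.ne e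
    · intro e f h he hf
      simp only [key] at he hf
      by_cases ha : D.gr e = D.gr e₁ ∨ D.gr e = D.gr e₂
      · have hb : D.gr f = D.gr e₁ ∨ D.gr f = D.gr e₂ := by
          by_cases hf2 : D.gr f = D.gr e₂
          · exact Or.inr hf2
          · rw [if_neg hf2] at h
            left
            rw [← h]
            split_ifs with he2
            · rfl
            · exact ha.resolve_right he2
        exact Subtype.ext (((hroot' ha he).resolve_right e.2).trans
          ((hroot' hb hf).resolve_right f.2).symm)
      · rw [not_or] at ha
        have hf2 : D.gr f ≠ D.gr e₂ := by
          intro hf2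
          rw [if_neg ha.2, if_pos hf2] at h
          exact ha.1 h
        rw [if_neg ha.2, if_neg hf2] at h
        exact Subtype.ext (hd.green e f h he hf)
    · intro e f h he hf
      simp only [key] at he hf
      exact Subtype.ext (hd.yellow e f h he hf)

/-- The hypothesis that a doubled component of the target is seen by the source. -/
def HasFailure (D : GluingData G P E G' P' E') : Prop :=
  (∃ h, D.m h = 2 ∧ ∀ e f, D.νG (D.gr e) = h → D.νG (D.gr f) = h → D.gr e = D.gr f) ∨
    ∃ e₁ e₂, e₁ ≠ e₂ ∧ D.pt e₁ = D.pt e₂ ∧ D.νE e₁ = D.νE e₂ ∧ ∃ d d',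
      IsForestDepth D.gr D.pt d d' ∧ (∀ e, d' (D.pt e) = 0 → D.pt e = D.pt e₁) ∧
      d (D.gr e₁) = 1 ∧ d (D.gr e₂) = 1

/-- The possible shapes of the target with at least one doubled component. -/
def DoubledShape (D : GluingData G P E G' P' E') : Prop :=
  (∃ h r, D.m h = 2 ∧ D.m r = 1 ∧ r ≠ h ∧ (∃ y, D.IsStarCentre y) ∧
    ((∀ k, k = h ∨ k = r) ∨ ∃ r', D.m r' = 1 ∧ r' ≠ h ∧ r' ≠ r ∧ ∀ k, k = h ∨ k = r ∨ k = r')) ∨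
  ∃ h k r, D.m h = 2 ∧ D.m k = 2 ∧ k ≠ h ∧ D.m r = 1 ∧ (∀ l, l = h ∨ l = k ∨ l = r) ∧
    ∃ y₁ y₂ y₃, D.IsNode h r y₁ ∧ D.IsNode k r y₂ ∧ D.IsNode h k y₃ ∧
      ∀ b c, b ≠ c → D.pt' b = D.pt' c → D.pt' b = y₁ ∨ D.pt' b = y₂ ∨ D.pt' b = y₃

lemma doubledShape_of_special {h : G'} (hh : D.m h = 2)
    (hs : ∀ e f, D.νG (D.gr e) = h → D.νG (D.gr f) = h → D.gr e = D.gr f) : D.DoubledShape := by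
  by_cases H : ∃ k, D.m k = 2 ∧ k ≠ h
  · obtain ⟨k, hk, hkh⟩ := H
    obtain ⟨r, hr, h1, h2⟩ := isNode_of_special hh hs hk hkh
    exact Or.inr ⟨h, k, r, hh, hk, hkh, hr, h1, h2⟩
  · push Not at H
    obtain ⟨r, hr, h1, h2⟩ := isStarCentre_of_special hh hs fun k hk =>
      (D.m_eq k).resolve_right fun h' => hk (H k h')
    exact Or.inl ⟨h, r, hh, hr, h1, h2⟩

/-- Two identified branches at a point belong to two different components over the same doubled
component, hence to all of its preimages that carry branches. After `contract` only one of them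
remains, and the target has not changed. -/
theorem HasFailure.doubledShape (hD : D.HasFailure) : D.DoubledShape := by
  rcases hD with ⟨h, hh, hs⟩ | ⟨e₁, e₂, hne, hp, hν, d, d', hd, hd0, h1, h2⟩
  · exact doubledShape_of_special hh hs
  · have hm : D.m (D.νG (D.gr e₁)) = 2 := by
      refine (D.m_eq _).resolve_left fun h => hne (D.eq_of_m_eq_one e₁ e₂ ?_ hν)
      rwa [D.gr'_νE]
    have h12 : D.νG (D.gr e₁) = D.νG (D.gr e₂) := by rw [← D.gr'_νE, hν, D.gr'_νE]
    have hg : D.gr e₁ ≠ D.gr e₂ := fun h => hne (eq_of_pt_eq_of_gr_eq hp h)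
    refine doubledShape_of_special (D := D.contract e₁ e₂ hp hne hν d d' hd hd0 h1 h2)
      (h := D.νG (D.gr e₁)) hm fun e f he hf => ?_
    have key : ∀ e : {e // e ≠ e₂},
        D.νG ((D.contract e₁ e₂ hp hne hν d d' hd hd0 h1 h2).gr e) = D.νG (D.gr e₁) →
        (D.contract e₁ e₂ hp hne hν d d' hd hd0 h1 h2).gr e = D.gr e₁ := by
      intro e he
      simp only [contract] at he ⊢
      split_ifs at he ⊢ with h
      · rfl
      · rcases D.gr_eq_of_three e e₁ e₂ he (he.trans h12) with h' | h' | h'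
        exacts [h', (h h').elim, (hg h').elim]
    exact (key e he).trans (key f hf).symm

end GluingData

/-! ## Completions of Noetherian local rings -/

namespace AdicCompletion

lemma mem_pow_iff {R : Type*} [CommRing R] {I : Ideal R} (hI : I.FG) {n : ℕ}
    {x : AdicCompletion I R} :
    x ∈ I.map (algebraMap R (AdicCompletion I R)) ^ n ↔ evalₐ I n x = 0 := by
  have h1 : x ∈ (eval I R n).ker ↔ x ∈ I.map (algebraMap R (AdicCompletion I R)) ^ n := by
    rw [← pow_smul_top_eq_ker_eval hI, Ideal.smul_top_eq_map, Ideal.map_pow]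
    rfl
  rw [← h1, LinearMap.mem_ker]
  constructor
  · intro h
    rw [← factor_eval_eq_evalₐ I x (le_of_eq (Ideal.mul_top _)), h, _root_.map_zero]
  · intro h
    rw [← factor_evalₐ_eq_eval I x (le_of_eq (Ideal.mul_top _).symm), h, _root_.map_zero]

lemma exists_sub_mem_pow {R : Type*} [CommRing R] {I : Ideal R} (hI : I.FG) (n : ℕ)
    (x : AdicCompletion I R) :
    ∃ r, x - algebraMap R _ r ∈ I.map (algebraMap R (AdicCompletion I R)) ^ n := by
  obtain ⟨r, hr⟩ := Ideal.Quotient.mk_surjective (evalₐ I n x)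
  refine ⟨r, ?_⟩
  rw [mem_pow_iff hI, map_sub, algebraMap_apply, Algebra.algebraMap_self_apply, evalₐ_of, hr,
    sub_self]

lemma isHausdorff_map {R : Type*} [CommRing R] {I : Ideal R} (hI : I.FG) :
    IsHausdorff (I.map (algebraMap R (AdicCompletion I R))) (AdicCompletion I R) :=
  (isAdicComplete_self I hI).toIsHausdorff

lemma factorPow_comp_quotientMap_comp_evalₐ {S R : Type*} [CommRing S] [CommRing R] {J : Ideal S}
    {I : Ideal R} (φ : S →+* R) (hle : ∀ n, J ^ n ≤ (I ^ n).comap φ) {m n : ℕ} (hmn : m ≤ n) :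
    (Ideal.Quotient.factorPow I hmn).comp ((Ideal.quotientMap (I ^ n) φ (hle n)).comp
      (evalₐ J n : AdicCompletion J S →+* S ⧸ J ^ n)) = (Ideal.quotientMap (I ^ m) φ (hle m)).comp
      (evalₐ J m : AdicCompletion J S →+* S ⧸ J ^ m) := by
  ext x
  obtain ⟨s, rfl⟩ := mk_surjective _ _ x
  have hs : Ideal.Quotient.mk (J ^ m) (s.val n) = Ideal.Quotient.mk (J ^ m) (s.val m) := by
    have h := s.property hmn
    rw [SModEq.sub_mem] at h
    rw [eq_comm, Ideal.Quotient.eq]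
    simpa using h
  have hs' := congrArg (Ideal.quotientMap (I ^ m) φ (hle m)) hs
  simpa [evalₐ_mk] using hs'

lemma pow_le_comap_pow {S R : Type*} [CommRing S] [CommRing R] {J : Ideal S} {I : Ideal R}
    (φ : S →+* R) (h : J ≤ I.comap φ) (n : ℕ) : J ^ n ≤ (I ^ n).comap φ :=
  (Ideal.pow_right_mono h n).trans (Ideal.le_comap_pow φ n)

/-- The map of adic completions that is induced by a ring homomorphism. -/
noncomputable def mapRingHom {S R : Type*} [CommRing S] [CommRing R] {J : Ideal S} {I : Ideal R}
    (φ : S →+* R) (h : J ≤ I.comap φ) : AdicCompletion J S →+* AdicCompletion I R :=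
  liftRingHom I (fun n => (Ideal.quotientMap (I ^ n) φ (pow_le_comap_pow φ h n)).comp
      (evalₐ J n : AdicCompletion J S →+* S ⧸ J ^ n))
    (factorPow_comp_quotientMap_comp_evalₐ φ (pow_le_comap_pow φ h))

lemma evalₐ_mapRingHom {S R : Type*} [CommRing S] [CommRing R] {J : Ideal S} {I : Ideal R}
    (φ : S →+* R) (h : J ≤ I.comap φ) (n : ℕ) (x : AdicCompletion J S) {s : S}
    (hs : evalₐ J n x = Ideal.Quotient.mk _ s) :
    evalₐ I n (mapRingHom φ h x) = Ideal.Quotient.mk _ (φ s) := by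
  refine (evalₐ_liftRingHom I _
    (factorPow_comp_quotientMap_comp_evalₐ φ (pow_le_comap_pow φ h)) n x).trans ?_
  rw [RingHom.comp_apply]
  erw [hs]
  rfl

lemma mapRingHom_algebraMap {S R : Type*} [CommRing S] [CommRing R] {J : Ideal S} {I : Ideal R}
    (φ : S →+* R) (h : J ≤ I.comap φ) (s : S) :
    mapRingHom φ h (algebraMap S _ s) = algebraMap R _ (φ s) := by
  refine ext_evalₐ fun n => ?_
  rw [evalₐ_mapRingHom φ h n _ (s := s)]
  · rw [algebraMap_apply, Algebra.algebraMap_self_apply, evalₐ_of]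
  · rw [algebraMap_apply, Algebra.algebraMap_self_apply, evalₐ_of]

lemma mapRingHom_comp {S R T : Type*} [CommRing S] [CommRing R] [CommRing T] {J : Ideal S}
    {I : Ideal R} {K : Ideal T} (φ : S →+* R) (h : J ≤ I.comap φ) (ψ : R →+* T)
    (h' : I ≤ K.comap ψ) (h'' : J ≤ K.comap (ψ.comp φ)) :
    (mapRingHom ψ h').comp (mapRingHom φ h) = mapRingHom (ψ.comp φ) h'' := by
  ext1 x
  refine ext_evalₐ fun n => ?_
  obtain ⟨s, hs⟩ := Ideal.Quotient.mk_surjective (evalₐ J n x)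
  rw [RingHom.comp_apply, evalₐ_mapRingHom ψ h' n _ (evalₐ_mapRingHom φ h n x hs.symm),
    evalₐ_mapRingHom _ h'' n x hs.symm]
  rfl

/-- The source is complete and the target separated, so it is enough to check surjectivity modulo
the ideal, where it follows from that of `φ`. -/
lemma mapRingHom_surjective {S R : Type*} [CommRing S] [CommRing R] {J : Ideal S} {I : Ideal R}
    (φ : S →+* R) (hφ : Function.Surjective φ) (h : J ≤ I.comap φ) (hJ : J.FG) (hI : J.map φ = I) :
    Function.Surjective (mapRingHom φ h) := by
  have hI' : I.FG := hI ▸ hJ.map φ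
  have hc : IsAdicComplete _ _ := isAdicComplete_self J hJ
  have hmap : (J.map (algebraMap S (AdicCompletion J S))).map (mapRingHom φ h) =
      I.map (algebraMap R _) := by
    rw [Ideal.map_map, show (mapRingHom φ h).comp (algebraMap S _) = (algebraMap R _).comp φ from
      RingHom.ext (mapRingHom_algebraMap φ h), ← Ideal.map_map, hI]
  have hH : IsHausdorff ((J.map (algebraMap S (AdicCompletion J S))).map (mapRingHom φ h))
      (AdicCompletion I R) := hmap ▸ isHausdorff_map hI'
  refine surjective_of_mk_map_comp_surjective
    (I := J.map (algebraMap S (AdicCompletion J S))) _ fun x => ?_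
  obtain ⟨x, rfl⟩ := Ideal.Quotient.mk_surjective x
  obtain ⟨r, hr⟩ := exists_sub_mem_pow hI' 1 x
  obtain ⟨s, rfl⟩ := hφ r
  refine ⟨algebraMap S _ s, ?_⟩
  rw [RingHom.comp_apply, mapRingHom_algebraMap, eq_comm, Ideal.Quotient.eq, hmap]
  simpa using hr

/-- Sending variables to generators of `I` presents the completion as a quotient of a power series
ring over `R`. -/
lemma isNoetherianRing {R : Type*} [CommRing R] [IsNoetherianRing R] (I : Ideal R) :
    IsNoetherianRing (AdicCompletion I R) := by
  have hI : I.FG := IsNoetherian.noetherian I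
  obtain ⟨n, s, hs⟩ := Submodule.fg_iff_exists_fin_generating_family.mp hI
  let J := MvPolynomial.idealOfVars (Fin n) R
  let φ : MvPolynomial (Fin n) R →+* R := (MvPolynomial.aeval s : _ →ₐ[R] R)
  have hJ : J.map φ = I := by
    change Ideal.map _ (Ideal.span _) = _
    rw [Ideal.map_span, ← hs, ← Set.range_comp]
    congr
    ext i
    simp [φ]
  have : IsNoetherianRing (AdicCompletion J (MvPolynomial (Fin n) R)) :=
    isNoetherianRing_of_ringEquiv _
      (MvPowerSeries.toAdicCompletionAlgEquiv (Fin n) R).toRingEquiv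
  exact isNoetherianRing_of_surjective _ _ _ (mapRingHom_surjective φ
    (fun r => ⟨MvPolynomial.C r, by simp [φ]⟩) (Ideal.map_le_iff_le_comap.mp hJ.le)
    (MvPolynomial.idealOfVars_fg _ _) hJ)

/-- The kernel of the map of completions induced by a surjection of Noetherian local rings. -/
lemma ker_mapRingHom {S R : Type*} [CommRing S] [CommRing R] [IsNoetherianRing S] [IsLocalRing S]
    {I : Ideal R} (φ : S →+* R) (hφ : Function.Surjective φ)
    (h : maximalIdeal S ≤ I.comap φ) (hI : (maximalIdeal S).map φ = I) :
    RingHom.ker (mapRingHom φ h) =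
      (RingHom.ker φ).map (algebraMap S (AdicCompletion (maximalIdeal S) S)) := by
  have := isNoetherianRing (maximalIdeal S)
  apply le_antisymm
  · intro x hx
    rw [RingHom.mem_ker] at hx
    let K := (RingHom.ker φ).map (algebraMap S (AdicCompletion (maximalIdeal S) S))
    -- By Krull's theorem the quotient by `K` is separated, so it suffices to approximate `x` by
    -- elements of `K` modulo every power of the maximal ideal.
    have hH : IsHausdorff (maximalIdeal (AdicCompletion (maximalIdeal S) S))
      (AdicCompletion (maximalIdeal S) S ⧸ K) := inferInstance
    rw [← Ideal.Quotient.eq_zero_iff_mem]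
    refine hH.haus' _ fun n => ?_
    rw [SModEq.zero]
    obtain ⟨s, hs⟩ := exists_sub_mem_pow (IsNoetherian.noetherian (maximalIdeal S)) n x
    rw [← maximalIdeal_eq_map] at hs
    have h1 : evalₐ (maximalIdeal S) n x = Ideal.Quotient.mk _ s := by
      rw [maximalIdeal_eq_map, mem_pow_iff (IsNoetherian.noetherian (maximalIdeal S)), map_sub,
        algebraMap_apply, Algebra.algebraMap_self_apply, evalₐ_of, sub_eq_zero] at hs
      exact hs
    have h2 := evalₐ_mapRingHom φ h n x h1
    rw [hx, _root_.map_zero, eq_comm, Ideal.Quotient.eq_zero_iff_mem, ← hI, ← Ideal.map_pow,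
      Ideal.mem_map_iff_of_surjective φ hφ] at h2
    obtain ⟨s', hs', hss⟩ := h2
    have h3 : algebraMap S (AdicCompletion (maximalIdeal S) S) (s - s') ∈ K :=
      Ideal.mem_map_of_mem _ (by rw [RingHom.mem_ker, map_sub, hss, sub_self])
    have h4 : x - algebraMap S _ (s - s') ∈
        maximalIdeal (AdicCompletion (maximalIdeal S) S) ^ n := by
      rw [map_sub, ← sub_add]
      refine Ideal.add_mem _ hs ?_
      rw [maximalIdeal_eq_map, ← Ideal.map_pow]
      exact Ideal.mem_map_of_mem _ hs'
    have h5 : Ideal.Quotient.mk K x = (x - algebraMap S _ (s - s')) • (1 : _ ⧸ K) := by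
      rw [Algebra.smul_def, mul_one, ← sub_eq_zero]
      change Ideal.Quotient.mk K x - Ideal.Quotient.mk K _ = 0
      rw [← map_sub, sub_sub_cancel, Ideal.Quotient.eq_zero_iff_mem]
      exact h3
    rw [h5]
    exact Submodule.smul_mem_smul h4 trivial
  · rw [Ideal.map_le_iff_le_comap]
    intro s hs
    rw [RingHom.mem_ker] at hs
    rw [Ideal.mem_comap, RingHom.mem_ker, mapRingHom_algebraMap, hs, _root_.map_zero]

end AdicCompletion

lemma completionMap_eq {A B : Type u} [CommRing A] [CommRing B] [IsLocalRing A] [IsLocalRing B]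
    (φ : A →+* B) [IsLocalHom φ] :
    completionMap φ = AdicCompletion.mapRingHom φ (IsLocalRing.maximalIdeal_comap φ).ge := rfl

/-! ### Minimal primes of the completion of a one-dimensional local ring -/

/-- Going-down holds for flat extensions: a smaller prime below would lift to a prime inside `b`. -/
lemma Ideal.comap_mem_minimalPrimes_of_flat {A B : Type*} [CommRing A] [CommRing B] [Algebra A B]
    [Module.Flat A B] {b : Ideal B} (hb : b ∈ minimalPrimes B) :
    b.comap (algebraMap A B) ∈ minimalPrimes A := by
  have := hb.1.1
  refine ⟨⟨inferInstance, bot_le⟩, fun q hq hle => ?_⟩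
  have := hq.1
  obtain ⟨P, hP, hP', hPq⟩ := Ideal.exists_ideal_le_liesOver_of_le (p := q)
    (q := b.comap (algebraMap A B)) b hle
  have := hb.2 ⟨hP', bot_le⟩ hP
  rw [hPq.over]
  exact Ideal.comap_mono this

section OneDimensional

variable {R : Type u} [CommRing R] [IsNoetherianRing R] [IsLocalRing R]

/-- The completion again has dimension one. Branches thus become exactly the nonmaximal primes of
the completed local ring, a description that is easier to transport along ring maps. -/
lemma mem_minimalPrimes_completion_iff (h0 : maximalIdeal R ∉ minimalPrimes R)
    (h1 : ∀ q : Ideal R, q.IsPrime → q ≠ maximalIdeal R → q ∈ minimalPrimes R)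
    {b : Ideal (AdicCompletion (maximalIdeal R) R)} :
    b ∈ minimalPrimes (AdicCompletion (maximalIdeal R) R) ↔
      b.IsPrime ∧ b ≠ maximalIdeal (AdicCompletion (maximalIdeal R) R) := by
  have hN := AdicCompletion.isNoetherianRing (maximalIdeal R)
  constructor
  · intro hb
    refine ⟨hb.1.1, ?_⟩
    rintro rfl
    have := Ideal.comap_mem_minimalPrimes_of_flat (A := R) hb
    rw [show (maximalIdeal (AdicCompletion (maximalIdeal R) R)).comap (algebraMap R _) =
      maximalIdeal R from maximalIdeal_comap _] at this
    exact h0 this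
  -- Prime avoidance yields a parameter `x`. The maximal ideal of the completion is minimal over
  -- `x`, hence of height at most one by the principal ideal theorem.
  · rintro ⟨hb, hne⟩
    obtain ⟨x, hx, hxm⟩ : ∃ x ∈ maximalIdeal R, ∀ q ∈ minimalPrimes R, x ∉ q := by
      by_contra! H
      have : (maximalIdeal R : Set R) ⊆ ⋃ q ∈ minimalPrimes R, (q : Set R) := by
        intro x hx
        obtain ⟨q, hq, hxq⟩ := H x hx
        exact Set.mem_biUnion hq hxq
      obtain ⟨q, hq, hle⟩ := (Ideal.subset_union_prime_finite
        (Ideal.finite_minimalPrimes_of_isNoetherianRing R ⊥) (f := id) ⊥ ⊥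
        (fun q hq _ _ => hq.1.1)).mp this
      have hq' : q = maximalIdeal R :=
        le_antisymm (le_maximalIdeal hq.1.1.ne_top) hle
      exact h0 (hq' ▸ hq)
    let x' := algebraMap R (AdicCompletion (maximalIdeal R) R) x
    have hmin : maximalIdeal (AdicCompletion (maximalIdeal R) R) ∈
        (Ideal.span {x'}).minimalPrimes := by
      refine ⟨⟨inferInstance, ?_⟩, fun p hp _ => ?_⟩
      · rw [Ideal.span_singleton_le_iff_mem, AdicCompletion.maximalIdeal_eq_map]
        exact Ideal.mem_map_of_mem _ hx
      · have := hp.1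
        have hxp : x ∈ p.comap (algebraMap R _) := hp.2 (Ideal.mem_span_singleton_self x')
        have hpm : p.comap (algebraMap R _) = maximalIdeal R := by
          by_contra hne'
          exact hxm _ (h1 _ inferInstance hne') hxp
        rw [AdicCompletion.maximalIdeal_eq_map, Ideal.map_le_iff_le_comap, hpm]
    have hh := Ideal.height_le_one_of_isPrincipal_of_mem_minimalPrimes (Ideal.span {x'}) _ hmin
    refine ⟨⟨hb, bot_le⟩, fun p hp hpb => ?_⟩
    by_contra hbp
    have hp' := hp.1
    have h2 : p < b := lt_of_le_not_ge hpb hbp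
    have h3 : b < maximalIdeal _ := lt_of_le_of_ne (le_maximalIdeal hb.ne_top) hne
    have h4 := Ideal.height_add_one_le_of_lt_of_isPrime h2
    have h5 := Ideal.height_add_one_le_of_lt_of_isPrime h3
    have h6 : (p.height + 1) + 1 ≤ 1 := (add_le_add_left h4 1).trans (h5.trans hh)
    have h7 : (1 : ℕ∞) + 1 ≤ 1 := le_trans (by gcongr; exact le_add_self) h6
    exact absurd h7 (by norm_num)

end OneDimensional

lemma SModEq.map_pow_smul_top {R M N : Type*} [CommRing R] {I : Ideal R} [AddCommGroup M]
    [Module R M] [AddCommGroup N] [Module R N] (g : M →ₗ[R] N) (n : ℕ) {x y : M}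
    (h : x ≡ y [SMOD (I ^ n • ⊤ : Submodule R M)]) :
    g x ≡ g y [SMOD (I ^ n • ⊤ : Submodule R N)] := by
  refine (h.map g).mono ?_
  rw [Submodule.map_smul'']
  exact Submodule.smul_mono le_rfl le_top

lemma IsPrecomplete.of_linearEquiv {R M N : Type*} [CommRing R] {I : Ideal R} [AddCommGroup M]
    [Module R M] [AddCommGroup N] [Module R N] (e : M ≃ₗ[R] N) [IsPrecomplete I N] :
    IsPrecomplete I M where
  prec' f hf := by
    obtain ⟨L, hL⟩ := IsPrecomplete.prec (I := I) (M := N) inferInstance (f := fun n => e (f n))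
      fun {m n} hmn => (hf hmn).map_pow_smul_top e.toLinearMap m
    refine ⟨e.symm L, fun n => ?_⟩
    simpa using (hL n).map_pow_smul_top e.symm.toLinearMap n

/-! ### Completing a finite extension: a product of complete local rings -/

section Semilocal

variable (A B : Type u) [CommRing A] [IsLocalRing A] [IsNoetherianRing A] [CommRing B]
  [Algebra A B] (E : Type u) [CommRing E] [IsLocalRing E] [Algebra A E] [Algebra B E]
  [IsScalarTower A B E] [IsLocalHom (algebraMap A E)]

/-- The completion of a local ring with respect to its maximal ideal. -/
abbrev LocalCompletion (A : Type u) [CommRing A] [IsLocalRing A] : Type u :=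
  AdicCompletion (maximalIdeal A) A

/-- The map from the base change of `B` to the completion of `A` to the completion of a local
ring `E` over `B`. -/
noncomputable def tensorToCompletion : LocalCompletion A ⊗[A] B →ₐ[A] LocalCompletion E :=
  Algebra.TensorProduct.lift
    { completionMap (algebraMap A E) with
      commutes' := fun a => by
        change completionMap (algebraMap A E) _ = _
        rw [completionMap_eq, AdicCompletion.mapRingHom_algebraMap]
        rfl }
    ((IsScalarTower.toAlgHom A E (LocalCompletion E)).comp (IsScalarTower.toAlgHom A B E))
    fun _ _ => Commute.all _ _

lemma tensorToCompletion_tmul (a : LocalCompletion A) (b : B) :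
    tensorToCompletion A B E (a ⊗ₜ b) =
      completionMap (algebraMap A E) a * algebraMap E _ (algebraMap B E b) := rfl

lemma tensorToCompletion_includeLeft (a : LocalCompletion A) :
    tensorToCompletion A B E (algebraMap _ _ a) = completionMap (algebraMap A E) a := by
  rw [Algebra.TensorProduct.algebraMap_apply, Algebra.algebraMap_self_apply,
    tensorToCompletion_tmul, map_one, map_one, mul_one]

lemma tensorToCompletion_includeRight (b : B) :
    tensorToCompletion A B E (1 ⊗ₜ b) = algebraMap E _ (algebraMap B E b) := by
  rw [tensorToCompletion_tmul, map_one, one_mul]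

variable [Module.Finite A B]

/-- A prime of `E` containing `maximalIdeal A` contracts to a prime of `B` over the maximal ideal of
`A`. By integrality this prime is maximal, and it lies in `P`, so it equals `P`. -/
lemma exists_pow_maximalIdeal_le [IsNoetherianRing B] (P : Ideal B) [P.IsMaximal]
    [IsLocalization.AtPrime E P] :
    ∃ k, maximalIdeal E ^ k ≤ (maximalIdeal A).map (algebraMap A E) := by
  have hN : IsNoetherianRing E := IsLocalization.isNoetherianRing P.primeCompl E ‹_›
  have hle : maximalIdeal E ≤ ((maximalIdeal A).map (algebraMap A E)).radical := by
    rw [Ideal.radical_eq_sInf]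
    refine le_sInf fun Q hQ => ?_
    have := hQ.2
    have h1 : Q.comap (algebraMap B E) ≤ P := by
      rw [← IsLocalization.AtPrime.under_maximalIdeal E P]
      exact Ideal.comap_mono (le_maximalIdeal this.ne_top)
    have h2 : maximalIdeal A ≤ (Q.comap (algebraMap B E)).comap (algebraMap A B) := by
      rw [Ideal.comap_comap, ← IsScalarTower.algebraMap_eq, ← Ideal.map_le_iff_le_comap]
      exact hQ.1
    have h3 : (Q.comap (algebraMap B E)).comap (algebraMap A B) = maximalIdeal A :=
      le_antisymm (le_maximalIdeal (Ideal.IsPrime.ne_top inferInstance)) h2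
    have h4 : (Q.comap (algebraMap B E)).IsMaximal :=
      Ideal.isMaximal_of_isIntegral_of_isMaximal_comap (R := A) _ (by rw [h3]; infer_instance)
    have h5 := h4.eq_of_le (Ideal.IsPrime.ne_top inferInstance) h1
    rw [← IsLocalization.map_under P.primeCompl E Q, Ideal.under_def, h5, IsLocalization.AtPrime.map_eq_maximalIdeal]
  exact Ideal.exists_pow_le_of_le_radical_of_fg hle (IsNoetherian.noetherian _)

/-- Elements outside the maximal ideal `P` are already invertible modulo `P ^ k`. -/
lemma exists_sub_algebraMap_mem_pow (P : Ideal B) [P.IsMaximal] [IsLocalization.AtPrime E P]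
    (k : ℕ) (y : E) : ∃ b, y - algebraMap B E b ∈ maximalIdeal E ^ k := by
  obtain ⟨b, s, rfl⟩ := IsLocalization.exists_mk'_eq P.primeCompl y
  have h1 : IsCoprime (P ^ k) (Ideal.span {(s : B)}) := by
    refine IsCoprime.pow_left ?_
    rw [Ideal.isCoprime_iff_sup_eq]
    refine ‹P.IsMaximal›.out.2 _ (lt_of_le_of_ne le_sup_left fun h => s.2 ?_)
    exact h.ge (Ideal.mem_sup_right (Ideal.mem_span_singleton_self _))
  obtain ⟨p, hp, q, hq, hpq⟩ := Ideal.isCoprime_iff_exists.mp h1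
  obtain ⟨c, rfl⟩ := Ideal.mem_span_singleton'.mp hq
  refine ⟨b * c, ?_⟩
  have h2 : IsLocalization.mk' E b s - algebraMap B E (b * c) =
      IsLocalization.mk' E b s * algebraMap B E p := by
    have : IsLocalization.mk' E b s * algebraMap B E s = algebraMap B E b :=
      IsLocalization.mk'_spec E b s
    have h3 : algebraMap B E p + algebraMap B E c * algebraMap B E s = 1 := by
      rw [← map_mul, ← map_add, hpq, map_one]
    rw [map_mul, ← this]
    linear_combination (-IsLocalization.mk' E b s) * h3
  rw [h2]
  refine Ideal.mul_mem_left _ _ ?_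
  rw [← IsLocalization.AtPrime.map_eq_maximalIdeal P E, ← Ideal.map_pow]
  exact Ideal.mem_map_of_mem _ hp

/-- For the topology of `maximalIdeal A` the tensor product is complete, because `B` is finite, and
the target is separated. Surjectivity modulo `maximalIdeal A` holds because `B` approximates `E`. -/
lemma tensorToCompletion_surjective (P : Ideal B) [P.IsMaximal] [IsLocalization.AtPrime E P] :
    Function.Surjective (tensorToCompletion A B E) := by
  have hNB : IsNoetherianRing B := IsNoetherianRing.of_finite A B
  have hN : IsNoetherianRing E := IsLocalization.isNoetherianRing P.primeCompl E ‹_›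
  have : IsAdicComplete (maximalIdeal A) (AdicCompletion (maximalIdeal A) B) :=
    AdicCompletion.isAdicComplete (IsNoetherian.noetherian _)
  have hP : IsPrecomplete (maximalIdeal A) (LocalCompletion A ⊗[A] B) :=
    IsPrecomplete.of_linearEquiv ((AdicCompletion.ofTensorProductEquivOfFiniteNoetherian
      (maximalIdeal A) B).restrictScalars A)
  obtain ⟨k, hk⟩ := exists_pow_maximalIdeal_le A B E P
  have hH : IsHausdorff (maximalIdeal A) (LocalCompletion E) := by
    have := AdicCompletion.isHausdorff_map (IsNoetherian.noetherian (maximalIdeal E))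
    have : IsHausdorff (maximalIdeal E) (LocalCompletion E) :=
      IsHausdorff.map_algebraMap_iff.mp this
    exact IsHausdorff.of_map (J := maximalIdeal E)
      (Ideal.map_le_iff_le_comap.mpr (maximalIdeal_comap (algebraMap A E)).ge)
  refine surjective_of_mkQ_comp_surjective (I := maximalIdeal A)
    (f := (tensorToCompletion A B E).toLinearMap) fun x => ?_
  obtain ⟨x, rfl⟩ := Submodule.mkQ_surjective _ x
  obtain ⟨y, hy⟩ := AdicCompletion.exists_sub_mem_pow (IsNoetherian.noetherian (maximalIdeal E)) k x
  obtain ⟨b, hb⟩ := exists_sub_algebraMap_mem_pow B E P k y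
  refine ⟨1 ⊗ₜ b, ?_⟩
  rw [LinearMap.comp_apply, eq_comm, Submodule.mkQ_apply, Submodule.mkQ_apply,
    Submodule.Quotient.eq, Ideal.smul_top_eq_map, Submodule.restrictScalars_mem]
  change x - tensorToCompletion A B E (1 ⊗ₜ b) ∈ _
  rw [tensorToCompletion_includeRight, ← sub_add_sub_cancel x (algebraMap E _ y), ← map_sub]
  have hle : ∀ z ∈ maximalIdeal E ^ k, algebraMap E (LocalCompletion E) z ∈
      (maximalIdeal A).map (algebraMap A (LocalCompletion E)) := by
    intro z hz
    rw [IsScalarTower.algebraMap_eq A E (LocalCompletion E), ← Ideal.map_map]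
    exact Ideal.mem_map_of_mem _ (hk hz)
  refine Ideal.add_mem _ ?_ (hle _ hb)
  rw [← Ideal.map_pow] at hy
  have hle' : (maximalIdeal E ^ k).map (algebraMap E (LocalCompletion E)) ≤
      (maximalIdeal A).map (algebraMap A (LocalCompletion E)) := Ideal.map_le_iff_le_comap.mpr hle
  exact hle' hy

end Semilocal

section Semilocal

variable (A B : Type u) [CommRing A] [IsLocalRing A] [IsNoetherianRing A] [CommRing B]
  [Algebra A B] [Module.Finite A B]

lemma faithfullyFlat_localCompletion : Module.FaithfullyFlat A (LocalCompletion A) :=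
  Module.FaithfullyFlat.of_flat_of_isLocalHom

lemma exists_sub_includeRight_mem_pow (n : ℕ) (d : LocalCompletion A ⊗[A] B) :
    ∃ b : B, d - 1 ⊗ₜ b ∈ (maximalIdeal A).map (algebraMap A (LocalCompletion A ⊗[A] B)) ^ n := by
  induction d with
  | zero => exact ⟨0, by simp⟩
  | tmul a b =>
    obtain ⟨r, hr⟩ := AdicCompletion.exists_sub_mem_pow (IsNoetherian.noetherian (maximalIdeal A)) n a
    refine ⟨r • b, ?_⟩
    have h : a ⊗ₜ[A] b - 1 ⊗ₜ (r • b) =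
        algebraMap (LocalCompletion A) (LocalCompletion A ⊗[A] B)
          (a - algebraMap A (LocalCompletion A) r) * 1 ⊗ₜ b := by
      rw [Algebra.TensorProduct.algebraMap_apply, Algebra.algebraMap_self_apply,
        Algebra.TensorProduct.tmul_mul_tmul, mul_one, one_mul, TensorProduct.sub_tmul,
        Algebra.algebraMap_eq_smul_one, TensorProduct.smul_tmul]
    rw [h]
    refine Ideal.mul_mem_right _ _ ?_
    rw [IsScalarTower.algebraMap_eq A (LocalCompletion A), ← Ideal.map_map, ← Ideal.map_pow]
    exact Ideal.mem_map_of_mem _ hr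
  | add x y hx hy =>
    obtain ⟨b, hb⟩ := hx
    obtain ⟨c, hc⟩ := hy
    refine ⟨b + c, ?_⟩
    rw [TensorProduct.tmul_add, add_sub_add_comm]
    exact Ideal.add_mem _ hb hc

variable {ι : Type u} (P : ι → Ideal B) [∀ i, (P i).IsMaximal] (E : ι → Type u)
  [∀ i, CommRing (E i)] [∀ i, IsLocalRing (E i)] [∀ i, Algebra A (E i)] [∀ i, Algebra B (E i)]
  [∀ i, IsScalarTower A B (E i)] [∀ i, IsLocalHom (algebraMap A (E i))]
  [∀ i, IsLocalization.AtPrime (E i) (P i)] [∀ i, IsNoetherianRing (E i)]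

/-- Membership in an ideal is local: a maximal ideal containing the colon ideal of `b` would be one
of the `P i`. -/
lemma Ideal.mem_of_forall_isLocalization_atPrime (hP : ∀ M : Ideal B, M.IsMaximal → ∃ i, P i = M)
    {J : Ideal B} {b : B} (h : ∀ i, algebraMap B (E i) b ∈ J.map (algebraMap B (E i))) : b ∈ J := by
  by_contra hb
  obtain ⟨M, hM, hle⟩ := Ideal.exists_le_maximal (J.colon {b}) (by
    rw [Ne, Ideal.eq_top_iff_one, Submodule.mem_colon_singleton, one_smul]
    exact hb)
  obtain ⟨i, rfl⟩ := hP M hM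
  obtain ⟨⟨a, s⟩, h1⟩ := (IsLocalization.mem_map_algebraMap_iff (P i).primeCompl (E i)).mp (h i)
  rw [← map_mul, IsLocalization.eq_iff_exists (P i).primeCompl] at h1
  obtain ⟨c, hc⟩ := h1
  refine (c * s).2 (hle ?_)
  rw [Submodule.mem_colon_singleton, smul_eq_mul, Submonoid.coe_mul, mul_assoc, mul_comm (s : B), hc]
  exact Ideal.mul_mem_left _ _ a.2

/-- An element of all kernels is approximated by some `b : B`, whose images lie in powers of
`maximalIdeal A` extended to the completions. Faithful flatness descends this to each `E i`,
localness to `B`, and Krull's intersection theorem concludes. -/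
lemma iInf_ker_tensorToCompletion (hP : ∀ M : Ideal B, M.IsMaximal → ∃ i, P i = M) :
    ⨅ i, RingHom.ker (tensorToCompletion A B (E i)) = ⊥ := by
  have hNA := AdicCompletion.isNoetherianRing (maximalIdeal A)
  rw [eq_bot_iff]
  intro d hd
  rw [Ideal.mem_iInf] at hd
  refine IsHausdorff.haus (I := maximalIdeal (LocalCompletion A)) inferInstance d fun n => ?_
  rw [SModEq.zero, Ideal.smul_top_eq_map, Submodule.restrictScalars_mem,
    AdicCompletion.maximalIdeal_eq_map, Ideal.map_pow, Ideal.map_map,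
    ← IsScalarTower.algebraMap_eq]
  obtain ⟨b, hb⟩ := exists_sub_includeRight_mem_pow A B n d
  suffices h : b ∈ (maximalIdeal A ^ n).map (algebraMap A B) by
    rw [← sub_add_cancel d (1 ⊗ₜ b)]
    refine Ideal.add_mem _ hb ?_
    have := Ideal.mem_map_of_mem (Algebra.TensorProduct.includeRight (R := A)
      (A := LocalCompletion A) (B := B)).toRingHom h
    rw [Ideal.map_map, Ideal.map_pow] at this
    convert! this
    exact (AlgHom.comp_algebraMap (Algebra.TensorProduct.includeRight (R := A)
      (A := LocalCompletion A) (B := B))).symm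
  refine Ideal.mem_of_forall_isLocalization_atPrime B P E hP fun i => ?_
  have hff := faithfullyFlat_localCompletion (E i)
  rw [Ideal.map_map, ← IsScalarTower.algebraMap_eq,
    ← Ideal.comap_map_eq_self_of_faithfullyFlat (B := LocalCompletion (E i))
      ((maximalIdeal A ^ n).map (algebraMap A (E i))), Ideal.mem_comap, Ideal.map_map,
    ← IsScalarTower.algebraMap_eq, ← tensorToCompletion_includeRight A B (E i), Ideal.map_pow]
  have h1 := Ideal.mem_map_of_mem (tensorToCompletion A B (E i)) hb
  rw [Ideal.map_pow] at h1
  have h2 : ((maximalIdeal A).map (algebraMap A (LocalCompletion A ⊗[A] B))).map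
      (tensorToCompletion A B (E i)) =
      (maximalIdeal A).map (algebraMap A (LocalCompletion (E i))) := by
    rw [← AlgHom.comp_algebraMap (tensorToCompletion A B (E i)), ← Ideal.map_map]
    rfl
  rw [h2, map_sub, show tensorToCompletion A B (E i) d = 0 from hd i, zero_sub, neg_mem_iff] at h1
  exact h1

lemma comap_maximalIdeal_includeRight (i : ι) :
    (maximalIdeal (LocalCompletion (E i))).comap ((tensorToCompletion A B (E i)).toRingHom.comp
      (Algebra.TensorProduct.includeRight (R := A) (A := LocalCompletion A) (B := B)).toRingHom) =
      P i := by
  have : (tensorToCompletion A B (E i)).toRingHom.comp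
      (Algebra.TensorProduct.includeRight (R := A) (A := LocalCompletion A) (B := B)).toRingHom =
      (algebraMap (E i) (LocalCompletion (E i))).comp (algebraMap B (E i)) := by
    refine RingHom.ext fun b => ?_
    exact tensorToCompletion_includeRight A B (E i) b
  rw [this, ← Ideal.comap_comap, maximalIdeal_comap]
  exact IsLocalization.AtPrime.under_maximalIdeal (E i) (P i)

/-- A maximal ideal above the kernel for `i` contracts to `P i` in `B`, so it cannot also lie above
the kernel for another index. -/
lemma isCoprime_ker_tensorToCompletion (hP : Function.Injective P) :
    Pairwise (Function.onFun IsCoprime fun i => RingHom.ker (tensorToCompletion A B (E i))) := by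
  intro i j hij
  rw [Function.onFun, Ideal.isCoprime_iff_sup_eq]
  by_contra h
  obtain ⟨M, hM, hle⟩ := Ideal.exists_le_maximal _ h
  have key : ∀ i, RingHom.ker (tensorToCompletion A B (E i)) ≤ M →
      M.comap (Algebra.TensorProduct.includeRight (R := A) (A := LocalCompletion A)
        (B := B)).toRingHom = P i := by
    intro i hi
    have hs := tensorToCompletion_surjective A B (E i) (P i)
    have h1 : (M.map (tensorToCompletion A B (E i)).toRingHom).comap
        (tensorToCompletion A B (E i)).toRingHom = M :=
      (Ideal.comap_map_of_surjective' _ hs M).trans (sup_eq_left.mpr hi)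
    have h2 : M.map (tensorToCompletion A B (E i)).toRingHom = maximalIdeal _ := by
      refine eq_maximalIdeal ?_
      refine Ideal.IsMaximal.map_of_surjective_of_ker_le hs hi
    rw [← h1, h2, Ideal.comap_comap]
    exact comap_maximalIdeal_includeRight A B P E i
  exact hij (hP ((key i (le_sup_left.trans hle)).symm.trans (key j (le_sup_right.trans hle))))

lemma exists_ker_tensorToCompletion_le [Finite ι]
    (hP : ∀ M : Ideal B, M.IsMaximal → ∃ i, P i = M) (Q : Ideal (LocalCompletion A ⊗[A] B))
    [Q.IsPrime] : ∃ i, RingHom.ker (tensorToCompletion A B (E i)) ≤ Q := by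
  have := Fintype.ofFinite ι
  have h : (Finset.univ.inf fun i => RingHom.ker (tensorToCompletion A B (E i))) ≤ Q := by
    rw [Finset.inf_univ_eq_iInf, iInf_ker_tensorToCompletion A B P E hP]
    exact bot_le
  obtain ⟨i, -, hi⟩ := (Ideal.IsPrime.inf_le' ‹_›).mp h
  exact ⟨i, hi⟩

/-- The Chinese remainder theorem prescribes the values; idempotency can be tested on the factors
since the kernels intersect in zero. -/
lemma exists_idempotent_tensorToCompletion [Finite ι] (hP : Function.Injective P)
    (hP' : ∀ M : Ideal B, M.IsMaximal → ∃ i, P i = M) (S : Set ι) :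
    ∃ e : LocalCompletion A ⊗[A] B, e * e = e ∧ (∀ i ∈ S, tensorToCompletion A B (E i) e = 1) ∧
      ∀ i ∉ S, tensorToCompletion A B (E i) e = 0 := by
  classical
  obtain ⟨e, he⟩ := Ideal.quotientInfToPiQuotient_surj
    (isCoprime_ker_tensorToCompletion A B P E hP)
    (fun i => if i ∈ S then 1 else 0)
  obtain ⟨e, rfl⟩ := Ideal.Quotient.mk_surjective e
  have h1 : ∀ i ∈ S, tensorToCompletion A B (E i) e = 1 := by
    intro i hi
    have := congrFun he i
    rw [Ideal.quotientInfToPiQuotient_mk', if_pos hi, ← map_one (Ideal.Quotient.mk _),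
      Ideal.Quotient.eq, RingHom.mem_ker, map_sub, map_one, sub_eq_zero] at this
    exact this
  have h2 : ∀ i ∉ S, tensorToCompletion A B (E i) e = 0 := by
    intro i hi
    have := congrFun he i
    rw [Ideal.quotientInfToPiQuotient_mk', if_neg hi,
      Ideal.Quotient.eq_zero_iff_mem, RingHom.mem_ker] at this
    exact this
  refine ⟨e, ?_, h1, h2⟩
  rw [← sub_eq_zero, ← Ideal.mem_bot, ← iInf_ker_tensorToCompletion A B P E hP', Ideal.mem_iInf]
  intro i
  rw [RingHom.mem_ker, map_sub, map_mul]
  by_cases hi : i ∈ S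
  · rw [h1 i hi, mul_one, sub_self]
  · rw [h2 i hi, mul_zero, sub_self]

end Semilocal

/-! ### Connectedness -/

lemma Ideal.exists_pow_le_of_forall_prime {R : Type*} [CommRing R] [IsLocalRing R]
    [IsNoetherianRing R] {I : Ideal R}
    (h : ∀ b : Ideal R, b.IsPrime → b ≠ maximalIdeal R → ¬ I ≤ b) : ∃ k, maximalIdeal R ^ k ≤ I := by
  refine Ideal.exists_pow_le_of_le_radical_of_fg ?_ (IsNoetherian.noetherian _)
  rw [Ideal.radical_eq_sInf]
  refine le_sInf fun b hb => ?_
  by_contra hne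
  exact h b hb.2 (fun h => hne h.ge) hb.1

/-- Over a local ring of depth at least two, an idempotent of an integral extension that is
trivial over each nonmaximal prime is trivial. -/
lemma eq_zero_or_one_of_forall_nonmaximal {R D : Type*} [CommRing R] [IsLocalRing R]
    [IsNoetherianRing R] [CommRing D] [Algebra R D] [Algebra.IsIntegral R D]
    (hinj : Function.Injective (algebraMap R D)) {t : R}
    (ht : ∀ d : D, ∃ n, ∃ r, algebraMap R D (t ^ n) * d = algebraMap R D r) {x y : R}
    (hxm : x ∈ maximalIdeal R) (hym : y ∈ maximalIdeal R)
    (hx : ∀ d : D, algebraMap R D x * d = 0 → d = 0) (hxy : ∀ a b : R, y * a = x * b → x ∣ a)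
    {e : D} (he : e * e = e)
    (H : ∀ b : Ideal R, b.IsPrime → b ≠ maximalIdeal R → t ∈ b →
      (∀ Q : Ideal D, Q.IsPrime → Q.comap (algebraMap R D) = b → e ∈ Q) ∨
      (∀ Q : Ideal D, Q.IsPrime → Q.comap (algebraMap R D) = b → 1 - e ∈ Q)) :
    e = 0 ∨ e = 1 := by
  have hmem : ∃ c, e = algebraMap R D c := by
    -- The ideal of denominators of `e`, that is, of those `a` for which `a * e` comes from `R`. The
    -- goal is that it contains one.
    let I : Ideal R := (Submodule.colon (LinearMap.range (Algebra.linearMap R D)) {e})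
    have hI : ∀ {a : R}, a ∈ I ↔ ∃ c, algebraMap R D c = algebraMap R D a * e := by
      intro a
      rw [Submodule.mem_colon_singleton, Algebra.smul_def]
      rfl
    have hprime : ∀ b : Ideal R, b.IsPrime → b ≠ maximalIdeal R → ¬ I ≤ b := by
      intro b hb hne hle
      have htb : t ∈ b := by
        obtain ⟨n, r, h⟩ := ht e
        exact hb.mem_of_pow_mem n (hle (hI.mpr ⟨r, h.symm⟩))
      -- An idempotent lying in every prime over `b` vanishes after localizing at `b`: otherwise
      -- some prime over `b` would also contain `1 - z`.
      have key : ∀ z : D, z * z = z →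
          (∀ Q : Ideal D, Q.IsPrime → Q.comap (algebraMap R D) = b → z ∈ Q) →
          ∃ s ∉ b, algebraMap R D s * z = 0 := by
        intro z hz hQ
        by_contra! hs
        obtain ⟨Q, hQle, hQp, hQb⟩ := Ideal.exists_ideal_over_prime_of_isIntegral b
          (Ideal.span {1 - z}) (by
            intro s hsmem
            by_contra hsb
            obtain ⟨w, hw⟩ := Ideal.mem_span_singleton'.mp (Ideal.mem_comap.mp hsmem)
            refine hs s hsb ?_
            rw [← hw]
            linear_combination -w * hz)
        refine hQp.ne_top ((Ideal.eq_top_iff_one _).mpr ?_)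
        rw [← sub_add_cancel 1 z]
        exact Ideal.add_mem _ (hQle (Ideal.mem_span_singleton_self _)) (hQ Q hQp hQb)
      rcases H b hb hne htb with h | h
      · obtain ⟨s, hs, hse⟩ := key e he h
        refine hs (hle (hI.mpr ⟨0, ?_⟩))
        rw [map_zero, hse]
      · obtain ⟨s, hs, hse⟩ := key (1 - e) (by linear_combination he) h
        refine hs (hle (hI.mpr ⟨s, ?_⟩))
        linear_combination hse
    by_contra hne
    obtain ⟨k, hk⟩ := Ideal.exists_pow_le_of_forall_prime hprime
    classical
    have hex : ∃ k, maximalIdeal R ^ k ≤ I := ⟨k, hk⟩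
    obtain ⟨l, hl⟩ : ∃ l, Nat.find hex = l + 1 := by
      refine Nat.exists_eq_succ_of_ne_zero fun h0 => hne ?_
      have := Nat.find_spec hex
      rw [h0, pow_zero, Ideal.one_eq_top] at this
      obtain ⟨c, hc⟩ := hI.mp (@this 1 Submodule.mem_top)
      exact ⟨c, by rw [hc, map_one, one_mul]⟩
    have h1 := Nat.find_spec hex
    have h2 := Nat.find_min hex (m := l) (by omega)
    -- Choose `r` in the last power of the maximal ideal not contained in `I`. Then `x * r * e` and
    -- `y * r * e` come from `R`, and the regular sequence `x`, `y` lets `x` be cancelled, so `r`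
    -- belongs to `I` after all.
    obtain ⟨r, hr, hrI⟩ := SetLike.not_le_iff_exists.mp h2
    have h3 : ∀ z ∈ maximalIdeal R, ∃ c, algebraMap R D c = algebraMap R D z * (algebraMap R D r * e) := by
      intro z hz
      have : z * r ∈ I := h1 (by rw [hl, pow_succ']; exact Ideal.mul_mem_mul hz hr)
      obtain ⟨c, hc⟩ := hI.mp this
      exact ⟨c, by rw [hc, map_mul, mul_assoc]⟩
    obtain ⟨a₁, ha₁⟩ := h3 x hxm
    obtain ⟨a₂, ha₂⟩ := h3 y hym
    obtain ⟨c, hc⟩ := hxy a₁ a₂ (hinj (by rw [map_mul, map_mul, ha₁, ha₂]; ring))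
    refine hrI (hI.mpr ⟨c, ?_⟩)
    rw [← sub_eq_zero]
    refine hx _ ?_
    rw [mul_sub, ← map_mul, ← hc, ha₁, sub_self]
  obtain ⟨c, rfl⟩ := hmem
  have hc : c * (1 - c) = 0 := hinj (by rw [map_mul, map_sub, map_one, map_zero]; linear_combination -he)
  rcases IsLocalRing.isUnit_or_isUnit_one_sub_self c with h | h
  · right
    rw [h.mul_right_eq_zero, sub_eq_zero] at hc
    rw [← hc, map_one]
  · left
    rw [h.mul_left_eq_zero] at hc
    rw [hc, map_zero]

/-! ### Nonmaximal primes of completions -/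

section Nonmaximal

variable {A R : Type u} [CommRing A] [IsLocalRing A] [IsNoetherianRing A] [CommRing R]
  [IsLocalRing R] [IsNoetherianRing R] (π : A →+* R) [IsLocalHom π]

lemma completionMap_algebraMap (a : A) :
    completionMap π (algebraMap A (LocalCompletion A) a) = algebraMap R (LocalCompletion R) (π a) := by
  rw [completionMap_eq, AdicCompletion.mapRingHom_algebraMap]

lemma completionMap_comp {S : Type u} [CommRing S] [IsLocalRing S] (ψ : R →+* S) [IsLocalHom ψ]
    [IsLocalHom (ψ.comp π)] :
    (completionMap ψ).comp (completionMap π) = completionMap (ψ.comp π) := by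
  simp only [completionMap_eq]
  exact AdicCompletion.mapRingHom_comp ..

lemma comap_comap_completionMap_algebraMap (c : Ideal (LocalCompletion R)) :
    (c.comap (completionMap π)).comap (algebraMap A (LocalCompletion A)) =
      (c.comap (algebraMap R (LocalCompletion R))).comap π := by
  ext a
  simp only [Ideal.mem_comap, completionMap_algebraMap]

variable (hπ : Function.Surjective π)
include hπ

lemma completionMap_surjective : Function.Surjective (completionMap π) := by
  rw [completionMap_eq]
  exact AdicCompletion.mapRingHom_surjective π hπ _ (IsNoetherian.noetherian _)
    (map_maximalIdeal_of_surjective π hπ)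

lemma ker_completionMap {t : A} (ht : RingHom.ker π = Ideal.span {t}) :
    RingHom.ker (completionMap π) = Ideal.span {algebraMap A (LocalCompletion A) t} := by
  rw [completionMap_eq, AdicCompletion.ker_mapRingHom π hπ _ (map_maximalIdeal_of_surjective π hπ), ht,
    Ideal.map_span, Set.image_singleton]

lemma comap_completionMap_ne_maximalIdeal {c : Ideal (LocalCompletion R)}
    (hne : c ≠ maximalIdeal _) : c.comap (completionMap π) ≠ maximalIdeal (LocalCompletion A) := by
  intro h
  refine hne (eq_maximalIdeal ?_)
  rw [← Ideal.map_comap_of_surjective _ (completionMap_surjective π hπ) c, h]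
  refine Ideal.IsMaximal.map_of_surjective_of_ker_le (completionMap_surjective π hπ) ?_
  rw [← h]
  exact Ideal.comap_mono bot_le

/-- Completing the surjection `π` gives the quotient of the completion of `A` by `t`, so primes
containing `t` descend. -/
lemma exists_comap_completionMap_eq {t : A} (ht : RingHom.ker π = Ideal.span {t})
    {b : Ideal (LocalCompletion A)} (hb : b.IsPrime) (hne : b ≠ maximalIdeal _)
    (htb : algebraMap A (LocalCompletion A) t ∈ b) :
    ∃ c : Ideal (LocalCompletion R), c.IsPrime ∧ c ≠ maximalIdeal _ ∧
      c.comap (completionMap π) = b := by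
  have hk : RingHom.ker (completionMap π) ≤ b := by
    rw [ker_completionMap π hπ ht, Ideal.span_singleton_le_iff_mem]
    exact htb
  have h : (b.map (completionMap π)).comap (completionMap π) = b :=
    (Ideal.comap_map_of_surjective' _ (completionMap_surjective π hπ) b).trans (sup_eq_left.mpr hk)
  refine ⟨b.map (completionMap π), Ideal.map_isPrime_of_surjective
    (completionMap_surjective π hπ) hk, fun h' => hne ?_, h⟩
  rw [← h, h']
  exact eq_maximalIdeal (Ideal.comap_isMaximal_of_surjective _ (completionMap_surjective π hπ))

end Nonmaximal

lemma RingTheory.Sequence.IsWeaklyRegular.dvd_of_mul_eq {R : Type*} [CommRing R] {x y : R}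
    {l : List R} (h : IsWeaklyRegular R (x :: y :: l)) {a b : R} (hab : y * a = x * b) : x ∣ a := by
  rw [isWeaklyRegular_cons_iff, isWeaklyRegular_cons_iff] at h
  have h1 : y • (Submodule.Quotient.mk a : QuotSMulTop x R) = 0 := by
    rw [← Submodule.Quotient.mk_smul, Submodule.Quotient.mk_eq_zero,
      Submodule.mem_smul_pointwise_iff_exists]
    exact ⟨b, Submodule.mem_top, hab.symm⟩
  have h2 := h.2.1.right_eq_zero_of_smul h1
  rw [Submodule.Quotient.mk_eq_zero, Submodule.mem_smul_pointwise_iff_exists] at h2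
  obtain ⟨c, -, hc⟩ := h2
  exact ⟨c, hc.symm⟩

/-! ### Branches over a point as primes of the completed base change -/

section Semilocal

variable (A B : Type u) [CommRing A] [IsLocalRing A] [IsNoetherianRing A] [CommRing B]
  [Algebra A B] [Module.Finite A B]
  {ι : Type u} (P : ι → Ideal B) [∀ i, (P i).IsMaximal] (E : ι → Type u)
  [∀ i, CommRing (E i)] [∀ i, IsLocalRing (E i)] [∀ i, Algebra A (E i)] [∀ i, Algebra B (E i)]
  [∀ i, IsScalarTower A B (E i)] [∀ i, IsLocalHom (algebraMap A (E i))]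
  [∀ i, IsLocalization.AtPrime (E i) (P i)] [∀ i, IsNoetherianRing (E i)]
  {R : Type u} [CommRing R] [IsLocalRing R] [IsNoetherianRing R] (π : A →+* R) [IsLocalHom π]
  (hπ : Function.Surjective π) {t : A} (hker : RingHom.ker π = Ideal.span {t})
  {S : ι → Type u} [∀ i, CommRing (S i)] [∀ i, IsLocalRing (S i)] [∀ i, IsNoetherianRing (S i)]
  (σ : ∀ i, E i →+* S i) [∀ i, IsLocalHom (σ i)]
  (hσ : ∀ i, Function.Surjective (σ i))
  (hkerσ : ∀ i, RingHom.ker (σ i) = Ideal.span {algebraMap A (E i) t})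
  (ψ : ∀ i, R →+* S i) [∀ i, IsLocalHom (ψ i)]
  (hψ : ∀ i, (ψ i).comp π = (σ i).comp (algebraMap A (E i)))

lemma algebraMap_localCompletion_tensor (s : A) : algebraMap A (LocalCompletion A ⊗[A] B) s =
    (1 : LocalCompletion A) ⊗ₜ[A] algebraMap A B s := by
  rw [IsScalarTower.algebraMap_apply A (LocalCompletion A),
    Algebra.TensorProduct.algebraMap_apply, Algebra.algebraMap_self_apply,
    Algebra.algebraMap_eq_smul_one, Algebra.algebraMap_eq_smul_one, TensorProduct.smul_tmul]

/-- The prime ideal of the base change of `B` to the completion of `A` that corresponds to a prime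
ideal of the completion of `S i`. -/
noncomputable def pullbackIdeal (i : ι) (c : Ideal (LocalCompletion (S i))) :
    Ideal (LocalCompletion A ⊗[A] B) :=
  (c.comap (completionMap (σ i))).comap (tensorToCompletion A B (E i)).toRingHom

instance isPrime_pullbackIdeal (i : ι) (c : Ideal (LocalCompletion (S i))) [c.IsPrime] :
    (pullbackIdeal A B E σ i c).IsPrime := by
  unfold pullbackIdeal
  infer_instance

lemma ker_le_pullbackIdeal (i : ι) (c : Ideal (LocalCompletion (S i))) :
    RingHom.ker (tensorToCompletion A B (E i)) ≤ pullbackIdeal A B E σ i c :=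
  Ideal.comap_mono bot_le

include hψ in
lemma comap_pullbackIdeal (i : ι) (c : Ideal (LocalCompletion (S i))) :
    (pullbackIdeal A B E σ i c).comap (algebraMap (LocalCompletion A) (LocalCompletion A ⊗[A] B)) =
      (c.comap (completionMap (ψ i))).comap (completionMap π) := by
  have h1 : (tensorToCompletion A B (E i)).toRingHom.comp
      (algebraMap (LocalCompletion A) (LocalCompletion A ⊗[A] B)) =
      completionMap (algebraMap A (E i)) :=
    RingHom.ext (tensorToCompletion_includeLeft A B (E i))
  have : IsLocalHom ((ψ i).comp π) := RingHom.isLocalHom_comp _ _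
  have : IsLocalHom ((σ i).comp (algebraMap A (E i))) := RingHom.isLocalHom_comp _ _
  rw [pullbackIdeal, Ideal.comap_comap, Ideal.comap_comap, Ideal.comap_comap, h1,
    completionMap_comp, completionMap_comp]
  simp only [hψ]

include P hσ in
lemma pullbackIdeal_injective (i : ι) : Function.Injective (pullbackIdeal A B E σ i) :=
  (Ideal.comap_injective_of_surjective _ (tensorToCompletion_surjective A B (E i) (P i))).comp
    (Ideal.comap_injective_of_surjective _ (completionMap_surjective _ (hσ i)))

include P hσ in
lemma pullbackIdeal_not_isMaximal (i : ι) {c : Ideal (LocalCompletion (S i))}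
    (hne : c ≠ maximalIdeal _) : ¬ (pullbackIdeal A B E σ i c).IsMaximal := by
  intro h
  have h1 := comap_completionMap_ne_maximalIdeal (σ i) (hσ i) hne
  refine h1 (eq_maximalIdeal ?_)
  have hs := tensorToCompletion_surjective A B (E i) (P i)
  have h2 : (pullbackIdeal A B E σ i c).map (tensorToCompletion A B (E i)).toRingHom =
      c.comap (completionMap (σ i)) := Ideal.map_comap_of_surjective _ hs _
  rw [← h2]
  exact Ideal.IsMaximal.map_of_surjective_of_ker_le hs (ker_le_pullbackIdeal A B E σ i c)

include P hσ hψ hπ in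
/-- The image of a branch is a branch. -/
lemma comap_completionMap_ne_maximalIdeal_of_finite (i : ι) {c : Ideal (LocalCompletion (S i))}
    (hc : c.IsPrime) (hne : c ≠ maximalIdeal _) :
    c.comap (completionMap (ψ i)) ≠ maximalIdeal _ := by
  intro h
  refine pullbackIdeal_not_isMaximal A B P E σ hσ i hne
    (Ideal.isMaximal_of_isIntegral_of_isMaximal_comap (R := LocalCompletion A) _ ?_)
  rw [comap_pullbackIdeal A B E π σ ψ hψ, h]
  exact Ideal.comap_isMaximal_of_surjective _ (completionMap_surjective π hπ)

-- A prime contains the product of the kernels, which is zero, hence one of them; so it comes from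
-- one factor, and from the quotient of that factor by `t`.
include hσ hkerσ in
lemma exists_pullbackIdeal_eq [Finite ι] (hP : ∀ M : Ideal B, M.IsMaximal → ∃ i, P i = M)
    (Q : Ideal (LocalCompletion A ⊗[A] B)) [Q.IsPrime]
    (htQ : algebraMap (LocalCompletion A) (LocalCompletion A ⊗[A] B) (algebraMap A _ t) ∈ Q)
    (hQ : ¬ Q.IsMaximal) :
    ∃ i, ∃ c : Ideal (LocalCompletion (S i)), c.IsPrime ∧ c ≠ maximalIdeal _ ∧
      pullbackIdeal A B E σ i c = Q := by
  obtain ⟨i, hi⟩ := exists_ker_tensorToCompletion_le A B P E hP Q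
  have hs : Function.Surjective (tensorToCompletion A B (E i)).toRingHom :=
    tensorToCompletion_surjective A B (E i) (P i)
  have h1 : (Q.map (tensorToCompletion A B (E i)).toRingHom).comap
      (tensorToCompletion A B (E i)).toRingHom = Q :=
    (Ideal.comap_map_of_surjective' _ hs Q).trans (sup_eq_left.mpr hi)
  obtain ⟨c, hc, hne, h⟩ := exists_comap_completionMap_eq (σ i) (hσ i) (hkerσ i)
    (b := Q.map (tensorToCompletion A B (E i)).toRingHom)
    (Ideal.map_isPrime_of_surjective hs hi) (by
      intro h
      apply hQ
      rw [← h1, h]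
      exact Ideal.comap_isMaximal_of_surjective _ hs) (by
      rw [← completionMap_algebraMap, ← tensorToCompletion_includeLeft A B (E i)]
      exact Ideal.mem_map_of_mem _ htQ)
  refine ⟨i, c, hc, hne, ?_⟩
  rw [pullbackIdeal, h, h1]

include hσ hkerσ hπ hker hψ in
/-- Each branch is the image of a branch. -/
lemma exists_comap_completionMap_eq_of_finite [Finite ι]
    (hP : ∀ M : Ideal B, M.IsMaximal → ∃ i, P i = M)
    (hinj : Function.Injective (algebraMap A B)) {b : Ideal (LocalCompletion R)} (hb : b.IsPrime)
    (hne : b ≠ maximalIdeal _) :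
    ∃ i, ∃ c : Ideal (LocalCompletion (S i)), c.IsPrime ∧ c ≠ maximalIdeal _ ∧
      c.comap (completionMap (ψ i)) = b := by
  have hinj' : Function.Injective
      (algebraMap (LocalCompletion A) (LocalCompletion A ⊗[A] B)) := by
    exact Algebra.TensorProduct.includeLeft_injective (S := A) hinj
  -- Lying over in the integral extension given by the completed base change, which remains
  -- injective by flatness of the completion.
  obtain ⟨Q, -, hQp, hQ⟩ := Ideal.exists_ideal_over_prime_of_isIntegral
    (S := LocalCompletion A ⊗[A] B) (b.comap (completionMap π)) ⊥ (by
      rw [← RingHom.ker_eq_comap_bot, (RingHom.injective_iff_ker_eq_bot _).mp hinj']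
      exact bot_le)
  obtain ⟨i, c, hc, hcne, h⟩ := exists_pullbackIdeal_eq A B P E σ hσ hkerσ hP Q (by
    rw [← Ideal.mem_comap, hQ, Ideal.mem_comap, completionMap_algebraMap,
      show π t = 0 by rw [← RingHom.mem_ker, hker]; exact Ideal.mem_span_singleton_self t, map_zero]
    exact zero_mem _) (by
    intro hm
    have := Ideal.isMaximal_comap_of_isIntegral_of_isMaximal (R := LocalCompletion A) Q
    rw [hQ] at this
    exact comap_completionMap_ne_maximalIdeal π hπ hne (eq_maximalIdeal this))
  refine ⟨i, c, hc, hcne, Ideal.comap_injective_of_surjective _ (completionMap_surjective π hπ) ?_⟩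
  rw [← hQ, ← h, comap_pullbackIdeal A B E π σ ψ hψ]

lemma includeRight_mem_pullbackIdeal_iff {i : ι} {c : Ideal (LocalCompletion (S i))}
    (b : B) : (1 ⊗ₜ[A] b : LocalCompletion A ⊗[A] B) ∈ pullbackIdeal A B E σ i c ↔
      b ∈ ((c.comap (algebraMap (S i) (LocalCompletion (S i)))).comap (σ i)).comap
        (algebraMap B (E i)) := by
  simp only [Ideal.mem_comap]
  rw [← completionMap_algebraMap, ← tensorToCompletion_includeRight A B (E i)]
  rfl

include hσ hψ in
/-- A branch of multiplicity one is the image of only one branch. -/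
lemma sigma_eq_of_comap_completionMap_eq (hP : Function.Injective P)
    {i j : ι} {c : Ideal (LocalCompletion (S i))}
    {c' : Ideal (LocalCompletion (S j))} (hc : c.IsPrime) (hc' : c'.IsPrime)
    (h : c.comap (completionMap (ψ i)) = c'.comap (completionMap (ψ j)))
    (g : Ideal B)
    (hg : g = ((c.comap (algebraMap (S i) (LocalCompletion (S i)))).comap (σ i)).comap
        (algebraMap B (E i)))
    (hg' : g = ((c'.comap (algebraMap (S j) (LocalCompletion (S j)))).comap (σ j)).comap
        (algebraMap B (E j)))
    (hres : ∀ β : B, ∃ s a : A, algebraMap A B s ∉ g ∧ algebraMap A B s * β - algebraMap A B a ∈ g) :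
    (⟨i, c⟩ : Σ i, Ideal (LocalCompletion (S i))) = ⟨j, c'⟩ := by
  have key : ∀ {i j : ι} {c : Ideal (LocalCompletion (S i))}
      {c' : Ideal (LocalCompletion (S j))} (hc : c.IsPrime) (hc' : c'.IsPrime)
      (h : c.comap (completionMap (ψ i)) = c'.comap (completionMap (ψ j)))
      (hg : g = ((c.comap (algebraMap (S i) (LocalCompletion (S i)))).comap (σ i)).comap
        (algebraMap B (E i)))
      (hg' : g = ((c'.comap (algebraMap (S j) (LocalCompletion (S j)))).comap (σ j)).comap
        (algebraMap B (E j))),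
      pullbackIdeal A B E σ i c ≤ pullbackIdeal A B E σ j c' := by
    intro i j c c' hc hc' h hg hg'
    have hcomap : (pullbackIdeal A B E σ i c).comap
        (algebraMap (LocalCompletion A) (LocalCompletion A ⊗[A] B)) =
        (pullbackIdeal A B E σ j c').comap
        (algebraMap (LocalCompletion A) (LocalCompletion A ⊗[A] B)) := by
      rw [comap_pullbackIdeal A B E π σ ψ hψ, comap_pullbackIdeal A B E π σ ψ hψ, h]
    -- Modulo `g`, inverting elements of `A` outside `g` makes every element of `B` come from `A`.
    -- The same then holds for the completed base change, so a prime that lies over `g` is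
    -- determined by its contraction to the completion of `A`.
    have hgen : ∀ x : LocalCompletion A ⊗[A] B, ∃ s : A, algebraMap A B s ∉ g ∧
        ∃ a : LocalCompletion A, algebraMap A (LocalCompletion A ⊗[A] B) s * x -
          algebraMap (LocalCompletion A) _ a ∈ g.map (Algebra.TensorProduct.includeRight (R := A)
            (A := LocalCompletion A) (B := B)).toRingHom := by
      intro x
      have hgp : g.IsPrime := by rw [hg]; infer_instance
      induction x with
      | zero =>
        refine ⟨1, ?_, 0, by simp⟩
        rw [map_one]
        exact fun h => hgp.ne_top ((Ideal.eq_top_iff_one _).mpr h)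
      | tmul α β =>
        obtain ⟨s, a, hs, ha⟩ := hres β
        refine ⟨s, hs, a • α, ?_⟩
        have : algebraMap A (LocalCompletion A ⊗[A] B) s * α ⊗ₜ[A] β -
            algebraMap (LocalCompletion A) _ (a • α) =
            α ⊗ₜ[A] 1 * 1 ⊗ₜ[A] (algebraMap A B s * β - algebraMap A B a) := by
          rw [algebraMap_localCompletion_tensor, Algebra.TensorProduct.algebraMap_apply,
            Algebra.algebraMap_self_apply, Algebra.TensorProduct.tmul_mul_tmul, Algebra.TensorProduct.tmul_mul_tmul,
            one_mul, mul_one, one_mul, TensorProduct.tmul_sub, TensorProduct.smul_tmul,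
            Algebra.algebraMap_eq_smul_one a]
        rw [this]
        exact Ideal.mul_mem_left _ _ (Ideal.mem_map_of_mem _ ha)
      | add x y hx hy =>
        obtain ⟨s, hs, a, ha⟩ := hx
        obtain ⟨s', hs', a', ha'⟩ := hy
        refine ⟨s * s', by rw [map_mul]; exact hgp.mul_notMem hs hs', s' • a + s • a', ?_⟩
        have : algebraMap A (LocalCompletion A ⊗[A] B) (s * s') * (x + y) -
            algebraMap (LocalCompletion A) _ (s' • a + s • a') =
            algebraMap A _ s' * (algebraMap A (LocalCompletion A ⊗[A] B) s * x -
              algebraMap (LocalCompletion A) _ a) +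
            algebraMap A _ s * (algebraMap A (LocalCompletion A ⊗[A] B) s' * y -
              algebraMap (LocalCompletion A) _ a') := by
          rw [map_add, Algebra.smul_def, Algebra.smul_def, map_mul, map_mul, map_mul,
            ← IsScalarTower.algebraMap_apply, ← IsScalarTower.algebraMap_apply]
          ring
        rw [this]
        exact Ideal.add_mem _ (Ideal.mul_mem_left _ _ ha) (Ideal.mul_mem_left _ _ ha')
    have hle : ∀ {k : ι} {d : Ideal (LocalCompletion (S k))},
        g = ((d.comap (algebraMap (S k) (LocalCompletion (S k)))).comap (σ k)).comap
          (algebraMap B (E k)) →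
        g.map (Algebra.TensorProduct.includeRight (R := A)
            (A := LocalCompletion A) (B := B)).toRingHom ≤ pullbackIdeal A B E σ k d := by
      intro k d hd
      rw [Ideal.map_le_iff_le_comap]
      intro b hb
      rw [hd] at hb
      exact (includeRight_mem_pullbackIdeal_iff A B E σ b).mpr hb
    intro x hx
    obtain ⟨s, hs, a, ha⟩ := hgen x
    have h1 : algebraMap (LocalCompletion A) (LocalCompletion A ⊗[A] B) a ∈
        pullbackIdeal A B E σ i c := by
      rw [← sub_sub_self (algebraMap A (LocalCompletion A ⊗[A] B) s * x) (algebraMap _ _ a)]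
      exact Ideal.sub_mem _ (Ideal.mul_mem_left _ _ hx) (hle hg ha)
    have h2 : algebraMap (LocalCompletion A) (LocalCompletion A ⊗[A] B) a ∈
        pullbackIdeal A B E σ j c' := by
      rw [← Ideal.mem_comap, hcomap] at h1
      exact h1
    have h3 : algebraMap A (LocalCompletion A ⊗[A] B) s * x ∈ pullbackIdeal A B E σ j c' := by
      rw [← sub_add_cancel (algebraMap A (LocalCompletion A ⊗[A] B) s * x) (algebraMap _ _ a)]
      exact Ideal.add_mem _ (hle hg' ha) h2
    refine ((isPrime_pullbackIdeal A B E σ j c').mem_or_mem h3).resolve_left fun h4 => hs ?_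
    rw [hg', ← includeRight_mem_pullbackIdeal_iff A B E σ]
    rwa [algebraMap_localCompletion_tensor] at h4
  have heq := (key hc hc' h hg hg').antisymm (key hc' hc h.symm hg' hg)
  have hij : i = j := by
    by_contra hij
    have := isCoprime_ker_tensorToCompletion A B P E hP hij
    rw [Function.onFun, Ideal.isCoprime_iff_sup_eq] at this
    refine (isPrime_pullbackIdeal A B E σ i c).ne_top (top_le_iff.mp (this.ge.trans (sup_le
      (ker_le_pullbackIdeal A B E σ i c) ?_)))
    rw [heq]
    exact ker_le_pullbackIdeal A B E σ j c'
  subst hij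
  rw [pullbackIdeal_injective A B P E σ hσ i heq]

include hσ hkerσ hπ hψ in
/-- The points over a point of depth two are connected to each other by their branches. -/
lemma eq_empty_or_eq_univ_of_saturated [Finite ι] [IsDomain A] [IsDomain B]
    (hP : Function.Injective P)
    (hP' : ∀ M : Ideal B, M.IsMaximal → ∃ i, P i = M)
    (hinj : Function.Injective (algebraMap A B))
    (ht : ∀ b : B, ∃ n, ∃ a, algebraMap A B (t ^ n) * b = algebraMap A B a)
    {x y : A} {l : List A} (hx : x ∈ maximalIdeal A) (hy : y ∈ maximalIdeal A) (hx0 : x ≠ 0)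
    (hreg : RingTheory.Sequence.IsWeaklyRegular A (x :: y :: l))
    (U : Set ι) (hU : ∀ i j, ∀ c : Ideal (LocalCompletion (S i)),
      ∀ c' : Ideal (LocalCompletion (S j)), c.IsPrime → c ≠ maximalIdeal _ → c'.IsPrime →
      c' ≠ maximalIdeal _ → c.comap (completionMap (ψ i)) = c'.comap (completionMap (ψ j)) →
      (i ∈ U ↔ j ∈ U)) : U = ∅ ∨ U = Set.univ := by
  have hNA := AdicCompletion.isNoetherianRing (maximalIdeal A)
  have hinj' : Function.Injective
      (algebraMap (LocalCompletion A) (LocalCompletion A ⊗[A] B)) := by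
    exact Algebra.TensorProduct.includeLeft_injective (S := A) hinj
  -- The idempotent that is one exactly on the factors in `U`; it is zero or one only if `U` is
  -- empty or everything.
  obtain ⟨e, hee, he1, he0⟩ := exists_idempotent_tensorToCompletion A B P E hP hP' U
  have hreg' := hreg.of_flat (S := LocalCompletion A)
  have h01 : ∀ i, (0 : LocalCompletion (E i)) ≠ 1 := fun i => zero_ne_one
  have := eq_zero_or_one_of_forall_nonmaximal (R := LocalCompletion A)
    (D := LocalCompletion A ⊗[A] B) hinj' (t := algebraMap A _ t) (x := algebraMap A _ x)
    (y := algebraMap A _ y) (e := e) ?_ ?_ ?_ ?_ ?_ hee ?_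
  · rcases this with h | h
    · left
      refine Set.eq_empty_of_forall_notMem fun i hi => h01 i ?_
      rw [← he1 i hi, h, map_zero]
    · right
      refine Set.eq_univ_of_forall fun i => by_contra fun hi => h01 i ?_
      rw [← he0 i hi, h, map_one]
  · intro d
    induction d with
    | zero => exact ⟨0, 0, by simp⟩
    | tmul α β =>
      obtain ⟨n, a, h⟩ := ht β
      refine ⟨n, a • α, ?_⟩
      rw [Algebra.TensorProduct.algebraMap_apply, Algebra.TensorProduct.algebraMap_apply,
        Algebra.algebraMap_self_apply, Algebra.algebraMap_self_apply,
        Algebra.TensorProduct.tmul_mul_tmul, one_mul, ← map_pow, ← Algebra.smul_def,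
        TensorProduct.smul_tmul, TensorProduct.smul_tmul, Algebra.smul_def, h,
        Algebra.algebraMap_eq_smul_one]
    | add d d' hd hd' =>
      obtain ⟨n, r, h⟩ := hd
      obtain ⟨n', r', h'⟩ := hd'
      refine ⟨n + n', algebraMap A _ t ^ n' * r + algebraMap A _ t ^ n * r', ?_⟩
      rw [map_add, map_mul, map_mul, ← h, ← h', pow_add, map_mul]
      ring
  · rw [AdicCompletion.maximalIdeal_eq_map]
    exact Ideal.mem_map_of_mem _ hx
  · rw [AdicCompletion.maximalIdeal_eq_map]
    exact Ideal.mem_map_of_mem _ hy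
  · intro d hd
    -- Regularity of `x` on the domain `B` passes to the completed base change by flatness.
    have h1 : IsSMulRegular B x := by
      intro b b' hbb
      simp only [Algebra.smul_def] at hbb
      exact mul_left_cancel₀ ((map_ne_zero_iff _ hinj).mpr hx0) hbb
    have h2 : Function.Injective ((LinearMap.lsmul A B x).lTensor (LocalCompletion A)) :=
      Module.Flat.lTensor_preserves_injective_linearMap _ h1
    refine h2 ?_
    rw [map_zero, ← hd]
    have h3 : (LinearMap.lsmul A B x).lTensor (LocalCompletion A) =
        LinearMap.lsmul A (LocalCompletion A ⊗[A] B) x := by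
      ext
      simp
    rw [h3]
    exact (algebraMap_smul (LocalCompletion A) x d).symm.trans
      (Algebra.smul_def (algebraMap A (LocalCompletion A) x) d)
  · intro a b hab
    exact hreg'.dvd_of_mul_eq hab
  · intro b hb hne htb
    have hQ : ∀ Q : Ideal (LocalCompletion A ⊗[A] B), Q.IsPrime → Q.comap (algebraMap _ _) = b →
        ∃ i, ∃ c : Ideal (LocalCompletion (S i)), c.IsPrime ∧ c ≠ maximalIdeal _ ∧
          pullbackIdeal A B E σ i c = Q := by
      intro Q hQ hQb
      refine exists_pullbackIdeal_eq A B P E σ hσ hkerσ hP' Q ?_ ?_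
      · rwa [← hQb, Ideal.mem_comap] at htb
      · intro hm
        have := Ideal.isMaximal_comap_of_isIntegral_of_isMaximal (R := LocalCompletion A) Q
        rw [hQb] at this
        exact hne (eq_maximalIdeal this)
    have hmem : ∀ i, ∀ c : Ideal (LocalCompletion (S i)),
        (i ∈ U → 1 - e ∈ pullbackIdeal A B E σ i c) ∧ (i ∉ U → e ∈ pullbackIdeal A B E σ i c) := by
      intro i c
      refine ⟨fun hi => ker_le_pullbackIdeal A B E σ i c ?_,
        fun hi => ker_le_pullbackIdeal A B E σ i c ?_⟩
      · rw [RingHom.mem_ker, map_sub, map_one, he1 i hi, sub_self]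
      · rw [RingHom.mem_ker, he0 i hi]
    -- The primes over `b` are the branches with image `b`. Saturation of `U` says that the points
    -- carrying them are all in `U` or all outside, so `e` is trivial over `b`.
    by_cases hex : ∃ i ∈ U, ∃ c : Ideal (LocalCompletion (S i)), c.IsPrime ∧ c ≠ maximalIdeal _ ∧
        (pullbackIdeal A B E σ i c).comap (algebraMap _ _) = b
    · right
      obtain ⟨i, hi, c, hc, hcne, hcb⟩ := hex
      intro Q hQp hQb
      obtain ⟨j, c', hc', hcne', rfl⟩ := hQ Q hQp hQb
      refine (hmem j c').1 ((hU i j c c' hc hcne hc' hcne' ?_).mp hi)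
      refine Ideal.comap_injective_of_surjective _ (completionMap_surjective π hπ) ?_
      rw [← comap_pullbackIdeal A B E π σ ψ hψ, ← comap_pullbackIdeal A B E π σ ψ hψ, hcb, hQb]
    · left
      intro Q hQp hQb
      obtain ⟨j, c', hc', hcne', rfl⟩ := hQ Q hQp hQb
      exact (hmem j c').2 fun hj => hex ⟨j, hj, c', hc', hcne', hQb⟩

end Semilocal

/-! ### Multiplicity and minimal primes -/

section Multiplicity

variable {C : Type u} [CommRing C]

lemma length_localizedModule_eq_add_of_exact (b : Ideal C) [b.IsPrime] {N M L : Type u}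
    [AddCommGroup N] [Module C N] [AddCommGroup M] [Module C M] [AddCommGroup L] [Module C L]
    {f : N →ₗ[C] M} {g : M →ₗ[C] L} (hf : Function.Injective f) (hg : Function.Surjective g)
    (hfg : Function.Exact f g) :
    Module.length (Localization.AtPrime b) (LocalizedModule b.primeCompl M) =
      Module.length (Localization.AtPrime b) (LocalizedModule b.primeCompl N) +
        Module.length (Localization.AtPrime b) (LocalizedModule b.primeCompl L) :=
  Module.length_eq_add_of_exact (LocalizedModule.map b.primeCompl f)
    (LocalizedModule.map b.primeCompl g) (LocalizedModule.map_injective _ f hf)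
    (LocalizedModule.map_surjective _ g hg) (LocalizedModule.map_exact _ f g hfg)

lemma length_localizedModule_quotient_eq_zero {b p : Ideal C} [b.IsPrime] (h : ¬ p ≤ b) {L : Type u}
    [AddCommGroup L] [Module C L] (e : L ≃ₗ[C] C ⧸ p) :
    Module.length (Localization.AtPrime b) (LocalizedModule b.primeCompl L) = 0 := by
  rw [Module.length_eq_zero_iff, LocalizedModule.subsingleton_iff]
  obtain ⟨x, hx, hxb⟩ := SetLike.not_le_iff_exists.mp h
  refine fun m => ⟨x, hxb, e.injective ?_⟩
  obtain ⟨y, hy⟩ := Ideal.Quotient.mk_surjective (e m)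
  rw [map_smul, map_zero, ← hy, Algebra.smul_def, Ideal.Quotient.algebraMap_eq, ← map_mul,
    Ideal.Quotient.eq_zero_iff_mem]
  exact Ideal.mul_mem_right _ _ hx

lemma length_localizedModule_quotient_le_one (b : Ideal C) [b.IsPrime] {L : Type u}
    [AddCommGroup L] [Module C L] (e : L ≃ₗ[C] C ⧸ b) :
    Module.length (Localization.AtPrime b) (LocalizedModule b.primeCompl L) ≤ 1 := by
  let v : LocalizedModule b.primeCompl L := LocalizedModule.mk (e.symm 1) 1
  have hgen : ∀ m : L, ∃ c : C, m = c • e.symm 1 := by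
    intro m
    obtain ⟨y, hy⟩ := Ideal.Quotient.mk_surjective (e m)
    refine ⟨y, e.injective ?_⟩
    rw [map_smul, e.apply_symm_apply, Algebra.smul_def, mul_one, ← hy]
    rfl
  let f : Localization.AtPrime b →ₗ[Localization.AtPrime b] LocalizedModule b.primeCompl L :=
    LinearMap.toSpanSingleton _ _ v
  have hf : Function.Surjective f := by
    intro x
    induction x using LocalizedModule.induction_on with
    | h m s =>
      obtain ⟨c, rfl⟩ := hgen m
      refine ⟨Localization.mk c s, ?_⟩
      rw [LinearMap.toSpanSingleton_apply, LocalizedModule.mk_smul_mk, mul_one]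
  have hk : maximalIdeal (Localization.AtPrime b) ≤ LinearMap.ker f := by
    rw [← Localization.AtPrime.map_eq_maximalIdeal, Ideal.map_le_iff_le_comap]
    intro c hc
    rw [Ideal.mem_comap, LinearMap.mem_ker, LinearMap.toSpanSingleton_apply, algebraMap_smul,
      LocalizedModule.smul'_mk]
    have : c • e.symm 1 = 0 := by
      rw [← map_smul, ← map_zero e.symm, Algebra.smul_def, mul_one, Ideal.Quotient.algebraMap_eq,
        Ideal.Quotient.eq_zero_iff_mem.mpr hc]
    rw [this, LocalizedModule.zero_mk]
  have h1 := Module.length_le_of_surjective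
    (Submodule.liftQ (maximalIdeal (Localization.AtPrime b)) f hk) (by
      rw [← LinearMap.range_eq_top, Submodule.range_liftQ, LinearMap.range_eq_top]
      exact hf)
  have : IsSimpleModule (Localization.AtPrime b)
      (Localization.AtPrime b ⧸ maximalIdeal (Localization.AtPrime b)) :=
    isSimpleModule_iff_quot_maximal.mpr ⟨_, inferInstance, ⟨LinearEquiv.refl _ _⟩⟩
  exact h1.trans (Module.length_eq_one (Localization.AtPrime b)
    (Localization.AtPrime b ⧸ maximalIdeal (Localization.AtPrime b))).le

/-- The length of the quotient by the submodule `I ^ n M` as a function of `n`. -/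
noncomputable def lengthQuotientPow (I : Ideal C) (M : Type u) [AddCommGroup M] [Module C M] (n : ℕ) :
    ℕ∞ :=
  Module.length C (M ⧸ (I ^ n • ⊤ : Submodule C M))

/-- Artin–Rees: the filtration induced on `N` is finer than its own up to a shift by `k`. For `n <
k` truncated subtraction makes the term of `N` zero. -/
lemma add_le_lengthQuotientPow (I : Ideal C) [IsNoetherianRing C] {N M L : Type u}
    [AddCommGroup N] [Module C N] [AddCommGroup M] [Module C M] [Module.Finite C M]
    [AddCommGroup L] [Module C L]
    {f : N →ₗ[C] M} {g : M →ₗ[C] L} (hf : Function.Injective f) (hg : Function.Surjective g)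
    (hfg : Function.Exact f g) : ∃ k, ∀ n,
      lengthQuotientPow I N (n - k) + lengthQuotientPow I L n ≤ lengthQuotientPow I M n := by
  obtain ⟨k, hk⟩ := Ideal.exists_pow_inf_eq_pow_smul I (LinearMap.range f)
  refine ⟨k, fun n => ?_⟩
  let K : Submodule C N := (I ^ n • ⊤ : Submodule C M).comap f
  have hmap : (I ^ n • ⊤ : Submodule C M).map g = (I ^ n • ⊤ : Submodule C L) := by
    rw [Submodule.map_smul'', Submodule.map_top, LinearMap.range_eq_top.mpr hg]
  have hgle : (I ^ n • ⊤ : Submodule C M) ≤ (I ^ n • ⊤ : Submodule C L).comap g :=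
    Submodule.map_le_iff_le_comap.mp hmap.le
  have h1 : Module.length C (M ⧸ (I ^ n • ⊤ : Submodule C M)) = Module.length C (N ⧸ K) +
      Module.length C (L ⧸ (I ^ n • ⊤ : Submodule C L)) := by
    refine Module.length_eq_add_of_exact (Submodule.mapQ K _ f le_rfl)
      (Submodule.mapQ _ _ g hgle) ?_ ?_ ?_
    · rw [← LinearMap.ker_eq_bot, Submodule.ker_mapQ]
      exact Submodule.mkQ_map_self K
    · rw [← LinearMap.range_eq_top, Submodule.range_mapQ, LinearMap.range_eq_top.mpr hg,
        Submodule.map_top, Submodule.range_mkQ]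
    · rw [LinearMap.exact_iff, Submodule.ker_mapQ, Submodule.range_mapQ, ← hmap,
        Submodule.comap_map_eq, Submodule.map_sup, Submodule.mkQ_map_self, bot_sup_eq,
        LinearMap.exact_iff.mp hfg]
  have h2 : K ≤ (I ^ (n - k) • ⊤ : Submodule C N) := by
    rcases le_or_gt k n with hkn | hkn
    · rw [← Submodule.map_le_map_iff_of_injective hf, Submodule.map_comap_eq, inf_comm, hk n hkn,
        Submodule.map_smul'', Submodule.map_top]
      exact Submodule.smul_mono le_rfl inf_le_right
    · rw [Nat.sub_eq_zero_of_le hkn.le, pow_zero, Ideal.one_eq_top, Submodule.top_smul]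
      exact le_top
  rw [lengthQuotientPow, lengthQuotientPow, lengthQuotientPow, h1]
  gcongr
  exact Module.length_le_of_surjective (Submodule.factor h2) (Submodule.factor_surjective h2)

/-- By Nakayama each step of the adic filtration is strict unless it reaches zero, and it never
does, since a power of the maximal ideal inside `p` would make `p` maximal. -/
lemma le_lengthQuotientPow_quotient [IsLocalRing C] [IsNoetherianRing C] {p : Ideal C} [p.IsPrime]
    (hp : p ≠ maximalIdeal C) {L : Type u} [AddCommGroup L] [Module C L] (e : L ≃ₗ[C] C ⧸ p)
    (n : ℕ) : n ≤ lengthQuotientPow (maximalIdeal C) L n := by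
  have hfin : Module.Finite C L := Module.Finite.equiv e.symm
  have hne : ∀ n, (maximalIdeal C ^ n • ⊤ : Submodule C L) ≠ ⊥ := by
    intro n h
    apply hp
    refine le_antisymm (le_maximalIdeal (Ideal.IsPrime.ne_top ‹_›)) ?_
    refine Ideal.IsPrime.le_of_pow_le (n := n) (fun x hx => ?_)
    have h1 : x • e.symm 1 ∈ (maximalIdeal C ^ n • ⊤ : Submodule C L) :=
      Submodule.smul_mem_smul hx Submodule.mem_top
    rw [h, Submodule.mem_bot, ← map_smul, LinearEquiv.map_eq_zero_iff, Algebra.smul_def, mul_one] at h1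
    exact Ideal.Quotient.eq_zero_iff_mem.mp h1
  induction n with
  | zero => simp
  | succ n ih =>
    have hle : (maximalIdeal C ^ (n + 1) • ⊤ : Submodule C L) ≤ maximalIdeal C ^ n • ⊤ :=
      Submodule.smul_mono_left (Ideal.pow_le_pow_right n.le_succ)
    have hlt : ¬ (maximalIdeal C ^ n • ⊤ : Submodule C L) ≤ maximalIdeal C ^ (n + 1) • ⊤ := by
      intro hle
      refine hne n (Submodule.eq_bot_of_le_smul_of_le_jacobson_bot (maximalIdeal C) _
        (IsNoetherian.noetherian _) ?_ (maximalIdeal_le_jacobson _))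
      rw [← Submodule.mul_smul, ← pow_succ']
      exact hle
    have := Module.length_eq_add_of_exact (LinearMap.ker (Submodule.factor hle)).subtype
      (Submodule.factor hle) (Submodule.subtype_injective _) (Submodule.factor_surjective hle)
      (LinearMap.exact_subtype_ker_map _)
    rw [lengthQuotientPow, this, Nat.cast_succ, add_comm]
    refine add_le_add ?_ ih
    rw [Order.one_le_iff_pos, Module.length_pos_iff, Submodule.nontrivial_iff_ne_bot]
    intro h
    refine hlt fun x hx => ?_
    rw [← Submodule.Quotient.mk_eq_zero, ← Submodule.mem_bot C, ← h, LinearMap.mem_ker]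
    exact (Submodule.Quotient.mk_eq_zero _).mpr hx

/-- Dévissage to quotients by primes. Lengths at the minimal primes are additive, while lengths
modulo powers are superadditive up to a shift. For `C ⧸ p` only `b = p` can contribute, and by at
most one. -/
lemma exists_mul_le_lengthQuotientPow_add [IsLocalRing C] [IsNoetherianRing C] (F : Finset (Ideal C))
    (hF : ∀ b ∈ F, b ∈ minimalPrimes C ∧ b ≠ maximalIdeal C) (hF' : ∀ b : F, b.1.IsPrime) (M : Type u)
    [AddCommGroup M] [Module C M] [hM : Module.Finite C M] : ∃ s c : ℕ,
      ∑ b : F, Module.length (Localization.AtPrime b.1) (LocalizedModule b.1.primeCompl M) = s ∧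
      ∀ n : ℕ, n * s ≤ lengthQuotientPow (maximalIdeal C) M n + c := by
  induction hM using IsNoetherianRing.induction_on_isQuotientEquivQuotientPrime C with
  | subsingleton N =>
    refine ⟨0, 0, ?_, fun n => by simp⟩
    refine Finset.sum_eq_zero fun b _ => ?_
    have : Subsingleton (LocalizedModule b.1.primeCompl N) := by
      rw [LocalizedModule.subsingleton_iff]
      exact fun m => ⟨1, Submonoid.one_mem _, Subsingleton.elim _ _⟩
    exact Module.length_eq_zero
  | quotient N p e =>
    have hzero : ∀ b : F, b.1 ≠ p.1 →
        Module.length (Localization.AtPrime b.1) (LocalizedModule b.1.primeCompl N) = 0 := by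
      intro b hb
      refine length_localizedModule_quotient_eq_zero (fun hle => hb ?_) e
      exact ((hF b b.2).1.2 ⟨p.2, bot_le⟩ hle).antisymm hle
    by_cases hp : p.1 ∈ F
    · have hsum : ∑ b : F, Module.length (Localization.AtPrime b.1)
          (LocalizedModule b.1.primeCompl N) ≤ 1 := by
        rw [Finset.sum_eq_single ⟨p.1, hp⟩ (fun b _ hb => hzero b fun h => hb (Subtype.ext h))
          (fun h => absurd (Finset.mem_univ _) h)]
        exact length_localizedModule_quotient_le_one p.1 e
      obtain ⟨s, hs⟩ := ENat.ne_top_iff_exists.mp (ne_top_of_le_ne_top ENat.one_ne_top hsum)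
      refine ⟨s, 0, hs.symm, fun n => ?_⟩
      rw [Nat.cast_zero, add_zero]
      rw [← hs] at hsum
      calc (n : ℕ∞) * s ≤ n * 1 := by gcongr
        _ = n := mul_one _
        _ ≤ _ := le_lengthQuotientPow_quotient (hF p.1 hp).2 e n
    · refine ⟨0, 0, ?_, fun n => by simp⟩
      exact Finset.sum_eq_zero fun b _ => hzero b fun h => hp (h ▸ b.2)
  | exact N M L f g hf hg hfg hN hL =>
    obtain ⟨s, c, hs, hc⟩ := hN
    obtain ⟨s', c', hs', hc'⟩ := hL
    obtain ⟨k, hk⟩ := add_le_lengthQuotientPow (maximalIdeal C) hf hg hfg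
    -- The Artin–Rees shift by `k` loses at most `k * s`.
    refine ⟨s + s', c + c' + k * s, ?_, fun n => ?_⟩
    · rw [Finset.sum_congr rfl fun b _ => length_localizedModule_eq_add_of_exact b.1 hf hg hfg,
        Finset.sum_add_distrib, hs, hs', Nat.cast_add]
    · have h1 : (n : ℕ∞) ≤ (n - k : ℕ) + k := by
        exact_mod_cast (by omega : n ≤ n - k + k)
      calc (n : ℕ∞) * ((s + s' : ℕ) : ℕ∞) = n * s + n * s' := by rw [Nat.cast_add, mul_add]
        _ ≤ ((n - k : ℕ) + k) * s + n * s' := by gcongr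
        _ = (n - k : ℕ) * s + n * s' + k * s := by rw [add_mul]; abel
        _ ≤ (lengthQuotientPow (maximalIdeal C) N (n - k) + c) +
            (lengthQuotientPow (maximalIdeal C) L n + c') + k * s :=
          add_le_add (add_le_add (hc _) (hc' _)) le_rfl
        _ = (lengthQuotientPow (maximalIdeal C) N (n - k) + lengthQuotientPow (maximalIdeal C) L n) +
            (c + c' + k * s) := by abel
        _ ≤ lengthQuotientPow (maximalIdeal C) M n + (c + c' + k * s) := by gcongr; exact hk n
        _ = _ := by push_cast; rfl

end Multiplicity

lemma length_eq_of_ringEquiv {R S : Type*} [CommRing R] [CommRing S] (e : R ≃+* S) :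
    Module.length R R = Module.length S S := by
  apply WithBot.coe_injective
  rw [Module.coe_length, Module.coe_length]
  exact Order.krullDim_eq_of_orderIso e.symm.idealComapOrderIso

section Multiplicity

variable {R : Type u} [CommRing R] [IsLocalRing R] [IsNoetherianRing R]

lemma length_quotient_pow_eq (n : ℕ) : Module.length R (R ⧸ maximalIdeal R ^ n) =
    lengthQuotientPow (maximalIdeal (LocalCompletion R)) (LocalCompletion R) n := by
  have hff := faithfullyFlat_localCompletion R
  let J := maximalIdeal (LocalCompletion R) ^ n
  have hJ : J = (maximalIdeal R ^ n).map (algebraMap R (LocalCompletion R)) := by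
    rw [Ideal.map_pow, ← AdicCompletion.maximalIdeal_eq_map]
  let f : R →ₗ[R] LocalCompletion R ⧸ J := Algebra.linearMap R _
  have hf : Function.Surjective f := by
    intro x
    obtain ⟨x, rfl⟩ := Ideal.Quotient.mk_surjective x
    obtain ⟨r, hr⟩ := AdicCompletion.exists_sub_mem_pow (IsNoetherian.noetherian (maximalIdeal R)) n x
    refine ⟨r, ?_⟩
    rw [eq_comm]
    refine Ideal.Quotient.eq.mpr ?_
    rw [hJ, Ideal.map_pow]
    exact hr
  have hker : LinearMap.ker f = maximalIdeal R ^ n := by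
    rw [← Ideal.comap_map_eq_self_of_faithfullyFlat (B := LocalCompletion R) (maximalIdeal R ^ n),
      ← hJ]
    ext r
    rw [LinearMap.mem_ker, Ideal.mem_comap]
    exact Ideal.Quotient.eq_zero_iff_mem
  rw [← hker, (f.quotKerEquivOfSurjective hf).length_eq,
    Module.length_eq_of_surjective (R := LocalCompletion R ⧸ J) hf,
    ← Module.length_eq_of_surjective (R := LocalCompletion R ⧸ J) (S := LocalCompletion R)
      Ideal.Quotient.mk_surjective, lengthQuotientPow, Ideal.smul_top_eq_map,
      Algebra.algebraMap_self, Ideal.map_id]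
  rfl

/-- Along the flat local map from the localization at the prime below to the one at `b`, length is
multiplied by the length of the closed fibre, which is at least one. -/
lemma length_localization_le_length_localizedModule (b : Ideal (LocalCompletion R)) [b.IsPrime] :
    Module.length (Localization.AtPrime (b.comap (algebraMap R (LocalCompletion R))))
      (Localization.AtPrime (b.comap (algebraMap R (LocalCompletion R)))) ≤
    Module.length (Localization.AtPrime b) (LocalizedModule b.primeCompl (LocalCompletion R)) := by
  let q := b.comap (algebraMap R (LocalCompletion R))
  let φ : Localization.AtPrime q →+* Localization.AtPrime b :=
    Localization.localRingHom q b (algebraMap R (LocalCompletion R)) rfl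
  algebraize_only [φ]
  have hflat : Module.Flat (Localization.AtPrime q) (Localization.AtPrime b) :=
    RingHom.Flat.localRingHom (f := algebraMap R (LocalCompletion R))
      (RingHom.flat_algebraMap_iff.mpr inferInstance) b q rfl
  have : IsLocalHom (algebraMap (Localization.AtPrime q) (Localization.AtPrime b)) :=
    Localization.isLocalHom_localRingHom _ _ _ rfl
  have e : LocalizedModule b.primeCompl (LocalCompletion R) ≃ₗ[Localization.AtPrime b]
      Localization.AtPrime b :=
    (IsLocalizedModule.linearEquiv b.primeCompl
      (LocalizedModule.mkLinearMap b.primeCompl (LocalCompletion R))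
      (Algebra.linearMap (LocalCompletion R) (Localization.AtPrime b))).extendScalarsOfIsLocalization
        b.primeCompl (Localization.AtPrime b)
  rw [e.length_eq, ← (TensorProduct.AlgebraTensorModule.rid (Localization.AtPrime q)
    (Localization.AtPrime b) (Localization.AtPrime b)).length_eq, IsLocalRing.length_baseChange]
  refine le_mul_of_one_le_right zero_le ?_
  rw [Order.one_le_iff_pos, Module.length_pos_iff, Ideal.Quotient.nontrivial_iff]
  exact (map_maximalIdeal_lt_top (algebraMap (Localization.AtPrime q) (Localization.AtPrime b))).ne

/-- The multiplicity of a local ring is at least the sum of the multiplicities of its branches. -/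
lemma sum_length_le_samuelMultiplicity (F : Finset (Ideal (LocalCompletion R)))
    (hF : ∀ b ∈ F, b ∈ minimalPrimes (LocalCompletion R) ∧ b ≠ maximalIdeal (LocalCompletion R))
    (m : Ideal (LocalCompletion R) → ℕ)
    (hm : ∀ b ∈ F, ∀ (_ : b.IsPrime), m b =
      Module.length (Localization.AtPrime (b.comap (algebraMap R (LocalCompletion R))))
      (Localization.AtPrime (b.comap (algebraMap R (LocalCompletion R))))) :
    ((∑ b ∈ F, m b : ℕ) : ℝ≥0∞) ≤ samuelMultiplicity R := by
  have hN := AdicCompletion.isNoetherianRing (maximalIdeal R)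
  have hF' : ∀ b : F, b.1.IsPrime := fun b => (hF b b.2).1.1.1
  obtain ⟨s, c, hs, hc⟩ := exists_mul_le_lengthQuotientPow_add F hF hF' (LocalCompletion R)
  have hms : ∑ b ∈ F, m b ≤ s := by
    rw [← Nat.cast_le (α := ℕ∞), ← hs, ← Finset.sum_coe_sort, Nat.cast_sum]
    refine Finset.sum_le_sum fun b _ => ?_
    rw [hm b b.2 (hF' b)]
    exact length_localization_le_length_localizedModule b.1
  refine (Nat.cast_le.mpr hms).trans ?_
  -- If the upper limit were below `s`, choose `r` strictly between. For large `n` the length is at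
  -- most `r * n` and at least `s * n - c`, which fails once `n` exceeds `c / (s - r)`.
  by_contra! hlt
  obtain ⟨r, hr1, hr2⟩ := ENNReal.lt_iff_exists_nnreal_btwn.mp hlt
  have hev := Filter.eventually_lt_of_limsup_lt hr1
  have hr3 : (r : ℝ) < s := by exact_mod_cast hr2
  obtain ⟨N, hN'⟩ := exists_nat_gt (c / (s - r : ℝ))
  obtain ⟨n, ⟨hn, hnN⟩, hn0⟩ := ((hev.and (Filter.eventually_ge_atTop N)).and
    (Filter.eventually_gt_atTop 0)).exists
  have h1 := hc n
  rw [← length_quotient_pow_eq] at h1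
  have h2 : ((n * s : ℕ) : ℝ≥0∞) ≤
      ((Module.length R (R ⧸ maximalIdeal R ^ n) : ℕ∞) : ℝ≥0∞) + c := by
    have := ENat.toENNReal_le.mpr h1
    simpa using this
  have h3 : ((Module.length R (R ⧸ maximalIdeal R ^ n) : ℕ∞) : ℝ≥0∞) ≤ r * n := by
    rw [ENNReal.div_lt_iff (Or.inl (by exact_mod_cast hn0.ne')) (Or.inl (ENNReal.natCast_ne_top n))]
      at hn
    exact hn.le
  have h4 : ((n * s : ℕ) : ℝ≥0∞) ≤ r * n + c := h2.trans (by gcongr)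
  have h5 : (n * s : ℝ) ≤ r * n + c := by exact_mod_cast h4
  have h6 : (c : ℝ) < (s - r) * n := by
    rw [div_lt_iff₀' (by linarith)] at hN'
    refine hN'.trans_le ?_
    have : (N : ℝ) ≤ n := by exact_mod_cast hnN
    nlinarith
  nlinarith

end Multiplicity

/-! ### Degrees of the components over a generic point -/

section Degree

variable (A B : Type u) [CommRing A] [IsLocalRing A] [IsNoetherianRing A] [CommRing B]
  [Algebra A B] [Module.Finite A B]

lemma length_ne_top_of_smul_eq_zero {A : Type*} [CommRing A] {t : A}
    (hfin : Module.length A (A ⧸ Ideal.span {t}) ≠ ⊤) (L : Type*) [AddCommGroup L] [Module A L]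
    [Module.Finite A L] (h : ∀ x : L, t • x = 0) : Module.length A L ≠ ⊤ := by
  obtain ⟨n, f, hf⟩ := Module.Finite.exists_fin' A L
  have hk : ∀ i, Ideal.span {t} ≤
      LinearMap.ker (LinearMap.toSpanSingleton A L (f (Pi.single i 1))) := by
    intro i
    rw [Ideal.span_singleton_le_iff_mem, LinearMap.mem_ker, LinearMap.toSpanSingleton_apply, h]
  let g : (Fin n → A ⧸ Ideal.span {t}) →ₗ[A] L :=
    LinearMap.lsum A (fun _ => A ⧸ Ideal.span {t}) A fun i => Submodule.liftQ _ _ (hk i)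
  have hg : Function.Surjective g := by
    intro x
    obtain ⟨v, rfl⟩ := hf x
    refine ⟨fun i => Submodule.Quotient.mk (v i), ?_⟩
    change (LinearMap.lsum A (fun _ => A ⧸ Ideal.span {t}) A fun i => Submodule.liftQ _ _ (hk i)) _ = _
    rw [LinearMap.lsum_apply, LinearMap.sum_apply]
    conv_rhs => rw [pi_eq_sum_univ' v, map_sum]
    refine Finset.sum_congr rfl fun i _ => ?_
    rw [LinearMap.comp_apply, LinearMap.proj_apply, Submodule.liftQ_apply,
      LinearMap.toSpanSingleton_apply, ← map_smul]
  refine ne_top_of_le_ne_top ?_ (Module.length_le_of_surjective g hg)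
  rw [Module.length_pi_of_fintype]
  exact ENat.sum_ne_top.mpr fun i _ => hfin

/-- Filter `L` by powers of `t`; each graded piece is a finite module over the quotient by `t`. -/
lemma length_ne_top_of_pow_smul_eq_zero {A : Type*} [CommRing A] [IsNoetherianRing A] {t : A}
    (hfin : Module.length A (A ⧸ Ideal.span {t}) ≠ ⊤) (n : ℕ) (L : Type*) [AddCommGroup L]
    [Module A L] [Module.Finite A L] (h : ∀ x : L, t ^ n • x = 0) : Module.length A L ≠ ⊤ := by
  induction n generalizing L with
  | zero =>
    have : Subsingleton L := subsingleton_of_forall_eq 0 fun x => by simpa using h x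
    rw [Module.length_eq_zero]
    exact ENat.zero_ne_top
  | succ n ih =>
    let μ : L →ₗ[A] L := LinearMap.lsmul A L t
    rw [Module.length_eq_add_of_exact (LinearMap.range μ).subtype (LinearMap.range μ).mkQ
      (Submodule.subtype_injective _) (Submodule.mkQ_surjective _)
      (LinearMap.exact_subtype_mkQ _)]
    refine WithTop.add_ne_top.mpr ⟨ih _ ?_, length_ne_top_of_smul_eq_zero hfin _ ?_⟩
    · rintro ⟨_, x, rfl⟩
      ext
      change t ^ n • t • x = 0
      rw [smul_smul, ← pow_succ, h]
    · intro x
      obtain ⟨x, rfl⟩ := Submodule.mkQ_surjective _ x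
      rw [← map_smul]
      exact (Submodule.Quotient.mk_eq_zero _).mpr ⟨x, rfl⟩

/-- The length of `B/tA` equals both `ℓ(A/tA) + ℓ(B/A)` and `ℓ(B/A) + ℓ(B/tB)`, the latter because
multiplication by `t` identifies `B/A` with `tB/tA`. The finite length of `B/A` cancels. -/
lemma length_quotient_map_eq [IsDomain B] (hinj : Function.Injective (algebraMap A B)) {t : A}
    (ht0 : t ≠ 0) (ht : ∃ n, ∀ b : B, ∃ a, algebraMap A B (t ^ n) * b = algebraMap A B a)
    (hfin : Module.length A (A ⧸ Ideal.span {t}) ≠ ⊤) :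
    Module.length A (B ⧸ Ideal.span {algebraMap A B t}) =
      Module.length A (A ⧸ Ideal.span {t}) := by
  let j : A →ₗ[A] B := Algebra.linearMap A B
  let μ : B →ₗ[A] B := LinearMap.lsmul A B t
  have hμ : Function.Injective μ := by
    intro b b' h
    have h' : algebraMap A B t * b = algebraMap A B t * b' := by
      rw [← Algebra.smul_def, ← Algebra.smul_def]
      exact h
    exact mul_left_cancel₀ ((map_ne_zero_iff _ hinj).mpr ht0) h'
  let A' : Submodule A B := LinearMap.range j
  let W : Submodule A B := A'.map μ
  have hWA : W ≤ A' := by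
    rintro _ ⟨_, ⟨a, rfl⟩, rfl⟩
    exact ⟨t • a, map_smul j t a⟩
  let tB : Submodule A B := (Ideal.span {algebraMap A B t}).restrictScalars A
  have htB : tB = LinearMap.range μ := by
    ext b
    rw [Submodule.restrictScalars_mem, Ideal.mem_span_singleton]
    constructor
    · rintro ⟨c, rfl⟩
      exact ⟨c, Algebra.smul_def t c⟩
    · rintro ⟨c, rfl⟩
      exact ⟨c, Algebra.smul_def t c⟩
  have hWt : W ≤ tB := by
    rw [htB]
    exact LinearMap.map_le_range
  have h1 : Module.length A (B ⧸ W) =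
      Module.length A (A ⧸ Ideal.span {t}) + Module.length A (B ⧸ A') := by
    have hle : Ideal.span {t} ≤ W.comap j := by
      rw [Ideal.span_singleton_le_iff_mem]
      exact ⟨_, ⟨1, rfl⟩, by simp [μ, j, Algebra.smul_def]⟩
    refine Module.length_eq_add_of_exact (Submodule.mapQ (Ideal.span {t}) W j hle)
      (Submodule.factor hWA) ?_ (Submodule.factor_surjective hWA) ?_
    · rw [← LinearMap.ker_eq_bot, Submodule.ker_mapQ, eq_bot_iff, Submodule.map_le_iff_le_comap]
      rintro a ⟨_, ⟨a', rfl⟩, h⟩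
      rw [Submodule.mem_comap, Submodule.mem_bot]
      refine (Submodule.Quotient.mk_eq_zero _).mpr (Ideal.mem_span_singleton.mpr ⟨a', hinj ?_⟩)
      rw [map_mul, ← Algebra.smul_def]
      exact h.symm
    · rw [LinearMap.exact_iff, Submodule.range_mapQ, Submodule.factor, Submodule.ker_mapQ,
        Submodule.comap_id]
  have h2 : Module.length A (B ⧸ W) = Module.length A (B ⧸ A') + Module.length A (B ⧸ tB) := by
    refine Module.length_eq_add_of_exact (Submodule.mapQ A' W μ (Submodule.le_comap_map _ _))
      (Submodule.factor hWt) ?_ (Submodule.factor_surjective hWt) ?_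
    · rw [← LinearMap.ker_eq_bot, Submodule.ker_mapQ, Submodule.comap_map_eq_of_injective hμ]
      exact Submodule.mkQ_map_self A'
    · rw [LinearMap.exact_iff, Submodule.range_mapQ, Submodule.factor, Submodule.ker_mapQ,
        Submodule.comap_id, htB]
  have h3 : Module.length A (B ⧸ A') ≠ ⊤ := by
    obtain ⟨n, hn⟩ := ht
    refine length_ne_top_of_pow_smul_eq_zero hfin n _ fun x => ?_
    obtain ⟨b, rfl⟩ := Submodule.mkQ_surjective _ x
    obtain ⟨a, ha⟩ := hn b
    rw [← map_smul]
    refine (Submodule.Quotient.mk_eq_zero _).mpr ⟨a, ?_⟩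
    rw [Algebra.smul_def, ha]
    rfl
  rw [h1, add_comm] at h2
  rw [← (Submodule.Quotient.restrictScalarsEquiv A (Ideal.span {algebraMap A B t})).length_eq]
  exact ((WithTop.add_left_inj h3).mp h2).symm

lemma sum_length_le_length_quotient {ι : Type*} [Fintype ι] {K : ι → Type*} [∀ i, CommRing (K i)]
    [∀ i, Algebra A (K i)] (f : ∀ i, B →ₐ[A] K i) (hf : ∀ i, Function.Surjective (f i))
    (hcop : Pairwise (Function.onFun IsCoprime fun i => RingHom.ker (f i))) {t : A}
    (ht : ∀ i, algebraMap A (K i) t = 0) :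
    ∑ i, Module.length A (K i) ≤ Module.length A (B ⧸ Ideal.span {algebraMap A B t}) := by
  rw [← Module.length_pi_of_fintype,
    ← (Submodule.Quotient.restrictScalarsEquiv A (Ideal.span {algebraMap A B t})).length_eq]
  let F : B →ₗ[A] ∀ i, K i := LinearMap.pi fun i => (f i).toLinearMap
  have hF : Function.Surjective F := by
    intro x
    choose y hy using fun i => hf i (x i)
    obtain ⟨z, hz⟩ := Ideal.quotientInfToPiQuotient_surj hcop fun i => Ideal.Quotient.mk _ (y i)
    obtain ⟨z, rfl⟩ := Ideal.Quotient.mk_surjective z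
    refine ⟨z, funext fun i => ?_⟩
    have := congrFun hz i
    rw [Ideal.quotientInfToPiQuotient_mk', Ideal.Quotient.eq, RingHom.mem_ker, map_sub, hy,
      sub_eq_zero] at this
    exact this
  have hk : (Ideal.span {algebraMap A B t}).restrictScalars A ≤ LinearMap.ker F := by
    intro b hb
    rw [Submodule.restrictScalars_mem, Ideal.mem_span_singleton] at hb
    obtain ⟨c, rfl⟩ := hb
    refine funext fun i => ?_
    change f i (_ * _) = 0
    rw [map_mul, AlgHom.commutes, ht, zero_mul]
  exact Module.length_le_of_surjective (Submodule.liftQ _ F hk) (by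
      rw [← LinearMap.range_eq_top, Submodule.range_liftQ, LinearMap.range_eq_top]
      exact hF)

variable {ι : Type u} [Fintype ι] (P : ι → Ideal B) [∀ i, (P i).IsMaximal] (E : ι → Type u)
  [∀ i, CommRing (E i)] [∀ i, IsLocalRing (E i)] [∀ i, Algebra A (E i)] [∀ i, Algebra B (E i)]
  [∀ i, IsScalarTower A B (E i)] [∀ i, IsLocalHom (algebraMap A (E i))]
  [∀ i, IsLocalization.AtPrime (E i) (P i)]

lemma residue_comp_algebraMap_surjective (E : Type u) [CommRing E] [IsLocalRing E] [Algebra B E]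
    (P : Ideal B) [P.IsMaximal] [IsLocalization.AtPrime E P] :
    Function.Surjective ((residue E).comp (algebraMap B E)) := by
  intro x
  obtain ⟨y, rfl⟩ := residue_surjective x
  obtain ⟨b, hb⟩ := exists_sub_algebraMap_mem_pow B E P 1 y
  refine ⟨b, ?_⟩
  rw [pow_one, ← residue_eq_zero_iff, map_sub, sub_eq_zero] at hb
  exact hb.symm

lemma ker_residue_comp_algebraMap (E : Type u) [CommRing E] [IsLocalRing E] [Algebra B E]
    (P : Ideal B) [P.IsMaximal] [IsLocalization.AtPrime E P] :
    RingHom.ker ((residue E).comp (algebraMap B E)) = P := by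
  rw [← RingHom.comap_ker, ker_residue]
  exact IsLocalization.AtPrime.under_maximalIdeal E P

/-- The quotient of `B` by `t` surjects onto the product of the residue fields at its maximal
ideals, by the Chinese remainder theorem. -/
lemma sum_length_residueField_le (hP : Function.Injective P) {t : A} (ht : t ∈ maximalIdeal A) :
    ∑ i, Module.length (ResidueField A) (ResidueField (E i)) ≤
      Module.length A (B ⧸ Ideal.span {algebraMap A B t}) := by
  have h1 : ∀ i, Module.length (ResidueField A) (ResidueField (E i)) =
      Module.length A (ResidueField (E i)) := fun i =>
    (Module.length_eq_of_surjective (S := A) (R := ResidueField A) residue_surjective).symm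
  simp_rw [h1]
  let f : ∀ i, B →ₐ[A] ResidueField (E i) := fun i =>
    { (residue (E i)).comp (algebraMap B (E i)) with
      commutes' := fun a => by
        change residue (E i) (algebraMap B (E i) (algebraMap A B a)) = _
        rw [← IsScalarTower.algebraMap_apply A B (E i)]
        rfl }
  have hk : ∀ i, RingHom.ker (f i) = P i := fun i => ker_residue_comp_algebraMap B (E i) (P i)
  refine sum_length_le_length_quotient A B f
    (fun i => residue_comp_algebraMap_surjective B (E i) (P i)) ?_ fun i => ?_
  · intro i j hij
    rw [Function.onFun, hk, hk]
    exact Ideal.isCoprime_of_isMaximal fun h => hij (hP h)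
  · rw [← (f i).commutes]
    change residue (E i) (algebraMap B (E i) (algebraMap A B t)) = 0
    rw [← IsScalarTower.algebraMap_apply A B (E i), residue_eq_zero_iff]
    exact (maximalIdeal_comap (algebraMap A (E i))).ge ht

end Degree

/-! ## Fibres of morphisms of schemes -/

lemma eq_zero_of_mem_maximalIdeal_localization {K : Type*} [Field K] (p : Ideal K) [p.IsPrime]
    {w : Localization.AtPrime p} (hw : w ∈ maximalIdeal (Localization.AtPrime p)) : w = 0 := by
  rw [← Localization.AtPrime.map_eq_maximalIdeal] at hw
  have hp : p = ⊥ := (Ideal.eq_bot_or_top p).resolve_right (Ideal.IsPrime.ne_top ‹_›)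
  have h : p.map (algebraMap K (Localization.AtPrime p)) ≤ ⊥ :=
    Ideal.map_le_iff_le_comap.mpr (hp.le.trans bot_le)
  exact h hw

lemma stalkMap_eq_zero_of_fromSpec_field {K : Type u} [Field K] {T : Scheme.{u}}
    (α : Spec (CommRingCat.of K) ⟶ T) (z : Spec (CommRingCat.of K))
    (a : T.presheaf.stalk (α z)) (ha : a ∈ maximalIdeal (T.presheaf.stalk (α z))) :
    (α.stalkMap z).hom a = 0 := by
  have h1 : (α.stalkMap z).hom a ∈ maximalIdeal _ :=
    (maximalIdeal_comap (α.stalkMap z).hom).ge ha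
  have hz : z.asIdeal.IsPrime := z.2
  let e := (Spec.stalkIso (CommRingCat.of K) z).commRingCatIsoToRingEquiv
  have h3 : e ((α.stalkMap z).hom a) = 0 :=
    eq_zero_of_mem_maximalIdeal_localization (K := K) z.asIdeal
      fun h => h1 ((MulEquiv.isUnit_map e).mp h)
  exact e.injective (h3.trans (map_zero e).symm)

lemma stalkMap_eq_zero_of_factor {Z T : Scheme.{u}} {t₀ : T} {α : Z ⟶ T}
    (β : Z ⟶ Spec (T.residueField t₀)) (h : α = β ≫ T.fromSpecResidueField t₀) (z : Z)
    (a : T.presheaf.stalk (α z)) (ha : a ∈ maximalIdeal (T.presheaf.stalk (α z))) :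
    (α.stalkMap z).hom a = 0 := by
  subst h
  rw [Scheme.Hom.stalkMap_comp]
  have := stalkMap_eq_zero_of_fromSpec_field (K := T.residueField t₀)
    (T.fromSpecResidueField t₀) (β z) a ha
  change (β.stalkMap z).hom (((T.fromSpecResidueField t₀).stalkMap (β z)).hom a) = 0
  rw [this, map_zero]

lemma exists_eq_SpecMap_fromSpecStalk {C : Scheme.{u}} {S : Type u} [CommRing S] [IsLocalRing S]
    (φ : Spec (CommRingCat.of S) ⟶ C) {c : C} {z : Spec (CommRingCat.of S)}
    (hz : z = closedPoint S) (h : φ z = c) :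
    ∃ θ : C.presheaf.stalk c ⟶ CommRingCat.of S, φ = Spec.map θ ≫ C.fromSpecStalk c := by
  subst hz h
  exact ⟨Scheme.stalkClosedPointTo (R := CommRingCat.of S) φ,
    (Scheme.Spec_stalkClosedPointTo_fromSpecStalk _).symm⟩

section Fiber

variable {Y T : Scheme.{u}} (g : Y ⟶ T) (t₀ : T) (c : g.fiber t₀)

lemma apply_fiberι : g (g.fiberι t₀ c) = t₀ := by
  have : g.fiberι t₀ c ∈ g ⁻¹' {t₀} := by
    rw [← g.range_fiberι]
    exact ⟨c, rfl⟩
  exact this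

lemma fiberι_stalkMap_surjective : Function.Surjective ((g.fiberι t₀).stalkMap c).hom :=
  (g.fiberι t₀).stalkMap_surjective c

/-- The local ring of a fibre is the quotient of the local ring of the total space by the ideal
generated by the maximal ideal of the local ring of the base. -/
lemma ker_fiberι_stalkMap : RingHom.ker ((g.fiberι t₀).stalkMap c).hom =
    (maximalIdeal (T.presheaf.stalk (g (g.fiberι t₀ c)))).map
      (g.stalkMap (g.fiberι t₀ c)).hom := by
  apply le_antisymm
  · let x := g.fiberι t₀ c
    let J := (maximalIdeal (T.presheaf.stalk (g x))).map (g.stalkMap x).hom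
    have hJ : J ≤ maximalIdeal (Y.presheaf.stalk x) :=
      Ideal.map_le_iff_le_comap.mpr (maximalIdeal_comap (g.stalkMap x).hom).ge
    have hnt : Nontrivial (Y.presheaf.stalk x ⧸ J) :=
      Ideal.Quotient.nontrivial_iff.mpr fun h => Ideal.IsPrime.ne_top
        (inferInstance : (maximalIdeal (Y.presheaf.stalk x)).IsPrime) (top_le_iff.mp (h.ge.trans hJ))
    have hloc : IsLocalRing (Y.presheaf.stalk x ⧸ J) :=
      IsLocalRing.of_surjective' (Ideal.Quotient.mk J) Ideal.Quotient.mk_surjective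
    have hlh : IsLocalHom (Ideal.Quotient.mk J) :=
      IsLocalHom.of_surjective _ Ideal.Quotient.mk_surjective
    let q : Y.presheaf.stalk x ⟶ CommRingCat.of (Y.presheaf.stalk x ⧸ J) :=
      CommRingCat.ofHom (Ideal.Quotient.mk J)
    let ρ : T.residueField (g x) ⟶ CommRingCat.of (Y.presheaf.stalk x ⧸ J) :=
      CommRingCat.ofHom (Ideal.Quotient.lift (maximalIdeal (T.presheaf.stalk (g x)))
        ((Ideal.Quotient.mk J).comp (g.stalkMap x).hom) fun a ha =>
          Ideal.Quotient.eq_zero_iff_mem.mpr (Ideal.mem_map_of_mem _ ha))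
    have hρ : T.residue (g x) ≫ ρ = g.stalkMap x ≫ q := by
      ext a
      rfl
    have h0 : t₀ = g x := (apply_fiberι g t₀ c).symm
    -- The quotient of the local ring by the extended ideal lies over the residue field of the base,
    -- so its spectrum maps to the fibre, with closed point going to `c`. The quotient map thus
    -- factors through the local ring of the fibre, which bounds the kernel.
    let φ : Spec (CommRingCat.of (Y.presheaf.stalk x ⧸ J)) ⟶ g.fiber t₀ :=
      pullback.lift (Spec.map q ≫ Y.fromSpecStalk x)
        (Spec.map ρ ≫ Spec.map (T.residueFieldCongr h0).hom) (by
          rw [Category.assoc, Category.assoc, Scheme.residueFieldCongr_fromSpecResidueField,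
            ← Scheme.SpecMap_stalkMap_fromSpecStalk, ← Spec.map_comp_assoc, ← hρ,
            Spec.map_comp_assoc]
          rfl)
    have hφ : φ ≫ g.fiberι t₀ = Spec.map q ≫ Y.fromSpecStalk x := pullback.lift_fst ..
    obtain ⟨z, hz⟩ : ∃ z : Spec (CommRingCat.of (Y.presheaf.stalk x ⧸ J)),
        z = closedPoint (Y.presheaf.stalk x ⧸ J) := ⟨_, rfl⟩
    have hc : φ z = c := by
      refine (g.fiberι t₀).isEmbedding.injective ?_
      rw [← Scheme.Hom.comp_apply, hφ, Scheme.Hom.comp_apply]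
      have : Spec.map q z = closedPoint (Y.presheaf.stalk x) := by
        rw [hz]
        exact comap_closedPoint (Ideal.Quotient.mk J)
      rw [this]
      exact Scheme.fromSpecStalk_closedPoint
    obtain ⟨θ, hθ⟩ := exists_eq_SpecMap_fromSpecStalk φ hz hc
    have h1 : (g.fiberι t₀).stalkMap c ≫ θ = q := by
      rw [← Spec.map_inj, ← cancel_mono (Y.fromSpecStalk x), ← hφ, hθ, Spec.map_comp,
        Category.assoc, Category.assoc, Scheme.SpecMap_stalkMap_fromSpecStalk]
    intro a ha
    refine Ideal.Quotient.eq_zero_iff_mem.mp (?_ : q.hom a = 0)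
    rw [← h1]
    change θ.hom (((g.fiberι t₀).stalkMap c).hom a) = 0
    rw [RingHom.mem_ker.mp ha, map_zero]
  · rw [Ideal.map_le_iff_le_comap]
    intro a ha
    rw [Ideal.mem_comap, RingHom.mem_ker]
    have := stalkMap_eq_zero_of_factor (g.fiberToSpecResidueField t₀) (g.fiber_fac t₀) c a ha
    rw [Scheme.Hom.stalkMap_comp] at this
    exact this

end Fiber

/-! ## Uniformizers of smooth curves -/

/-- The prime below `P` in the polynomial ring is principal, and its generator generates the maximal
ideal upstairs because étale maps are unramified. Flatness keeps it nonzero. -/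
lemma Algebra.exists_maximalIdeal_eq_span_of_etale {k S : Type*} [Field k] [CommRing S]
    [Algebra (MvPolynomial (Fin 1) k) S] [Algebra.Etale (MvPolynomial (Fin 1) k) S]
    (P : Ideal S) [hP : P.IsMaximal] :
    ∃ t, maximalIdeal (Localization.AtPrime P) = Ideal.span {t} ∧ t ≠ 0 := by
  let R := MvPolynomial (Fin 1) k
  let Q : Ideal R := P.comap (algebraMap R S)
  have : IsPrincipalIdealRing R :=
    IsPrincipalIdealRing.of_surjective (MvPolynomial.uniqueAlgEquiv k (Fin 1)).symm.toRingHom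
      (MvPolynomial.uniqueAlgEquiv k (Fin 1)).symm.surjective
  -- By the Nullstellensatz the residue field of `P` is algebraic over `k`, so the variable
  -- satisfies a polynomial relation modulo `P`.
  have hQ : Q ≠ ⊥ := by
    intro hbot
    algebraize [(algebraMap R S).comp (algebraMap k R)]
    have : IsScalarTower k R S := IsScalarTower.of_algebraMap_eq' rfl
    have : Algebra.FiniteType k S := Algebra.FiniteType.trans (S := R) inferInstance inferInstance
    let _ : Field (S ⧸ P) := Ideal.Quotient.field P
    have : Module.Finite k (S ⧸ P) := finite_of_finite_type_of_isJacobsonRing k (S ⧸ P)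
    obtain ⟨p, hp0, hp⟩ := Algebra.IsAlgebraic.isAlgebraic (R := k)
      (algebraMap R (S ⧸ P) (MvPolynomial.X 0))
    have h1 : algebraMap R (S ⧸ P) (Polynomial.aeval (MvPolynomial.X 0) p) = 0 := by
      rw [← Polynomial.aeval_algebraMap_apply, hp]
    have h2 : Polynomial.aeval (MvPolynomial.X 0 : R) p ∈ Q := by
      rw [IsScalarTower.algebraMap_apply R S, Ideal.Quotient.algebraMap_eq,
        Ideal.Quotient.eq_zero_iff_mem] at h1
      exact h1
    rw [hbot, Ideal.mem_bot] at h2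
    exact MvPolynomial.transcendental_X k (0 : Fin 1) ⟨p, hp0, h2⟩
  obtain ⟨h, hh⟩ := IsPrincipalIdealRing.principal Q
  have hh : Q = Ideal.span {h} := hh
  have hQP : Q.IsPrime := inferInstance
  have : P.LiesOver Q := ⟨rfl⟩
  let _ : Algebra (Localization.AtPrime Q) (Localization.AtPrime P) :=
    (Localization.localRingHom Q P (algebraMap R S) rfl).toAlgebra
  have : Localization.AtPrime.IsLiesOverAlgebra Q P := ⟨rfl⟩
  have hun : Algebra.IsUnramifiedAt R P := inferInstance
  have hmap := ((Algebra.isUnramifiedAt_iff_map_eq R Q P).mp hun).2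
  rw [hh, Ideal.map_span, Set.image_singleton] at hmap
  refine ⟨_, hmap.symm, fun h0 => ?_⟩
  have hfl : Module.Flat R (Localization.AtPrime P) := Module.Flat.trans R S _
  have hne : h ≠ 0 := by
    rintro rfl
    exact hQ (by rw [hh, Ideal.span_singleton_eq_bot])
  have hreg : IsSMulRegular R h := by
    intro a b hab
    exact mul_left_cancel₀ hne hab
  have := hreg.of_flat (S := Localization.AtPrime P)
  refine one_ne_zero (α := Localization.AtPrime P) (this ?_)
  simp [h0]

/-- The ring of global sections of `Spec k` carries only its ring structure; this version avoids a
conflicting field instance. -/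
lemma Algebra.exists_maximalIdeal_eq_span_of_etale_of_isField {k S : Type*} [i : CommRing k]
    (hk : IsField k) [CommRing S] [Algebra (MvPolynomial (Fin 1) k) S]
    [Algebra.Etale (MvPolynomial (Fin 1) k) S] (P : Ideal S) [hP : P.IsMaximal] :
    ∃ t, maximalIdeal (Localization.AtPrime P) = Ideal.span {t} ∧ t ≠ 0 := by
  obtain ⟨F, rfl⟩ : ∃ F : Field k, i = F.toCommRing := ⟨hk.toField, rfl⟩
  exact Algebra.exists_maximalIdeal_eq_span_of_etale (k := k) P

/-- Locally a smooth curve is étale over the affine line. -/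
lemma exists_maximalIdeal_stalk_eq_span {T : Scheme.{u}} {k : Type u} [Field k]
    (p : T ⟶ Spec (CommRingCat.of k)) [SmoothOfRelativeDimension 1 p] {t₀ : T}
    (ht₀ : IsClosed {t₀}) :
    ∃ t, maximalIdeal (T.presheaf.stalk t₀) = Ideal.span {t} ∧ t ≠ 0 := by
  obtain ⟨U, hU, V, hV, hx, e, hf⟩ :=
    SmoothOfRelativeDimension.exists_isStandardSmoothOfRelativeDimension (n := 1) (f := p) t₀
  have hUtop : U = ⊤ := by
    have hpt : p t₀ ∈ U := e hx
    ext z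
    have : z = p t₀ := Subsingleton.elim (α := PrimeSpectrum k) _ _
    simpa [this] using hpt
  subst hUtop
  have hk : IsField Γ(Spec (CommRingCat.of k), ⊤) :=
    MulEquiv.isField (Field.toIsField k)
      (Scheme.ΓSpecIso (CommRingCat.of k)).commRingCatIsoToRingEquiv.toMulEquiv
  obtain ⟨g, -, hg⟩ := hf.exists_etale_mvPolynomial
  algebraize [g]
  let P := (hV.primeIdealOf ⟨t₀, hx⟩).asIdeal
  have hP : P.IsMaximal := hV.primeIdealOf_isMaximal_of_isClosed ⟨t₀, hx⟩ ht₀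
  obtain ⟨t, ht, ht0⟩ := Algebra.exists_maximalIdeal_eq_span_of_etale_of_isField hk P
  let _ := TopCat.Presheaf.algebra_section_stalk T.presheaf (⟨t₀, hx⟩ : V)
  have := hV.isLocalization_stalk ⟨t₀, hx⟩
  let E := (IsLocalization.algEquiv P.primeCompl (Localization.AtPrime P)
    (T.presheaf.stalk t₀)).toRingEquiv
  refine ⟨E t, ?_, by simpa using ht0⟩
  rw [← Set.image_singleton, ← Ideal.map_span, ← ht]
  exact (map_maximalIdeal_of_surjective E.toRingHom E.surjective).symm

/-! ## The semilocal ring of a finite morphism -/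

/-- A finite birational extension of a local domain `A`, whose maximal ideals are indexed by `ι` and
whose localizations at them are the rings `E i`. -/
structure IsSemilocalModel (A B : Type*) [CommRing A] [CommRing B] [Algebra A B] {ι : Type*}
    (P : ι → Ideal B) (E : ι → Type*) [∀ i, CommRing (E i)] [∀ i, Algebra A (E i)]
    [∀ i, Algebra B (E i)] : Prop where
  isMaximal : ∀ i, (P i).IsMaximal
  isScalarTower : ∀ i, IsScalarTower A B (E i)
  finite : Module.Finite A B
  isLocalization : ∀ i, ∃ _ : (P i).IsPrime, IsLocalization.AtPrime (E i) (P i)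
  injective : Function.Injective P
  exists_eq : ∀ M : Ideal B, M.IsMaximal → ∃ i, P i = M
  isDomain : IsDomain B
  algebraMap_injective : Function.Injective (algebraMap A B)
  exists_mul_eq : ∀ b : B, ∃ s a : A, s ≠ 0 ∧ algebraMap A B s * b = algebraMap A B a

/-- Localize both rings at the complement of `p`. By integrality, the maximal ideals of the
localized extension are exactly the primes over `p`. -/
lemma exists_isSemilocalModel {A₀ B₀ A : Type u} [CommRing A₀] [CommRing B₀] [Algebra A₀ B₀]
    [Module.Finite A₀ B₀] [IsDomain A₀] [IsDomain B₀] (hinj : Function.Injective (algebraMap A₀ B₀))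
    (hbir : ∀ b : B₀, ∃ s a : A₀, s ≠ 0 ∧ algebraMap A₀ B₀ s * b = algebraMap A₀ B₀ a)
    [CommRing A] [Algebra A₀ A] (p : Ideal A₀) [p.IsPrime] [IsLocalization.AtPrime A p]
    {ι : Type*} (Q : ι → Ideal B₀) [∀ i, (Q i).IsPrime]
    (hQ : ∀ i, (Q i).comap (algebraMap A₀ B₀) = p) (hQinj : Function.Injective Q)
    (hQsurj : ∀ M : Ideal B₀, M.IsPrime → M.comap (algebraMap A₀ B₀) = p → ∃ i, Q i = M)
    (E : ι → Type u) [∀ i, CommRing (E i)] [∀ i, Algebra B₀ (E i)]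
    [∀ i, IsLocalization.AtPrime (E i) (Q i)] [∀ i, Algebra A (E i)]
    (hE : ∀ i, (algebraMap A (E i)).comp (algebraMap A₀ A) =
      (algebraMap B₀ (E i)).comp (algebraMap A₀ B₀)) :
    ∃ (B : Type u) (_ : CommRing B) (_ : Algebra A B) (_ : ∀ i, Algebra B (E i))
      (P : ι → Ideal B), IsSemilocalModel A B P E := by
  let M := p.primeCompl
  let M' := Algebra.algebraMapSubmonoid B₀ M
  let B := Localization M'
  have hMQ : ∀ i, M' ≤ (Q i).primeCompl := by
    rintro i _ ⟨s, hs, rfl⟩ h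
    exact hs (by rw [← hQ i]; exact h)
  let _ : Algebra A B := localizationAlgebra M B₀
  let _ : ∀ i, Algebra B (E i) := fun i => (IsLocalization.lift (M := M') (S := B)
    (g := algebraMap B₀ (E i)) fun s =>
      IsLocalization.map_units (E i) (⟨s, hMQ i s.2⟩ : (Q i).primeCompl)).toAlgebra
  have hAB : ∀ a : A₀, algebraMap A B (algebraMap A₀ A a) = algebraMap B₀ B (algebraMap A₀ B₀ a) :=
    fun a => IsLocalization.map_eq _ a
  have hBE : ∀ i, ∀ b : B₀, algebraMap B (E i) (algebraMap B₀ B b) = algebraMap B₀ (E i) b :=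
    fun i b => IsLocalization.lift_eq _ b
  have t1 : ∀ i, IsScalarTower B₀ B (E i) := fun i => .of_algebraMap_eq fun b => (hBE i b).symm
  have t2 : ∀ i, IsScalarTower A B (E i) := fun i => .of_algebraMap_eq' (by
    refine IsLocalization.ringHom_ext M ?_
    rw [hE]
    ext a
    simp only [RingHom.comp_apply]
    rw [hAB, hBE])
  have t3 : IsScalarTower A₀ A B := .of_algebraMap_eq fun a => by
    rw [hAB, ← IsScalarTower.algebraMap_apply]
  have hM'0 : M' ≤ nonZeroDivisors B₀ := by
    rintro _ ⟨s, hs, rfl⟩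
    refine mem_nonZeroDivisors_of_ne_zero fun h => hs ?_
    rw [(map_eq_zero_iff _ hinj).mp h]
    exact zero_mem p
  have hM0 : M ≤ nonZeroDivisors A₀ := p.primeCompl_le_nonZeroDivisors
  have hfin : Module.Finite A B := Module.Finite.of_isLocalization A₀ B₀ M
  have hdom : IsDomain B := IsLocalization.isDomain_of_le_nonZeroDivisors B hM'0
  have hloc : ∀ i, IsLocalRing (E i) := fun i => IsLocalization.AtPrime.isLocalRing (E i) (Q i)
  let P : ι → Ideal B := fun i => (maximalIdeal (E i)).comap (algebraMap B (E i))
  have hP0 : ∀ i, (P i).comap (algebraMap B₀ B) = Q i := by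
    intro i
    rw [Ideal.comap_comap, ← IsScalarTower.algebraMap_eq]
    exact IsLocalization.AtPrime.under_maximalIdeal (E i) (Q i)
  have hlocA : IsLocalRing A := IsLocalization.AtPrime.isLocalRing A p
  have hcomap : ∀ N : Ideal B, (N.comap (algebraMap A B)).comap (algebraMap A₀ A) =
      (N.comap (algebraMap B₀ B)).comap (algebraMap A₀ B₀) := by
    intro N
    ext a
    simp only [Ideal.mem_comap]
    rw [hAB]
  have hPm : ∀ i, (P i).comap (algebraMap A B) = maximalIdeal A := by
    intro i
    have h1 := hcomap (P i)
    rw [hP0, hQ, ← IsLocalization.AtPrime.under_maximalIdeal A p] at h1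
    exact (IsLocalization.orderEmbedding M A).injective h1
  refine ⟨B, inferInstance, inferInstance, inferInstance, P, ?_, t2, hfin, ?_, ?_, ?_, hdom, ?_, ?_⟩
  · intro i
    exact Ideal.isMaximal_of_isIntegral_of_isMaximal_comap (R := A) _ (by
      rw [hPm]; exact maximalIdeal.isMaximal A)
  · intro i
    refine ⟨inferInstance, ?_⟩
    have := IsLocalization.isLocalization_of_submonoid_le B (E i) M' (Q i).primeCompl (hMQ i)
    refine IsLocalization.of_le (M := (Q i).primeCompl.map (algebraMap B₀ B)) (P i).primeCompl ?_ ?_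
    · rintro _ ⟨s, hs, rfl⟩ h
      refine hs ?_
      rw [SetLike.mem_coe, ← hP0 i]
      exact h
    · intro r hr
      by_contra h
      exact hr h
  · intro i j h
    apply hQinj
    rw [← hP0, h, hP0]
  · intro N hN
    have h1 : N.comap (algebraMap A B) = maximalIdeal A :=
      eq_maximalIdeal (Ideal.isMaximal_comap_of_isIntegral_of_isMaximal (R := A) N)
    have h2 := hcomap N
    rw [h1] at h2
    replace h2 := (IsLocalization.AtPrime.under_maximalIdeal A p).symm.trans h2
    obtain ⟨i, hi⟩ := hQsurj _ inferInstance h2.symm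
    refine ⟨i, (IsLocalization.orderEmbedding M' B).injective ?_⟩
    exact (hP0 i).trans hi
  · exact IsLocalization.map_injective_of_injective' M B₀ B (N := M') M.le_comap_map
      (fun h => zero_notMem_nonZeroDivisors (hM'0 h)) hinj
  · intro b
    obtain ⟨⟨b₀, ⟨_, s, hs, rfl⟩⟩, hb⟩ := IsLocalization.surj M' b
    obtain ⟨s', a, hs', ha⟩ := hbir b₀
    have hinjA : Function.Injective (algebraMap A₀ A) := IsLocalization.injective A hM0
    refine ⟨algebraMap A₀ A (s * s'), algebraMap A₀ A a, ?_, ?_⟩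
    · rw [Ne, map_eq_zero_iff _ hinjA]
      refine mul_ne_zero ?_ hs'
      rintro rfl
      exact hs (zero_mem p)
    · rw [hAB, hAB, ← ha, map_mul, map_mul, map_mul, ← hb]
      dsimp only
      ring

/-! ### Stalk maps to a prescribed image point, and the semilocal ring of a finite birational
morphism -/

namespace AlgebraicGeometry.Scheme.Hom

/-- The map of local rings from the local ring at `z` to the local ring at `y`, if `y` is mapped
to `z`. -/
noncomputable def stalkMapOfEq {Y Z : Scheme.{u}} (g : Y ⟶ Z) {y : Y} {z : Z} (h : g y = z) :
    Z.presheaf.stalk z ⟶ Y.presheaf.stalk y :=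
  Z.presheaf.stalkSpecializes (specializes_of_eq h) ≫ g.stalkMap y

lemma stalkMapOfEq_rfl {Y Z : Scheme.{u}} (g : Y ⟶ Z) (y : Y) :
    g.stalkMapOfEq (rfl : g y = g y) = g.stalkMap y := by
  simp [stalkMapOfEq]

instance {Y Z : Scheme.{u}} (g : Y ⟶ Z) {y : Y} {z : Z} (h : g y = z) :
    IsLocalHom (g.stalkMapOfEq h).hom := by
  subst h
  rw [stalkMapOfEq_rfl]
  infer_instance

lemma germ_stalkMapOfEq {Y Z : Scheme.{u}} (g : Y ⟶ Z) {y : Y} {z : Z} (h : g y = z)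
    (U : Z.Opens) (hz : z ∈ U) :
    Z.presheaf.germ U z hz ≫ g.stalkMapOfEq h =
      g.app U ≫ Y.presheaf.germ (g ⁻¹ᵁ U) y (by subst h; exact hz) := by
  subst h
  rw [stalkMapOfEq_rfl, germ_stalkMap]

end AlgebraicGeometry.Scheme.Hom

section Birational

variable {X' X : Scheme.{u}} [AlgebraicGeometry.IsIntegral X'] [AlgebraicGeometry.IsIntegral X]
  (ν : X' ⟶ X)

lemma app_injective_of_isIso_stalkMap [IsIso (ν.stalkMap (genericPoint X'))] (U : X.Opens)
    (hU : ν (genericPoint X') ∈ U) : Function.Injective (ν.app U).hom := by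
  have h := congrArg CommRingCat.Hom.hom (ν.germ_stalkMap U (genericPoint X') hU)
  have h1 : Function.Injective (ν.stalkMap (genericPoint X')).hom :=
    (asIso (ν.stalkMap (genericPoint X'))).commRingCatIsoToRingEquiv.injective
  have h2 := h1.comp (germ_injective_of_isIntegral X (ν (genericPoint X')) hU)
  rw [CommRingCat.hom_comp, CommRingCat.hom_comp] at h
  exact Function.Injective.of_comp (f := (X'.presheaf.germ _ _ hU).hom)
    ((congrArg (fun φ : _ →+* _ => Function.Injective φ) h).mp h2)

/-- The isomorphism of stalks at the generic points writes every section upstairs as a fraction of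
sections downstairs. -/
lemma exists_app_mul_eq [IsIso (ν.stalkMap (genericPoint X'))]
    {U : X.Opens} (hUa : IsAffineOpen U)
    (hU : ν (genericPoint X') ∈ U) (b : Γ(X', ν ⁻¹ᵁ U)) :
    ∃ s a : Γ(X, U), s ≠ 0 ∧ (ν.app U).hom s * b = (ν.app U).hom a := by
  let e := (asIso (ν.stalkMap (genericPoint X'))).commRingCatIsoToRingEquiv
  obtain ⟨z, hz⟩ := e.surjective (X'.presheaf.germ (ν ⁻¹ᵁ U) (genericPoint X') hU b)
  let _ := TopCat.Presheaf.algebra_section_stalk X.presheaf (⟨_, hU⟩ : U)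
  have := hUa.isLocalization_stalk ⟨_, hU⟩
  obtain ⟨⟨a, s⟩, hs⟩ := IsLocalization.surj (hUa.primeIdealOf ⟨_, hU⟩).asIdeal.primeCompl z
  have hg := ν.germ_stalkMap_apply U (genericPoint X') hU
  refine ⟨s, a, fun h => s.2 (by rw [h]; exact zero_mem _),
    germ_injective_of_isIntegral X' (genericPoint X') (U := ν ⁻¹ᵁ U) hU ?_⟩
  have h1 := congrArg e hs
  rw [map_mul, hz] at h1
  refine (map_mul (X'.presheaf.germ (ν ⁻¹ᵁ U) (genericPoint X') hU).hom _ _).trans ?_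
  refine (congrArg₂ (· * ·) (hg s).symm rfl).trans (Eq.trans ?_ (hg a))
  rw [mul_comm]
  exact h1

theorem exists_isSemilocalModel_stalk [IsFinite ν] [IsIso (ν.stalkMap (genericPoint X'))]
    (hgen : ν (genericPoint X') = genericPoint X) (x : X)
    {ι : Type u} (e : ι → X') (he : ∀ i, ν (e i) = x) (hinj : Function.Injective e)
    (hsurj : ∀ x', ν x' = x → ∃ i, e i = x')
    [inst : ∀ i, Algebra (X.presheaf.stalk x) (X'.presheaf.stalk (e i))]
    (hinst : ∀ i, algebraMap (X.presheaf.stalk x) (X'.presheaf.stalk (e i)) =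
      (ν.stalkMapOfEq (he i)).hom) :
    ∃ (B : Type u) (_ : CommRing B) (_ : Algebra (X.presheaf.stalk x) B)
      (_ : ∀ i, Algebra B (X'.presheaf.stalk (e i))) (P : ι → Ideal B),
      IsSemilocalModel (X.presheaf.stalk x) B P fun i => X'.presheaf.stalk (e i) := by
  obtain ⟨U, hUa, hxU, -⟩ := exists_isAffineOpen_mem_and_subset (TopologicalSpace.Opens.mem_top x)
  have hUne : Nonempty U := ⟨⟨x, hxU⟩⟩
  have hU : ν (genericPoint X') ∈ U := by
    rw [hgen]
    exact ((genericPoint_spec X).mem_open_set_iff U.isOpen).mpr (by simpa using hUne)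
  have hW : IsAffineOpen (ν ⁻¹ᵁ U) := hUa.preimage ν
  have heU : ∀ i, e i ∈ ν ⁻¹ᵁ U := fun i => (congrArg (· ∈ U) (he i)).mpr hxU
  have : Nonempty (ν ⁻¹ᵁ U) := ⟨⟨_, hU⟩⟩
  let _ : Algebra Γ(X, U) Γ(X', ν ⁻¹ᵁ U) := (ν.app U).hom.toAlgebra
  have hfin : Module.Finite Γ(X, U) Γ(X', ν ⁻¹ᵁ U) := ν.finite_app U hUa
  let _ := TopCat.Presheaf.algebra_section_stalk X.presheaf (⟨x, hxU⟩ : U)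
  have := hUa.isLocalization_stalk ⟨x, hxU⟩
  let _ := fun i => TopCat.Presheaf.algebra_section_stalk X'.presheaf (⟨e i, heU i⟩ : ν ⁻¹ᵁ U)
  have := fun i => hW.isLocalization_stalk ⟨e i, heU i⟩
  have hcomap : ∀ x' (hx' : x' ∈ ν ⁻¹ᵁ U), (hW.primeIdealOf ⟨x', hx'⟩).comap (ν.app U).hom =
      hUa.primeIdealOf ⟨ν x', hx'⟩ := by
    intro x' hx'
    have := IsAffineOpen.comap_primeIdealOf_appLE (f := ν) U hUa (ν ⁻¹ᵁ U) hW le_rfl hx'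
    rwa [← Scheme.Hom.app_eq_appLE] at this
  refine exists_isSemilocalModel (A₀ := Γ(X, U)) (B₀ := Γ(X', ν ⁻¹ᵁ U))
    (app_injective_of_isIso_stalkMap ν U hU) (exists_app_mul_eq ν hUa hU)
    (hUa.primeIdealOf ⟨x, hxU⟩).asIdeal (fun i => (hW.primeIdealOf ⟨e i, heU i⟩).asIdeal) ?_ ?_ ?_
    (fun i => X'.presheaf.stalk (e i)) ?_
  · intro i
    refine (congrArg PrimeSpectrum.asIdeal (hcomap (e i) (heU i))).trans ?_
    congr 2
    exact Subtype.ext (he i)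
  · intro i j h
    have h1 := congrArg (fun z => hW.fromSpec z) (PrimeSpectrum.ext h)
    simp only [hW.fromSpec_primeIdealOf] at h1
    exact hinj h1
  · intro M hM hMx
    let w : PrimeSpectrum Γ(X', ν ⁻¹ᵁ U) := ⟨M, hM⟩
    have hw : hW.fromSpec w ∈ ν ⁻¹ᵁ U := by
      have : hW.fromSpec w ∈ Set.range hW.fromSpec := ⟨w, rfl⟩
      rwa [hW.range_fromSpec] at this
    have hw' : hW.primeIdealOf ⟨_, hw⟩ = w := by
      apply hW.fromSpec.isEmbedding.injective
      rw [hW.fromSpec_primeIdealOf]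
    have h1 := hcomap _ hw
    rw [hw'] at h1
    have h2 : w.comap (ν.app U).hom = hUa.primeIdealOf ⟨x, hxU⟩ := PrimeSpectrum.ext hMx
    rw [h2] at h1
    have h3 := congrArg (fun z => hUa.fromSpec z) h1
    simp only [hUa.fromSpec_primeIdealOf] at h3
    obtain ⟨i, hi⟩ := hsurj _ h3.symm
    refine ⟨i, ?_⟩
    have h4 : (⟨e i, heU i⟩ : ν ⁻¹ᵁ U) = ⟨_, hw⟩ := Subtype.ext hi
    rw [h4, hw']
  · intro i
    rw [hinst]
    exact congrArg CommRingCat.Hom.hom (ν.germ_stalkMapOfEq (he i) U hxU)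

end Birational

/-! ## Birational extensions -/

section Birational

variable {A B : Type*} [CommRing A] [CommRing B] [Algebra A B] [IsDomain A] [IsDomain B]
  [Module.Finite A B] (hinj : Function.Injective (algebraMap A B))
  (hbir : ∀ b : B, ∃ s a : A, s ≠ 0 ∧ algebraMap A B s * b = algebraMap A B a)

include hinj hbir in
-- As a fraction `a / s`, the element `b` is integral over the localization at `q`, hence belongs to
-- it.
lemma exists_mul_eq_of_isIntegrallyClosed (q : Ideal A) [q.IsPrime] (D : Type*) [CommRing D]
    [Algebra A D] [IsLocalization.AtPrime D q] [IsIntegrallyClosed D] (b : B) :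
    ∃ s ∉ q, ∃ a, algebraMap A B s * b = algebraMap A B a := by
  have hD : IsDomain D :=
    IsLocalization.isDomain_of_le_nonZeroDivisors D q.primeCompl_le_nonZeroDivisors
  let K := FractionRing D
  let f : A →+* K := (algebraMap D K).comp (algebraMap A D)
  have hAD : Function.Injective (algebraMap A D) :=
    IsLocalization.injective D q.primeCompl_le_nonZeroDivisors
  have hf : Function.Injective f := (IsFractionRing.injective D K).comp hAD
  obtain ⟨s, a, hs, hsa⟩ := hbir b
  obtain ⟨p, hp, hpb⟩ := Algebra.IsIntegral.isIntegral (R := A) b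
  have h1 : (p.scaleRoots s).eval a = 0 := by
    apply hinj
    rw [map_zero, ← Polynomial.eval₂_at_apply, ← hsa]
    exact Polynomial.scaleRoots_eval₂_eq_zero _ hpb
  have hfs : f s ≠ 0 := by rwa [Ne, map_eq_zero_iff _ hf]
  have h2 : p.eval₂ f (f a / f s) = 0 := by
    have := Polynomial.scaleRoots_eval₂_mul (p := p) f (f a / f s) s
    rw [mul_div_cancel₀ _ hfs, Polynomial.eval₂_at_apply, h1, map_zero] at this
    exact (mul_eq_zero.mp this.symm).resolve_left (pow_ne_zero _ hfs)
  have h3 : IsIntegral D (f a / f s) :=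
    ⟨p.map (algebraMap A D), hp.map _, by rw [Polynomial.eval₂_map]; exact h2⟩
  obtain ⟨d, hd⟩ := IsIntegrallyClosed.isIntegral_iff.mp h3
  obtain ⟨⟨a', s'⟩, h4⟩ := IsLocalization.surj q.primeCompl d
  refine ⟨s', s'.2, a', ?_⟩
  have h5 : a * s' = s * a' := by
    apply hf
    have h6 : f a = f s * algebraMap D K d := by rw [hd, mul_div_cancel₀ _ hfs]
    rw [map_mul, map_mul, h6, mul_assoc]
    congr 1
    exact (map_mul (algebraMap D K) _ _).symm.trans (congrArg _ h4)
  have h7 : algebraMap A B s ≠ 0 := by rwa [Ne, map_eq_zero_iff _ hinj]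
  refine mul_left_cancel₀ h7 ?_
  rw [← map_mul, ← h5, map_mul, ← hsa]
  ring

-- The ideal of denominators of each `b` lies in no prime avoiding `t`, so it contains a power of
-- `t`. A maximum over generators of `B` gives a uniform exponent.
include hinj hbir in
lemma exists_pow_mul_eq {t : A} (ht : ∀ q : Ideal A, q.IsPrime → t ∉ q → ∀ b : B,
    ∃ s ∉ q, ∃ a, algebraMap A B s * b = algebraMap A B a) :
    ∃ n, ∀ b : B, ∃ a, algebraMap A B (t ^ n) * b = algebraMap A B a := by
  have h1 : ∀ b : B, ∃ n, ∃ a, algebraMap A B (t ^ n) * b = algebraMap A B a := by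
    intro b
    let 𝔞 : Ideal A := (LinearMap.range (Algebra.linearMap A B)).comap (LinearMap.toSpanSingleton A B b)
    have hmem : ∀ a, a ∈ 𝔞 ↔ ∃ c, algebraMap A B a * b = algebraMap A B c := by
      intro a
      simp only [𝔞, Submodule.mem_comap, LinearMap.mem_range, LinearMap.toSpanSingleton_apply,
        Algebra.linearMap_apply, Algebra.smul_def, eq_comm]
    have h2 : t ∈ 𝔞.radical := by
      rw [Ideal.radical_eq_sInf, Ideal.mem_sInf]
      rintro q ⟨hq, hqp⟩
      by_contra htq
      obtain ⟨s, hs, hs'⟩ := ht q hqp htq b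
      exact hs (hq ((hmem s).mpr hs'))
    obtain ⟨n, hn⟩ := h2
    exact ⟨n, (hmem _).mp hn⟩
  obtain ⟨F, hF⟩ := Module.Finite.fg_top (R := A) (M := B)
  choose n hn using h1
  refine ⟨F.sup n, fun b => ?_⟩
  have hb : b ∈ Submodule.span A (F : Set B) := hF.symm ▸ Submodule.mem_top
  induction hb using Submodule.span_induction with
  | mem x hx =>
    obtain ⟨a, ha⟩ := hn x
    obtain ⟨k, hk⟩ := Nat.exists_eq_add_of_le (Finset.le_sup (f := n) hx)
    refine ⟨t ^ k * a, ?_⟩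
    rw [hk, pow_add, map_mul, mul_right_comm, ha, map_mul, mul_comm]
  | zero => exact ⟨0, by simp⟩
  | add x y _ _ hx hy =>
    obtain ⟨a, ha⟩ := hx
    obtain ⟨c, hc⟩ := hy
    exact ⟨a + c, by rw [mul_add, ha, hc, map_add]⟩
  | smul r x _ hx =>
    obtain ⟨a, ha⟩ := hx
    exact ⟨r * a, by rw [Algebra.smul_def, mul_left_comm, ha, map_mul]⟩

omit [IsDomain A] [IsDomain B] [Module.Finite A B] in
lemma exists_mul_sub_mem {q : Ideal A} {g : Ideal B} (hg : g.comap (algebraMap A B) = q)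
    (h : ∀ b : B, ∃ s ∉ q, ∃ a, algebraMap A B s * b = algebraMap A B a) (b : B) :
    ∃ s a : A, algebraMap A B s ∉ g ∧ algebraMap A B s * b - algebraMap A B a ∈ g := by
  obtain ⟨s, hs, a, ha⟩ := h b
  refine ⟨s, a, fun h' => hs ?_, by rw [ha, sub_self]; exact zero_mem _⟩
  rw [← hg]
  exact h'

-- Where the extension is locally trivial, a prime is determined by its contraction.
omit [IsDomain A] [IsDomain B] [Module.Finite A B] in
lemma le_of_comap_eq_of_exists_mul_eq {q : Ideal A} {g g' : Ideal B} [g'.IsPrime]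
    (hg : g.comap (algebraMap A B) = q) (hg' : g'.comap (algebraMap A B) = q)
    (h : ∀ b : B, ∃ s ∉ q, ∃ a, algebraMap A B s * b = algebraMap A B a) : g ≤ g' := by
  intro b hb
  obtain ⟨s, hs, a, ha⟩ := h b
  have h1 : a ∈ q := by
    rw [← hg, Ideal.mem_comap, ← ha]
    exact Ideal.mul_mem_left _ _ hb
  rw [← hg', Ideal.mem_comap, ← ha] at h1
  refine (Ideal.IsPrime.mem_or_mem ‹_› h1).resolve_left fun h2 => hs ?_
  rw [← hg']
  exact h2

end Birational

/-! ## Dimension -/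

lemma isIntegrallyClosed_of_maximalIdeal_eq_span {A : Type*} [CommRing A] [IsDomain A]
    [IsLocalRing A] [IsNoetherianRing A] {t : A} (h : maximalIdeal A = Ideal.span {t}) :
    IsIntegrallyClosed A :=
  (((tfae_of_isNoetherianRing_of_isLocalRing_of_isDomain A).out 4 3 :
    Submodule.IsPrincipal (maximalIdeal A) ↔ IsIntegrallyClosed A ∧
      ∀ (P : Ideal A), P ≠ ⊥ → P.IsPrime → P = maximalIdeal A).mp ⟨t, h⟩).1

/-- A prime strictly below `q`, together with the zero ideal and the maximal ideal, would form a
chain of length three in `D`; the zero ideal is distinct because `t` maps to zero in `S`. -/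
lemma mem_minimalPrimes_of_ringKrullDim_le_two {D S : Type*} [CommRing D] [IsDomain D] [CommRing S]
    [IsLocalRing S] (hD : ringKrullDim D ≤ 2) {t : D} (ht : t ≠ 0) (φ : D →+* S)
    (hφ : Function.Surjective φ) (hφt : φ t = 0) (q : Ideal S) (hq : q.IsPrime)
    (hne : q ≠ maximalIdeal S) : q ∈ minimalPrimes S := by
  obtain ⟨r, hr, hrq⟩ := Ideal.exists_minimalPrimes_le (J := q) (I := ⊥) bot_le
  have hrp : r.IsPrime := hr.1.1
  rcases hrq.eq_or_lt with rfl | hlt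
  · exact hr
  exfalso
  have hc : ∀ {a b : Ideal S}, a < b → a.comap φ < b.comap φ := fun hab =>
    (Ideal.comap_mono hab.le).lt_of_ne fun h =>
      hab.ne (Ideal.comap_injective_of_surjective φ hφ h)
  have h0 : (⊥ : Ideal D) < r.comap φ := by
    rw [bot_lt_iff_ne_bot]
    intro h
    refine ht (?_ : t ∈ (⊥ : Ideal D))
    rw [← h, Ideal.mem_comap, hφt]
    exact zero_mem _
  have h1 := Ideal.height_add_one_le_of_lt_of_isPrime h0
  have h2 := Ideal.height_add_one_le_of_lt_of_isPrime (hc hlt)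
  have h3 := Ideal.height_add_one_le_of_lt_of_isPrime (hc ((le_maximalIdeal hq.ne_top).lt_of_ne hne))
  have h4 := (Ideal.height_le_ringKrullDim_of_isPrime (I := (maximalIdeal S).comap φ)).trans hD
  have h5 : ((maximalIdeal S).comap φ).height ≤ 2 :=
    WithBot.coe_le_coe.mp (h4.trans_eq rfl)
  have h6 : (3 : ℕ∞) ≤ ((maximalIdeal S).comap φ).height := by
    refine le_trans ?_ h3
    refine le_trans ?_ (add_le_add_left (le_trans (add_le_add_left h1 1) h2) 1)
    refine le_of_eq_of_le ?_ (add_le_add_left (add_le_add_left (add_le_add_left (zero_le (a := _)) 1) 1) 1)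
    norm_num
  exact absurd (h6.trans h5) (by norm_num)

lemma ringKrullDim_le_of_isIntegral {A B : Type*} [CommRing A] [CommRing B] [Algebra A B]
    [Algebra.IsIntegral A B] : ringKrullDim B ≤ ringKrullDim A := by
  refine Order.krullDim_le_of_strictMono (fun P : PrimeSpectrum B => P.comap (algebraMap A B)) ?_
  intro P Q h
  obtain ⟨hle, x, hxQ, hxP⟩ := Set.ssubset_iff_exists.mp (h : P.asIdeal < Q.asIdeal)
  exact Ideal.comap_lt_comap_of_integral_mem_sdiff hle ⟨hxQ, hxP⟩ (Algebra.IsIntegral.isIntegral x)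

lemma ringKrullDim_le_of_isLocalization {A B : Type*} [CommRing A] [CommRing B] [Algebra A B]
    (M : Submonoid A) [IsLocalization M B] : ringKrullDim B ≤ ringKrullDim A := by
  refine Order.krullDim_le_of_strictMono (fun P : PrimeSpectrum B => P.comap (algebraMap A B)) ?_
  intro P Q h
  exact (IsLocalization.orderEmbedding M B).strictMono (show P.asIdeal < Q.asIdeal from h)

/-! ## Generizations and stalks -/

/-- The local ring at a generization of `x` is a localization of the local ring at `x`. -/
lemma isLocalization_stalkSpecializes {X : Scheme.{u}} {x z : X} (h : z ⤳ x)
    (q : PrimeSpectrum (X.presheaf.stalk x)) (hq : X.fromSpecStalk x q = z) :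
    letI := (X.presheaf.stalkSpecializes h).hom.toAlgebra
    IsLocalization.AtPrime (X.presheaf.stalk z) q.asIdeal := by
  let _ := (X.presheaf.stalkSpecializes h).hom.toAlgebra
  have hq' : q = Spec.map (X.presheaf.stalkSpecializes h) (closedPoint (X.presheaf.stalk z)) := by
    apply (X.fromSpecStalk x).isEmbedding.injective
    have h1 := congrArg (fun m : Spec _ ⟶ X => m (closedPoint (X.presheaf.stalk z)))
      (Scheme.SpecMap_stalkSpecializes_fromSpecStalk h)
    exact hq.trans (h1.trans Scheme.fromSpecStalk_closedPoint).symm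
  obtain ⟨U, hUa, hxU, -⟩ := exists_isAffineOpen_mem_and_subset (TopologicalSpace.Opens.mem_top x)
  have hzU : z ∈ U := h.mem_open U.2 hxU
  let _ := TopCat.Presheaf.algebra_section_stalk X.presheaf (⟨x, hxU⟩ : U)
  have := hUa.isLocalization_stalk ⟨x, hxU⟩
  let _ := TopCat.Presheaf.algebra_section_stalk X.presheaf (⟨z, hzU⟩ : U)
  have := hUa.isLocalization_stalk ⟨z, hzU⟩
  have htower : IsScalarTower Γ(X, U) (X.presheaf.stalk x) (X.presheaf.stalk z) :=
    .of_algebraMap_eq' (congrArg CommRingCat.Hom.hom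
      (X.presheaf.germ_stalkSpecializes (U := U) hxU h)).symm
  have hmem : ∀ (w : X) (hw : w ∈ U) (a : Γ(X, U)), a ∈ (hUa.primeIdealOf ⟨w, hw⟩).asIdeal ↔
      X.presheaf.germ U w hw a ∈ maximalIdeal (X.presheaf.stalk w) := by
    intro w hw a
    rw [hUa.primeIdealOf_eq_map_closedPoint]
    rfl
  have hgerm : ∀ a : Γ(X, U), X.presheaf.germ U z hzU a =
      (X.presheaf.stalkSpecializes h).hom (X.presheaf.germ U x hxU a) := fun a =>
    IsScalarTower.algebraMap_apply Γ(X, U) (X.presheaf.stalk x) (X.presheaf.stalk z) a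
  have hle : (hUa.primeIdealOf ⟨x, hxU⟩).asIdeal.primeCompl ≤
      (hUa.primeIdealOf ⟨z, hzU⟩).asIdeal.primeCompl := by
    intro a ha hz
    refine ha ?_
    rw [SetLike.mem_coe, hmem, mem_maximalIdeal, mem_nonunits_iff] at hz ⊢
    intro hu
    refine hz ?_
    rw [hgerm]
    exact hu.map _
  have := IsLocalization.isLocalization_of_submonoid_le (X.presheaf.stalk x) (X.presheaf.stalk z)
    _ _ hle
  have hmemq : ∀ a, a ∈ q.asIdeal ↔ (X.presheaf.stalkSpecializes h).hom a ∈ maximalIdeal _ := by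
    intro a
    rw [hq']
    rfl
  refine IsLocalization.of_le (M := ((hUa.primeIdealOf ⟨z, hzU⟩).asIdeal.primeCompl.map
    (algebraMap Γ(X, U) (X.presheaf.stalk x)))) q.asIdeal.primeCompl ?_ ?_
  · rintro _ ⟨a, ha, rfl⟩ h'
    refine ha ?_
    rw [SetLike.mem_coe, hmem, hgerm]
    exact (hmemq _).mp h'
  · intro a ha
    by_contra hu
    exact ha ((hmemq a).mpr hu)

/-- The generization of `x` that corresponds to a prime ideal of the local ring at `x`. -/
noncomputable def generization {X : Scheme.{u}} {x : X} (q : Ideal (X.presheaf.stalk x))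
    [hq : q.IsPrime] : X :=
  X.fromSpecStalk x ⟨q, hq⟩

lemma generization_specializes {X : Scheme.{u}} {x : X} (q : Ideal (X.presheaf.stalk x))
    [hq : q.IsPrime] : generization q ⤳ x := by
  have : generization q ∈ Set.range (X.fromSpecStalk x) := ⟨_, rfl⟩
  rwa [Scheme.range_fromSpecStalk] at this

lemma generization_injective {X : Scheme.{u}} {x : X} {q r : Ideal (X.presheaf.stalk x)}
    [q.IsPrime] [r.IsPrime] (h : generization q = generization r) : q = r :=
  congrArg PrimeSpectrum.asIdeal ((X.fromSpecStalk x).isEmbedding.injective h)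

lemma exists_generization_eq {X : Scheme.{u}} {x z : X} (h : z ⤳ x) :
    ∃ (q : Ideal (X.presheaf.stalk x)) (_ : q.IsPrime), generization q = z := by
  have : z ∈ Set.range (X.fromSpecStalk x) := by
    rw [Scheme.range_fromSpecStalk]
    exact h
  obtain ⟨q, hq⟩ := this
  exact ⟨q.asIdeal, q.2, hq⟩

lemma generization_maximalIdeal {X : Scheme.{u}} (x : X) :
    generization (maximalIdeal (X.presheaf.stalk x)) = x :=
  Scheme.fromSpecStalk_closedPoint

lemma apply_generization {Y Z : Scheme.{u}} (g : Y ⟶ Z) {y : Y} {z : Z} (h : g y = z)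
    (q : Ideal (Y.presheaf.stalk y)) [hq : q.IsPrime] :
    g (generization q) = generization (q.comap (g.stalkMapOfEq h).hom) := by
  subst h
  have h1 := congrArg (fun m : Spec _ ⟶ Z => m (⟨q, hq⟩ : PrimeSpectrum (Y.presheaf.stalk y)))
    (Scheme.SpecMap_stalkMap_fromSpecStalk g (x := y))
  refine h1.symm.trans (congrArg (Z.fromSpecStalk (g y)) ?_)
  apply PrimeSpectrum.ext
  change q.comap _ = q.comap _
  rw [Scheme.Hom.stalkMapOfEq_rfl]

namespace AlgebraicGeometry.Scheme.Hom

lemma stalkMapOfEq_comp {W Y Z : Scheme.{u}} (g : W ⟶ Y) (k : Y ⟶ Z) {w : W} {y : Y} {z : Z}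
    (h₁ : g w = y) (h₂ : k y = z) (h₃ : (g ≫ k) w = z) :
    k.stalkMapOfEq h₂ ≫ g.stalkMapOfEq h₁ = (g ≫ k).stalkMapOfEq h₃ := by
  subst h₁ h₂
  rw [stalkMapOfEq_rfl, stalkMapOfEq_rfl]
  exact ((g ≫ k).stalkMapOfEq_rfl w ▸ stalkMap_comp g k w).symm

lemma map_maximalIdeal_stalkMapOfEq {Y Z : Scheme.{u}} (g : Y ⟶ Z) {y : Y} {z : Z} (h : g y = z) :
    (maximalIdeal (Z.presheaf.stalk z)).map (g.stalkMapOfEq h).hom =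
      (maximalIdeal (Z.presheaf.stalk (g y))).map (g.stalkMap y).hom := by
  subst h
  rw [stalkMapOfEq_rfl]

lemma stalkMapOfEq_flat {Y Z : Scheme.{u}} (g : Y ⟶ Z) [Flat g] {y : Y} {z : Z} (h : g y = z) :
    (g.stalkMapOfEq h).hom.Flat := by
  subst h
  rw [stalkMapOfEq_rfl]
  exact Flat.stalkMap g y

end AlgebraicGeometry.Scheme.Hom

/-- A nonzero element of a domain is regular and remains so under a flat map. -/
lemma stalkMapOfEq_ne_zero {X T : Scheme.{u}} [AlgebraicGeometry.IsIntegral T] (f : X ⟶ T)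
    [Flat f] {x : X} {t₀ : T} (h : f x = t₀) {t : T.presheaf.stalk t₀} (ht : t ≠ 0) :
    (f.stalkMapOfEq h).hom t ≠ 0 := by
  algebraize [(f.stalkMapOfEq h).hom]
  have : Module.Flat (T.presheaf.stalk t₀) (X.presheaf.stalk x) := f.stalkMapOfEq_flat h
  have hreg : IsSMulRegular (T.presheaf.stalk t₀) t := fun a b hab => mul_left_cancel₀ ht hab
  have := hreg.of_flat (S := X.presheaf.stalk x)
  intro h0
  refine one_ne_zero (α := X.presheaf.stalk x) (this ?_)
  simp [RingHom.algebraMap_toAlgebra, h0]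

lemma ker_fiberι_stalkMapOfEq {Y T : Scheme.{u}} (g : Y ⟶ T) {t₀ : T}
    {t : T.presheaf.stalk t₀} (ht : maximalIdeal (T.presheaf.stalk t₀) = Ideal.span {t})
    (c : g.fiber t₀) : RingHom.ker ((g.fiberι t₀).stalkMap c).hom =
      Ideal.span {(g.stalkMapOfEq (apply_fiberι g t₀ c)).hom t} := by
  rw [ker_fiberι_stalkMap, ← g.map_maximalIdeal_stalkMapOfEq (apply_fiberι g t₀ c), ht,
    Ideal.map_span, Set.image_singleton]

/-- The generic point of the component of which the prime ideal `b` of the completed local ring at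
`p` is a branch. -/
noncomputable def branchPoint {C : Scheme.{u}} {p : C} (b : Ideal (CompletedStalk C p))
    [b.IsPrime] : C :=
  generization (b.comap (algebraMap (C.presheaf.stalk p) (CompletedStalk C p)))

lemma isBranchOf_iff {C : Scheme.{u}} {p : C} (b : Ideal (CompletedStalk C p)) [b.IsPrime] (g : C) :
    IsBranchOf b g ↔ branchPoint b = g := by
  constructor
  · rintro ⟨q, hq, rfl⟩
    exact congrArg (C.fromSpecStalk p) (PrimeSpectrum.ext hq.symm)
  · rintro rfl
    exact ⟨_, rfl, rfl⟩

lemma branchPoint_comap {Y Z : Scheme.{u}} (g : Y ⟶ Z) {y : Y} {z : Z} (h : g y = z)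
    (c : Ideal (CompletedStalk Y y)) [c.IsPrime] :
    branchPoint (c.comap (completionMap (g.stalkMapOfEq h).hom)) = g (branchPoint c) := by
  unfold branchPoint
  rw [apply_generization g h]
  congr 1

/-! ## Local structure of the map between the fibres -/

section FiberMap

variable {X' X T : Scheme.{u}} (ν : X' ⟶ X) (f : X ⟶ T) (t₀ : T)

lemma fiberMap_fiberι : fiberMap ν f t₀ ≫ f.fiberι t₀ = (ν ≫ f).fiberι t₀ ≫ ν :=
  pullback.lift_fst ..

variable {ν f t₀} in
lemma apply_fiberι_eq {p : (ν ≫ f).fiber t₀} {y : f.fiber t₀} (h : fiberMap ν f t₀ p = y) :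
    ν ((ν ≫ f).fiberι t₀ p) = f.fiberι t₀ y := by
  subst h
  exact congrArg (fun m : (ν ≫ f).fiber t₀ ⟶ X => m p) (fiberMap_fiberι ν f t₀).symm

lemma exists_fiberMap_eq (y : f.fiber t₀) (x' : X') (h : ν x' = f.fiberι t₀ y) :
    ∃ p, fiberMap ν f t₀ p = y ∧ (ν ≫ f).fiberι t₀ p = x' := by
  have hx' : x' ∈ Set.range ((ν ≫ f).fiberι t₀) := by
    rw [Scheme.Hom.range_fiberι]
    exact (congrArg f h).trans (apply_fiberι f t₀ y)
  obtain ⟨p, hp⟩ := hx'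
  refine ⟨p, (f.fiberι t₀).isEmbedding.injective ?_, hp⟩
  rw [← apply_fiberι_eq rfl, hp, h]

variable {ν f t₀} in
/-- The map of local rings of the total spaces of the families over a map of their fibres. -/
noncomputable abbrev totalStalkMap {p : (ν ≫ f).fiber t₀} {y : f.fiber t₀}
    (h : fiberMap ν f t₀ p = y) : X.presheaf.stalk (f.fiberι t₀ y) →+*
      X'.presheaf.stalk ((ν ≫ f).fiberι t₀ p) :=
  (ν.stalkMapOfEq (apply_fiberι_eq h)).hom

variable {ν f t₀} in
/-- The map of local rings of the fibres. -/
noncomputable abbrev fiberStalkMap {p : (ν ≫ f).fiber t₀} {y : f.fiber t₀}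
    (h : fiberMap ν f t₀ p = y) : (f.fiber t₀).presheaf.stalk y →+*
      ((ν ≫ f).fiber t₀).presheaf.stalk p :=
  ((fiberMap ν f t₀).stalkMapOfEq h).hom

lemma fiberStalkMap_comp {p : (ν ≫ f).fiber t₀} {y : f.fiber t₀} (h : fiberMap ν f t₀ p = y) :
    (fiberStalkMap h).comp ((f.fiberι t₀).stalkMap y).hom =
      (((ν ≫ f).fiberι t₀).stalkMap p).hom.comp (totalStalkMap h) := by
  have h1 := Scheme.Hom.stalkMapOfEq_comp (fiberMap ν f t₀) (f.fiberι t₀) h rfl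
    (congrArg (f.fiberι t₀) h)
  have h2 := Scheme.Hom.stalkMapOfEq_comp ((ν ≫ f).fiberι t₀) ν rfl (apply_fiberι_eq h)
    (apply_fiberι_eq h)
  rw [Scheme.Hom.stalkMapOfEq_rfl] at h1 h2
  have h3 : ∀ (α β : (ν ≫ f).fiber t₀ ⟶ X) (hαβ : α = β) (hα : α p = f.fiberι t₀ y)
      (hβ : β p = f.fiberι t₀ y), α.stalkMapOfEq hα = β.stalkMapOfEq hβ := by
    rintro α _ rfl _ _
    rfl
  exact congrArg CommRingCat.Hom.hom (h1.trans ((h3 _ _ (fiberMap_fiberι ν f t₀) _ _).trans h2.symm))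

variable {ν f t₀} in
lemma totalStalkMap_stalkMapOfEq {p : (ν ≫ f).fiber t₀} {y : f.fiber t₀}
    (h : fiberMap ν f t₀ p = y) (t : T.presheaf.stalk t₀) :
    totalStalkMap h ((f.stalkMapOfEq (apply_fiberι f t₀ y)).hom t) =
      ((ν ≫ f).stalkMapOfEq (apply_fiberι (ν ≫ f) t₀ p)).hom t :=
  congrArg (fun m => m.hom t) (Scheme.Hom.stalkMapOfEq_comp ν f (apply_fiberι_eq h)
    (apply_fiberι f t₀ y) (apply_fiberι (ν ≫ f) t₀ p))

instance [IsLocallyNoetherian X] (y : f.fiber t₀) :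
    IsNoetherianRing ((f.fiber t₀).presheaf.stalk y) :=
  isNoetherianRing_of_surjective _ _ _ (fiberι_stalkMap_surjective f t₀ y)

/-- The algebra structure given by `totalStalkMap`. -/
@[reducible] noncomputable def totalAlgebra (y : f.fiber t₀) (p : {p // fiberMap ν f t₀ p = y}) :
    Algebra (X.presheaf.stalk (f.fiberι t₀ y)) (X'.presheaf.stalk ((ν ≫ f).fiberι t₀ p.1)) :=
  (totalStalkMap p.2).toAlgebra

lemma finite_fiberMap [IsFinite ν] (y : f.fiber t₀) : Finite {p // fiberMap ν f t₀ p = y} := by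
  have h1 : (ν ⁻¹' {f.fiberι t₀ y}).Finite := ν.finite_preimage_singleton _
  have := h1.to_subtype
  refine Finite.of_injective (β := ν ⁻¹' {f.fiberι t₀ y})
    (fun p => ⟨(ν ≫ f).fiberι t₀ p.1, apply_fiberι_eq p.2⟩) fun p q h => Subtype.ext ?_
  exact ((ν ≫ f).fiberι t₀).isEmbedding.injective (congrArg Subtype.val h)

variable [AlgebraicGeometry.IsIntegral X'] [AlgebraicGeometry.IsIntegral X]
  [IsFinite ν] [IsIso (ν.stalkMap (genericPoint X'))] (hgen : ν (genericPoint X') = genericPoint X)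

include hgen in
lemma exists_isSemilocalModel_fiber (y : f.fiber t₀) :
    letI := totalAlgebra ν f t₀ y
    ∃ (B : Type u) (_ : CommRing B) (_ : Algebra (X.presheaf.stalk (f.fiberι t₀ y)) B)
      (_ : ∀ p : {p // fiberMap ν f t₀ p = y},
        Algebra B (X'.presheaf.stalk ((ν ≫ f).fiberι t₀ p.1)))
      (P : {p // fiberMap ν f t₀ p = y} → Ideal B),
      IsSemilocalModel (X.presheaf.stalk (f.fiberι t₀ y)) B P
        fun p => X'.presheaf.stalk ((ν ≫ f).fiberι t₀ p.1) := by
  let _ := totalAlgebra ν f t₀ y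
  refine exists_isSemilocalModel_stalk ν hgen (f.fiberι t₀ y) _ (fun p => apply_fiberι_eq p.2) ?_ ?_
    fun i => rfl
  · intro p q h
    exact Subtype.ext (((ν ≫ f).fiberι t₀).isEmbedding.injective h)
  · intro x' hx'
    obtain ⟨p, hp, hpx⟩ := exists_fiberMap_eq ν f t₀ y x' hx'
    exact ⟨⟨p, hp⟩, hpx⟩

end FiberMap

/-! ### Transfer of the local results to the map between the fibres -/

section FiberLocal

variable {X' X T : Scheme.{u}} (ν : X' ⟶ X) (f : X ⟶ T) (t₀ : T)
  [AlgebraicGeometry.IsIntegral X'] [AlgebraicGeometry.IsIntegral X] [IsLocallyNoetherian X]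
  [IsLocallyNoetherian X']
  [IsFinite ν] [IsIso (ν.stalkMap (genericPoint X'))] (hgen : ν (genericPoint X') = genericPoint X)
  {t : T.presheaf.stalk t₀} (ht : maximalIdeal (T.presheaf.stalk t₀) = Ideal.span {t})

variable {ν f t₀} in
include ht in
lemma ker_fiberι_totalStalkMap {y : f.fiber t₀} {p : (ν ≫ f).fiber t₀}
    (h : fiberMap ν f t₀ p = y) : RingHom.ker (((ν ≫ f).fiberι t₀).stalkMap p).hom =
      Ideal.span {totalStalkMap h ((f.stalkMapOfEq (apply_fiberι f t₀ y)).hom t)} := by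
  rw [totalStalkMap_stalkMapOfEq, ker_fiberι_stalkMapOfEq _ ht]

include hgen in
/-- The image of a branch is a branch. -/
theorem comap_fiberStalkMap_ne_maximalIdeal {y : f.fiber t₀} {p : (ν ≫ f).fiber t₀}
    (h : fiberMap ν f t₀ p = y) {c : Ideal (CompletedStalk _ p)} (hc : c.IsPrime)
    (hne : c ≠ maximalIdeal _) :
    c.comap (completionMap (fiberStalkMap h)) ≠ maximalIdeal (CompletedStalk _ y) := by
  let _ := totalAlgebra ν f t₀ y
  obtain ⟨B, _, _, _, P, hB⟩ := exists_isSemilocalModel_fiber ν f t₀ hgen y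
  obtain ⟨_, _, _, hP, _, _, _, _, _⟩ := hB
  have hlc := fun p => (hP p).choose_spec
  have : ∀ p : {p // fiberMap ν f t₀ p = y}, IsLocalHom (algebraMap
      (X.presheaf.stalk (f.fiberι t₀ y)) (X'.presheaf.stalk ((ν ≫ f).fiberι t₀ p.1))) := fun p =>
    inferInstanceAs (IsLocalHom (totalStalkMap p.2))
  exact comap_completionMap_ne_maximalIdeal_of_finite _ B P
    (fun p => X'.presheaf.stalk ((ν ≫ f).fiberι t₀ p.1)) ((f.fiberι t₀).stalkMap y).hom
    (fiberι_stalkMap_surjective f t₀ y)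
    (S := fun p => ((ν ≫ f).fiber t₀).presheaf.stalk p.1)
    (fun p => (((ν ≫ f).fiberι t₀).stalkMap p.1).hom)
    (fun p => fiberι_stalkMap_surjective (ν ≫ f) t₀ p.1) (fun p => fiberStalkMap p.2)
    (fun p => fiberStalkMap_comp ν f t₀ p.2) ⟨p, h⟩ hc hne

include hgen ht in
/-- Every branch is the image of a branch. -/
theorem exists_comap_fiberStalkMap_eq {y : f.fiber t₀} {b : Ideal (CompletedStalk _ y)}
    (hb : b.IsPrime) (hne : b ≠ maximalIdeal _) :
    ∃ (p : (ν ≫ f).fiber t₀) (h : fiberMap ν f t₀ p = y) (c : Ideal (CompletedStalk _ p)),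
      c.IsPrime ∧ c ≠ maximalIdeal _ ∧ c.comap (completionMap (fiberStalkMap h)) = b := by
  let _ := totalAlgebra ν f t₀ y
  obtain ⟨B, _, _, _, P, hB⟩ := exists_isSemilocalModel_fiber ν f t₀ hgen y
  obtain ⟨_, _, _, hP, _, hP', _, hinj, _⟩ := hB
  have hlc := fun p => (hP p).choose_spec
  have : ∀ p : {p // fiberMap ν f t₀ p = y}, IsLocalHom (algebraMap
      (X.presheaf.stalk (f.fiberι t₀ y)) (X'.presheaf.stalk ((ν ≫ f).fiberι t₀ p.1))) := fun p =>
    inferInstanceAs (IsLocalHom (totalStalkMap p.2))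
  have := finite_fiberMap ν f t₀ y
  obtain ⟨p, c, hc, hcne, h⟩ := exists_comap_completionMap_eq_of_finite _ B P
    (fun p => X'.presheaf.stalk ((ν ≫ f).fiberι t₀ p.1)) ((f.fiberι t₀).stalkMap y).hom
    (fiberι_stalkMap_surjective f t₀ y) (ker_fiberι_stalkMapOfEq f ht y)
    (S := fun p => ((ν ≫ f).fiber t₀).presheaf.stalk p.1)
    (fun p => (((ν ≫ f).fiberι t₀).stalkMap p.1).hom)
    (fun p => fiberι_stalkMap_surjective (ν ≫ f) t₀ p.1)
    (fun p => ker_fiberι_totalStalkMap ht p.2) (fun p => fiberStalkMap p.2)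
    (fun p => fiberStalkMap_comp ν f t₀ p.2) hP' hinj hb hne
  exact ⟨p.1, p.2, c, hc, hcne, h⟩

variable {ν f t₀} in
/-- The component of the target whose image in the total space is normal has branches that are
images of only one branch. -/
theorem sigma_eq_of_comap_fiberStalkMap_eq (hgen : ν (genericPoint X') = genericPoint X)
    {y : f.fiber t₀} {p p' : (ν ≫ f).fiber t₀}
    (h : fiberMap ν f t₀ p = y) (h' : fiberMap ν f t₀ p' = y) {c : Ideal (CompletedStalk _ p)}
    {c' : Ideal (CompletedStalk _ p')} [hc : c.IsPrime] [hc' : c'.IsPrime]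
    (hcc : c.comap (completionMap (fiberStalkMap h)) = c'.comap (completionMap (fiberStalkMap h')))
    (hnorm : IsIntegrallyClosed (X.presheaf.stalk (f.fiberι t₀
      (branchPoint (c.comap (completionMap (fiberStalkMap h))))))) :
    (⟨p, c⟩ : Σ p, Ideal (CompletedStalk _ p)) = ⟨p', c'⟩ := by
  let _ := totalAlgebra ν f t₀ y
  obtain ⟨B, _, _, _, P, hB⟩ := exists_isSemilocalModel_fiber ν f t₀ hgen y
  obtain ⟨_, _, _, hP, hPinj, hP', _, hinj, hbir⟩ := hB
  have hlc := fun p => (hP p).choose_spec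
  have : ∀ p : {p // fiberMap ν f t₀ p = y}, IsLocalHom (algebraMap
      (X.presheaf.stalk (f.fiberι t₀ y)) (X'.presheaf.stalk ((ν ≫ f).fiberι t₀ p.1))) := fun p =>
    inferInstanceAs (IsLocalHom (totalStalkMap p.2))
  let A := X.presheaf.stalk (f.fiberι t₀ y)
  let q := ((c.comap (completionMap (fiberStalkMap h))).comap
    (algebraMap ((f.fiber t₀).presheaf.stalk y) (CompletedStalk _ y))).comap ((f.fiberι t₀).stalkMapOfEq rfl).hom
  have hq : generization q = f.fiberι t₀
      (branchPoint (c.comap (completionMap (fiberStalkMap h)))) :=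
    (apply_generization (f.fiberι t₀) rfl _).symm
  rw [← hq] at hnorm
  let _ := (X.presheaf.stalkSpecializes (generization_specializes q)).hom.toAlgebra
  have hql : IsLocalization.AtPrime (X.presheaf.stalk (generization q)) q :=
    isLocalization_stalkSpecializes (generization_specializes q) ⟨q, inferInstance⟩ rfl
  -- The component is the prime `q` of `A`, and normality there makes the extension trivial at `q`.
  -- Hence both branches lie over the same prime of `B`.
  have key := exists_mul_eq_of_isIntegrallyClosed hinj hbir q
    (X.presheaf.stalk (generization q))
  let G : ∀ (p : (ν ≫ f).fiber t₀) (h : fiberMap ν f t₀ p = y) (c : Ideal (CompletedStalk _ p)),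
      Ideal B := fun p h c => ((c.comap (algebraMap (((ν ≫ f).fiber t₀).presheaf.stalk p)
          (CompletedStalk _ p))).comap
        (((ν ≫ f).fiberι t₀).stalkMap p).hom).comap
          (algebraMap B (X'.presheaf.stalk ((ν ≫ f).fiberι t₀ (⟨p, h⟩ :
            {p // fiberMap ν f t₀ p = y}).1)))
  have hG : ∀ (p : (ν ≫ f).fiber t₀) (h : fiberMap ν f t₀ p = y)
      (c : Ideal (CompletedStalk _ p)), (G p h c).comap (algebraMap A B) =
        ((c.comap (completionMap (fiberStalkMap h))).comap
          (algebraMap ((f.fiber t₀).presheaf.stalk y) (CompletedStalk _ y))).comap ((f.fiberι t₀).stalkMapOfEq rfl).hom := by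
    intro p h c
    rw [comap_comap_completionMap_algebraMap, Scheme.Hom.stalkMapOfEq_rfl]
    ext a
    have h1 : algebraMap B (X'.presheaf.stalk ((ν ≫ f).fiberι t₀ (⟨p, h⟩ :
        {p // fiberMap ν f t₀ p = y}).1)) (algebraMap A B a) = totalStalkMap h a :=
      (IsScalarTower.algebraMap_apply A B (X'.presheaf.stalk ((ν ≫ f).fiberι t₀ (⟨p, h⟩ :
        {p // fiberMap ν f t₀ p = y}).1)) a).symm
    have h2 := DFunLike.congr_fun (fiberStalkMap_comp ν f t₀ h) a
    simp only [RingHom.comp_apply] at h2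
    simp only [G, Ideal.mem_comap]
    rw [h1, h2]
  have hGc : (G p h c).comap (algebraMap A B) = q := hG p h c
  have hGc' : (G p' h' c').comap (algebraMap A B) = q := by
    rw [hG]
    simp only [q, hcc]
  have i1 : (G p h c).IsPrime := inferInstance
  have i2 : (G p' h' c').IsPrime := inferInstance
  have hGG : G p h c = G p' h' c' := le_antisymm
    (le_of_comap_eq_of_exists_mul_eq hGc hGc' key) (le_of_comap_eq_of_exists_mul_eq hGc' hGc key)
  have := sigma_eq_of_comap_completionMap_eq A B P
    (fun p => X'.presheaf.stalk ((ν ≫ f).fiberι t₀ p.1)) ((f.fiberι t₀).stalkMap y).hom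
    (S := fun p => ((ν ≫ f).fiber t₀).presheaf.stalk p.1)
    (fun p => (((ν ≫ f).fiberι t₀).stalkMap p.1).hom)
    (fun p => fiberι_stalkMap_surjective (ν ≫ f) t₀ p.1) (fun p => fiberStalkMap p.2)
    (fun p => fiberStalkMap_comp ν f t₀ p.2) hPinj (i := ⟨p, h⟩) (j := ⟨p', h'⟩) hc hc' hcc
    (G p h c) rfl hGG (exists_mul_sub_mem hGc key)
  exact congrArg (fun s : Σ i : {p // fiberMap ν f t₀ p = y}, Ideal (CompletedStalk _ i.1) =>
    (⟨s.1.1, s.2⟩ : Σ p, Ideal (CompletedStalk _ p))) this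

-- A prime not containing `t` is a point outside the fibre, where the total space is normal and the
-- finite birational extension is trivial.
variable {f t₀} in
include ht in
lemma exists_pow_stalkMapOfEq_mul_eq (hnn : ∀ x : X, f x ≠ t₀ →
      IsIntegrallyClosed (X.presheaf.stalk x))
    {x : X} (hx : f x = t₀) {B : Type u} [CommRing B] [IsDomain B]
    [Algebra (X.presheaf.stalk x) B] [Module.Finite (X.presheaf.stalk x) B]
    (hinj : Function.Injective (algebraMap (X.presheaf.stalk x) B))
    (hbir : ∀ b : B, ∃ s a : X.presheaf.stalk x, s ≠ 0 ∧
      algebraMap (X.presheaf.stalk x) B s * b = algebraMap (X.presheaf.stalk x) B a) :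
    ∃ n, ∀ b : B, ∃ a, algebraMap (X.presheaf.stalk x) B ((f.stalkMapOfEq hx).hom t ^ n) * b =
      algebraMap (X.presheaf.stalk x) B a := by
  refine exists_pow_mul_eq hinj hbir fun q hq htq b => ?_
  have hnorm : IsIntegrallyClosed (X.presheaf.stalk (generization q)) := by
    refine hnn _ fun h => htq ?_
    rw [apply_generization f hx q] at h
    have h2 := generization_injective (h.trans (generization_maximalIdeal t₀).symm)
    have h3 : t ∈ q.comap (f.stalkMapOfEq hx).hom := by
      rw [h2, ht]
      exact Ideal.mem_span_singleton_self t
    exact h3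
  let _ := (X.presheaf.stalkSpecializes (generization_specializes q)).hom.toAlgebra
  have hql : IsLocalization.AtPrime (X.presheaf.stalk (generization q)) q :=
    isLocalization_stalkSpecializes (generization_specializes q) ⟨q, inferInstance⟩ rfl
  exact exists_mul_eq_of_isIntegrallyClosed hinj hbir q (X.presheaf.stalk (generization q)) b

variable {ν f t₀} in
include ht in
/-- The points over a point of the target cannot be separated by the images of their branches. -/
theorem mem_of_saturated (hgen : ν (genericPoint X') = genericPoint X)
    (hnn : ∀ x : X, f x ≠ t₀ → IsIntegrallyClosed (X.presheaf.stalk x)) {y : f.fiber t₀}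
    {rs : List (X.presheaf.stalk (f.fiberι t₀ y))} (hrs : ∀ r ∈ rs, r ∈ maximalIdeal _)
    (hreg : RingTheory.Sequence.IsRegular (X.presheaf.stalk (f.fiberι t₀ y)) rs)
    (hlen : 2 ≤ rs.length) (U : Set ((ν ≫ f).fiber t₀))
    (hU : ∀ (p p' : (ν ≫ f).fiber t₀) (h : fiberMap ν f t₀ p = y) (h' : fiberMap ν f t₀ p' = y)
      (c : Ideal (CompletedStalk _ p)) (c' : Ideal (CompletedStalk _ p')), c.IsPrime →
      c ≠ maximalIdeal _ → c'.IsPrime → c' ≠ maximalIdeal _ →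
      c.comap (completionMap (fiberStalkMap h)) = c'.comap (completionMap (fiberStalkMap h')) →
      (p ∈ U ↔ p' ∈ U)) {p p' : (ν ≫ f).fiber t₀} (h : fiberMap ν f t₀ p = y)
    (h' : fiberMap ν f t₀ p' = y) (hp : p ∈ U) : p' ∈ U := by
  let _ := totalAlgebra ν f t₀ y
  obtain ⟨B, _, _, _, P, hB⟩ := exists_isSemilocalModel_fiber ν f t₀ hgen y
  obtain ⟨_, _, _, hP, hPinj, hP', _, hinj, hbir⟩ := hB
  have hlc := fun p => (hP p).choose_spec
  have : ∀ p : {p // fiberMap ν f t₀ p = y}, IsLocalHom (algebraMap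
      (X.presheaf.stalk (f.fiberι t₀ y)) (X'.presheaf.stalk ((ν ≫ f).fiberι t₀ p.1))) := fun p =>
    inferInstanceAs (IsLocalHom (totalStalkMap p.2))
  have := finite_fiberMap ν f t₀ y
  obtain ⟨n, hn⟩ := exists_pow_stalkMapOfEq_mul_eq ht hnn (apply_fiberι f t₀ y) hinj hbir
  obtain ⟨a, b, l, rfl⟩ : ∃ a b l, rs = a :: b :: l := by
    match rs, hlen with
    | a :: b :: l, _ => exact ⟨a, b, l, rfl⟩
  have ha0 : a ≠ 0 := by
    rintro rfl
    have h1 := ((RingTheory.Sequence.isWeaklyRegular_cons_iff _ _ _).mp hreg.1).1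
    exact one_ne_zero (α := X.presheaf.stalk (f.fiberι t₀ y)) (h1 (by simp))
  rcases eq_empty_or_eq_univ_of_saturated _ B P
    (fun p => X'.presheaf.stalk ((ν ≫ f).fiberι t₀ p.1)) ((f.fiberι t₀).stalkMap y).hom
    (fiberι_stalkMap_surjective f t₀ y)
    (t := (f.stalkMapOfEq (apply_fiberι f t₀ y)).hom t) (S := fun p => ((ν ≫ f).fiber t₀).presheaf.stalk p.1)
    (fun p => (((ν ≫ f).fiberι t₀).stalkMap p.1).hom)
    (fun p => fiberι_stalkMap_surjective (ν ≫ f) t₀ p.1)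
    (fun p => ker_fiberι_totalStalkMap ht p.2) (fun p => fiberStalkMap p.2)
    (fun p => fiberStalkMap_comp ν f t₀ p.2) hPinj hP' hinj (fun b => ⟨n, hn b⟩)
    (hrs a (by simp)) (hrs b (by simp)) ha0 hreg.1
    {p | p.1 ∈ U} (fun i j c c' hc hcne hc' hcne' hcc => hU i.1 j.1 i.2 j.2 c c' hc hcne hc' hcne' hcc)
    with h0 | h0
  · exact (Set.eq_empty_iff_forall_notMem.mp h0 ⟨p, h⟩ hp).elim
  · exact Set.eq_univ_iff_forall.mp h0 ⟨p', h'⟩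

variable {ν f t₀} in
include hgen in
lemma ringKrullDim_totalStalk_le {y : f.fiber t₀} {p : (ν ≫ f).fiber t₀}
    (h : fiberMap ν f t₀ p = y) : ringKrullDim (X'.presheaf.stalk ((ν ≫ f).fiberι t₀ p)) ≤
      ringKrullDim (X.presheaf.stalk (f.fiberι t₀ y)) := by
  let _ := totalAlgebra ν f t₀ y
  obtain ⟨B, _, _, _, P, hB⟩ := exists_isSemilocalModel_fiber ν f t₀ hgen y
  obtain ⟨_, _, _, hP, _⟩ := hB
  have key : ∀ i : {p // fiberMap ν f t₀ p = y},
      ringKrullDim (X'.presheaf.stalk ((ν ≫ f).fiberι t₀ i.1)) ≤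
        ringKrullDim (X.presheaf.stalk (f.fiberι t₀ y)) := fun i =>
    have := (hP i).choose_spec
    (ringKrullDim_le_of_isLocalization (P i).primeCompl).trans
      (ringKrullDim_le_of_isIntegral (A := X.presheaf.stalk (f.fiberι t₀ y)))
  exact key ⟨p, h⟩

end FiberLocal

/-! ### Degrees of the components over a component against its multiplicity -/

section FiberLength

lemma length_quotient_eq_of_ker_eq {A R : Type*} [CommRing A] [CommRing R] (π : A →+* R)
    (hπ : Function.Surjective π) {I : Ideal A} (hI : RingHom.ker π = I) :
    Module.length A (A ⧸ I) = Module.length R R := by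
  subst hI
  rw [Module.length_eq_of_surjective (R := A ⧸ RingHom.ker π) Ideal.Quotient.mk_surjective]
  exact length_eq_of_ringEquiv (RingHom.quotientKerEquivOfSurjective hπ)

lemma bijective_residueFieldMap_of_surjective {A R : Type*} [CommRing A] [CommRing R]
    [IsLocalRing A] [IsLocalRing R] (π : A →+* R) [IsLocalHom π] (hπ : Function.Surjective π) :
    Function.Bijective (ResidueField.map π) := by
  refine ⟨(ResidueField.map π).injective, fun x => ?_⟩
  obtain ⟨r, rfl⟩ := residue_surjective x
  obtain ⟨a, rfl⟩ := hπ r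
  exact ⟨residue A a, ResidueField.map_residue π a⟩

lemma finrank_residueField_eq {A R E S : Type*} [CommRing A] [CommRing R] [CommRing E] [CommRing S]
    [IsLocalRing A] [IsLocalRing R] [IsLocalRing E] [IsLocalRing S] [Algebra A E] [Algebra R S]
    [IsLocalHom (algebraMap A E)] [IsLocalHom (algebraMap R S)] (π : A →+* R) [IsLocalHom π]
    (hπ : Function.Surjective π) (σ : E →+* S) [IsLocalHom σ] (hσ : Function.Surjective σ)
    (h : (algebraMap R S).comp π = σ.comp (algebraMap A E)) :
    Module.finrank (ResidueField A) (ResidueField E) =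
      Module.finrank (ResidueField R) (ResidueField S) := by
  refine Algebra.finrank_eq_of_equiv_equiv
    (RingEquiv.ofBijective _ (bijective_residueFieldMap_of_surjective π hπ))
    (RingEquiv.ofBijective _ (bijective_residueFieldMap_of_surjective σ hσ)) ?_
  refine RingHom.ext fun x => ?_
  obtain ⟨a, rfl⟩ := residue_surjective x
  exact congrArg (residue S) (DFunLike.congr_fun h a)

lemma residueDegree_eq_finrank {Y Z : Scheme.{u}} (g : Y ⟶ Z) {y : Y} {z : Z} (h : g y = z) :
    letI := (g.stalkMapOfEq h).hom.toAlgebra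
    haveI : IsLocalHom (algebraMap (Z.presheaf.stalk z) (Y.presheaf.stalk y)) :=
      inferInstanceAs (IsLocalHom (g.stalkMapOfEq h).hom)
    g.residueDegree y =
      Module.finrank (ResidueField (Z.presheaf.stalk z)) (ResidueField (Y.presheaf.stalk y)) := by
  subst h
  have key : ∀ (ψ : Z.presheaf.stalk (g y) ⟶ Y.presheaf.stalk y) (_ : ψ = g.stalkMap y)
      (hl : IsLocalHom ψ.hom),
      letI := ψ.hom.toAlgebra
      haveI : IsLocalHom (algebraMap (Z.presheaf.stalk (g y)) (Y.presheaf.stalk y)) := hl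
      g.residueDegree y =
        Module.finrank (ResidueField (Z.presheaf.stalk (g y))) (ResidueField (Y.presheaf.stalk y)) := by
    rintro ψ rfl hl
    let _ := (g.stalkMap y).hom.toAlgebra
    let _ := (g.residueFieldMap y).hom.toAlgebra
    refine Algebra.finrank_eq_of_equiv_equiv (R₀ := Z.residueField (g y)) (S₀ := Y.residueField y)
      (R₁ := ResidueField (Z.presheaf.stalk (g y))) (S₁ := ResidueField (Y.presheaf.stalk y))
      (RingEquiv.refl _) (RingEquiv.refl _) (RingHom.ext fun x => ?_)
    obtain ⟨a, rfl⟩ := residue_surjective (R := Z.presheaf.stalk (g y)) x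
    rfl
  exact key _ (g.stalkMapOfEq_rfl y) _

variable {X' X T : Scheme.{u}} {ν : X' ⟶ X} {f : X ⟶ T} {t₀ : T}
  [AlgebraicGeometry.IsIntegral X'] [AlgebraicGeometry.IsIntegral X] [AlgebraicGeometry.IsIntegral T]
  [IsLocallyNoetherian X] [IsLocallyNoetherian X'] [Flat f]
  [IsFinite ν] [IsIso (ν.stalkMap (genericPoint X'))] (hgen : ν (genericPoint X') = genericPoint X)
  {t : T.presheaf.stalk t₀} (ht : maximalIdeal (T.presheaf.stalk t₀) = Ideal.span {t}) (ht0 : t ≠ 0)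
  (hnn : ∀ x : X, f x ≠ t₀ → IsIntegrallyClosed (X.presheaf.stalk x))

-- The residue fields are quotients of `B/tB`, whose length equals that of `A/tA`, the local ring of
-- the fibre.
include hgen ht ht0 hnn in
theorem sum_length_residueField_fiber_le (y : f.fiber t₀)
    (hfin : Module.length ((f.fiber t₀).presheaf.stalk y) ((f.fiber t₀).presheaf.stalk y) ≠ ⊤)
    [Fintype {p // fiberMap ν f t₀ p = y}] :
    letI := totalAlgebra ν f t₀ y
    haveI : ∀ p : {p // fiberMap ν f t₀ p = y}, IsLocalHom (algebraMap
      (X.presheaf.stalk (f.fiberι t₀ y)) (X'.presheaf.stalk ((ν ≫ f).fiberι t₀ p.1))) := fun p =>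
        inferInstanceAs (IsLocalHom (totalStalkMap p.2))
    ∑ p : {p // fiberMap ν f t₀ p = y}, Module.length
      (ResidueField (X.presheaf.stalk (f.fiberι t₀ y)))
      (ResidueField (X'.presheaf.stalk ((ν ≫ f).fiberι t₀ p.1))) ≤
    Module.length ((f.fiber t₀).presheaf.stalk y) ((f.fiber t₀).presheaf.stalk y) := by
  let _ := totalAlgebra ν f t₀ y
  obtain ⟨B, _, _, _, P, hB⟩ := exists_isSemilocalModel_fiber ν f t₀ hgen y
  obtain ⟨_, _, _, hP, hPinj, hP', _, hinj, hbir⟩ := hB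
  have hlc := fun p => (hP p).choose_spec
  have : ∀ p : {p // fiberMap ν f t₀ p = y}, IsLocalHom (algebraMap
      (X.presheaf.stalk (f.fiberι t₀ y)) (X'.presheaf.stalk ((ν ≫ f).fiberι t₀ p.1))) := fun p =>
    inferInstanceAs (IsLocalHom (totalStalkMap p.2))
  have h1 := length_quotient_eq_of_ker_eq ((f.fiberι t₀).stalkMap y).hom
    (fiberι_stalkMap_surjective f t₀ y) (ker_fiberι_stalkMapOfEq f ht y)
  have htm : (f.stalkMapOfEq (apply_fiberι f t₀ y)).hom t ∈
      maximalIdeal (X.presheaf.stalk (f.fiberι t₀ y)) := by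
    refine (maximalIdeal_comap (f.stalkMapOfEq (apply_fiberι f t₀ y)).hom).ge ?_
    rw [ht]
    exact Ideal.mem_span_singleton_self t
  refine (sum_length_residueField_le _ B P
    (fun p => X'.presheaf.stalk ((ν ≫ f).fiberι t₀ p.1)) hPinj htm).trans (le_of_eq ?_)
  rw [length_quotient_map_eq _ B hinj (stalkMapOfEq_ne_zero f _ ht0)
    (exists_pow_stalkMapOfEq_mul_eq ht hnn _ hinj hbir) (by rwa [h1]), h1]

include hgen ht ht0 hnn in
/-- The degrees of the components of the source over a component of the target. -/
theorem sum_residueDegree_le (y : f.fiber t₀)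
    (hfin : Module.length ((f.fiber t₀).presheaf.stalk y) ((f.fiber t₀).presheaf.stalk y) ≠ ⊤)
    [Fintype {p // fiberMap ν f t₀ p = y}] :
    (∑ p : {p // fiberMap ν f t₀ p = y}, ((fiberMap ν f t₀).residueDegree p.1 : ℕ∞)) ≤
      Module.length ((f.fiber t₀).presheaf.stalk y) ((f.fiber t₀).presheaf.stalk y) ∧
    ∀ p : {p // fiberMap ν f t₀ p = y}, 0 < (fiberMap ν f t₀).residueDegree p.1 := by
  have key := sum_length_residueField_fiber_le hgen ht ht0 hnn y hfin
  let _ := totalAlgebra ν f t₀ y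
  have : ∀ p : {p // fiberMap ν f t₀ p = y}, IsLocalHom (algebraMap
      (X.presheaf.stalk (f.fiberι t₀ y)) (X'.presheaf.stalk ((ν ≫ f).fiberι t₀ p.1))) := fun p =>
    inferInstanceAs (IsLocalHom (totalStalkMap p.2))
  have hfinite : ∀ p : {p // fiberMap ν f t₀ p = y}, Module.Finite
      (ResidueField (X.presheaf.stalk (f.fiberι t₀ y)))
      (ResidueField (X'.presheaf.stalk ((ν ≫ f).fiberι t₀ p.1))) := by
    intro p
    have h1 := (Finset.single_le_sum (f := fun p : {p // fiberMap ν f t₀ p = y} => Module.length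
      (ResidueField (X.presheaf.stalk (f.fiberι t₀ y)))
      (ResidueField (X'.presheaf.stalk ((ν ≫ f).fiberι t₀ p.1)))) (fun _ _ => zero_le)
      (Finset.mem_univ p)).trans key
    have h2 := Module.length_ne_top_iff.mp (ne_top_of_le_ne_top hfin h1)
    have := (isFiniteLength_iff_isNoetherian_isArtinian.mp h2).1
    infer_instance
  have hdeg : ∀ p : {p // fiberMap ν f t₀ p = y}, (fiberMap ν f t₀).residueDegree p.1 =
      Module.finrank (ResidueField (X.presheaf.stalk (f.fiberι t₀ y)))
        (ResidueField (X'.presheaf.stalk ((ν ≫ f).fiberι t₀ p.1))) := by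
    intro p
    rw [residueDegree_eq_finrank (fiberMap ν f t₀) p.2]
    let _ := (fiberStalkMap p.2).toAlgebra
    have : IsLocalHom (algebraMap ((f.fiber t₀).presheaf.stalk y)
        (((ν ≫ f).fiber t₀).presheaf.stalk p.1)) :=
      inferInstanceAs (IsLocalHom (fiberStalkMap p.2))
    exact (finrank_residueField_eq ((f.fiberι t₀).stalkMap y).hom
      (fiberι_stalkMap_surjective f t₀ y) (((ν ≫ f).fiberι t₀).stalkMap p.1).hom
      (fiberι_stalkMap_surjective (ν ≫ f) t₀ p.1) (fiberStalkMap_comp ν f t₀ p.2)).symm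
  constructor
  · refine le_of_eq_of_le (Finset.sum_congr rfl fun p _ => ?_) key
    rw [hdeg, Module.length_eq_finrank]
  · intro p
    rw [hdeg]
    exact Module.finrank_pos

end FiberLength

/-! ## Generic points -/

lemma mem_genericPoints_iff {C : Type*} [TopologicalSpace C] [T0Space C] [QuasiSober C] {y : C} :
    y ∈ genericPoints C ↔ ∀ z, z ⤳ y → z = y := by
  constructor
  · intro h z hz
    have h1 : closure {y} ⊆ closure {z} := hz.closure_subset
    have h2 := (show Maximal IsIrreducible (closure {y}) from h).2 isIrreducible_singleton.closure h1
    exact (hz.antisymm (specializes_iff_closure_subset.mpr h2)).eq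
  · intro h
    refine ⟨isIrreducible_singleton.closure, fun s hs hys => ?_⟩
    have hy : y ∈ s := hys (subset_closure rfl)
    have hz := hs.isGenericPoint_genericPoint_closure
    have h1 : hs.genericPoint ⤳ y := by
      rw [specializes_iff_mem_closure, hz.def]
      exact subset_closure hy
    rw [← h _ h1, hz.def]
    exact subset_closure

section Generic

variable {C : Scheme.{u}}

lemma generization_specializes_iff {y : C} (r q : Ideal (C.presheaf.stalk y)) [hr : r.IsPrime]
    [hq : q.IsPrime] : generization r ⤳ generization q ↔ r ≤ q := by
  have h1 := (C.fromSpecStalk y).isEmbedding.isInducing.specializes_iff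
    (x := (⟨r, hr⟩ : PrimeSpectrum (C.presheaf.stalk y))) (y := ⟨q, hq⟩)
  have h2 := PrimeSpectrum.le_iff_specializes (⟨r, hr⟩ : PrimeSpectrum (C.presheaf.stalk y)) ⟨q, hq⟩
  exact h1.trans h2.symm

lemma generization_mem_genericPoints {y : C} {q : Ideal (C.presheaf.stalk y)} [hq : q.IsPrime]
    (h : q ∈ minimalPrimes (C.presheaf.stalk y)) : generization q ∈ genericPoints C := by
  rw [mem_genericPoints_iff]
  intro z hz
  obtain ⟨r, hr, rfl⟩ := exists_generization_eq (hz.trans (generization_specializes q))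
  have h1 := (generization_specializes_iff r q).mp hz
  have h2 : r = q := le_antisymm h1 (h.2 ⟨hr, bot_le⟩ h1)
  subst h2
  rfl

lemma eq_maximalIdeal_of_mem_genericPoints {y : C} (h : y ∈ genericPoints C)
    (q : Ideal (C.presheaf.stalk y)) [q.IsPrime] : q = maximalIdeal _ := by
  apply generization_injective
  rw [generization_maximalIdeal]
  exact mem_genericPoints_iff.mp h _ (generization_specializes q)

lemma maximalIdeal_notMem_minimalPrimes {y : C} (h : y ∉ genericPoints C) :
    maximalIdeal (C.presheaf.stalk y) ∉ minimalPrimes (C.presheaf.stalk y) := fun h' => h (by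
  have := generization_mem_genericPoints h'
  rwa [generization_maximalIdeal] at this)

lemma branchPoint_mem_genericPoints {y : C} [IsNoetherianRing (C.presheaf.stalk y)]
    {b : Ideal (CompletedStalk C y)} [b.IsPrime] (h : b ∈ branches C y) :
    branchPoint b ∈ genericPoints C :=
  generization_mem_genericPoints (Ideal.comap_mem_minimalPrimes_of_flat h)

lemma eq_maximalIdeal_completion_of_mem_genericPoints {y : C}
    [IsNoetherianRing (C.presheaf.stalk y)] (h : y ∈ genericPoints C)
    (c : Ideal (CompletedStalk C y)) [hc : c.IsPrime] : c = maximalIdeal _ := by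
  refine le_antisymm (le_maximalIdeal hc.ne_top) ?_
  have h1 := eq_maximalIdeal_of_mem_genericPoints h (c.comap (algebraMap (C.presheaf.stalk y) _))
  have h2 : maximalIdeal (CompletedStalk C y) =
      (maximalIdeal (C.presheaf.stalk y)).map (algebraMap _ (CompletedStalk C y)) := by
    exact AdicCompletion.maximalIdeal_eq_map
  rw [h2, Ideal.map_le_iff_le_comap, h1]

lemma not_nontrivial_branches_of_mem_genericPoints {y : C}
    [IsNoetherianRing (C.presheaf.stalk y)] (h : y ∈ genericPoints C) :
    ¬ (branches C y).Nontrivial := by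
  rintro ⟨b, hb, c, hc, hne⟩
  have hbp : b.IsPrime := hb.1.1
  have hcp : c.IsPrime := hc.1.1
  exact hne ((eq_maximalIdeal_completion_of_mem_genericPoints h b).trans
    (eq_maximalIdeal_completion_of_mem_genericPoints h c).symm)

lemma length_stalk_branchPoint {y : C} {b : Ideal (CompletedStalk C y)} [b.IsPrime] :
    Module.length (C.presheaf.stalk (branchPoint b)) (C.presheaf.stalk (branchPoint b)) =
      Module.length (Localization.AtPrime (b.comap (algebraMap (C.presheaf.stalk y) _)))
        (Localization.AtPrime (b.comap (algebraMap (C.presheaf.stalk y) _))) := by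
  let q := b.comap (algebraMap (C.presheaf.stalk y) _)
  let _ := (C.presheaf.stalkSpecializes (generization_specializes q)).hom.toAlgebra
  have hql : IsLocalization.AtPrime (C.presheaf.stalk (generization q)) q :=
    isLocalization_stalkSpecializes (generization_specializes q) ⟨q, inferInstance⟩ rfl
  exact length_eq_of_ringEquiv (IsLocalization.algEquiv q.primeCompl
    (C.presheaf.stalk (generization q)) (Localization.AtPrime q)).toRingEquiv

lemma length_stalk_eq_one_of_isReduced [IsReduced C] {y : C} (h : y ∈ genericPoints C) :
    Module.length (C.presheaf.stalk y) (C.presheaf.stalk y) = 1 := by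
  have h1 : maximalIdeal (C.presheaf.stalk y) ≤ ⊥ := by
    refine le_trans ?_ (nilradical_eq_zero (C.presheaf.stalk y)).le
    rw [nilradical_eq_sInf]
    exact le_sInf fun q (hq : q.IsPrime) => (eq_maximalIdeal_of_mem_genericPoints h q).ge
  refine Module.length_eq_one_iff.mpr ((isSimpleModule_iff _ _).mpr ⟨fun I => ?_⟩)
  by_cases hI : I = ⊤
  · exact Or.inr hI
  · exact Or.inl (le_bot_iff.mp ((le_maximalIdeal hI).trans h1))

lemma maximalIdeal_eq_bot_of_length_eq_one {R : Type*} [CommRing R] [IsLocalRing R]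
    (h : Module.length R R = 1) : maximalIdeal R = ⊥ := by
  have h1 := Module.length_eq_one_iff.mp h
  exact (eq_bot_or_eq_top (maximalIdeal R)).resolve_right (maximalIdeal.isMaximal R).ne_top

end Generic

/-! ## Dimension -/

section FiberDimension

variable {X' X T : Scheme.{u}} {ν : X' ⟶ X} {f : X ⟶ T} {t₀ : T}
  [AlgebraicGeometry.IsIntegral X'] [AlgebraicGeometry.IsIntegral X] [AlgebraicGeometry.IsIntegral T]
  [IsLocallyNoetherian X] [IsLocallyNoetherian X'] [Flat f] [QuasiCompact f]
  [IsFinite ν] [IsIso (ν.stalkMap (genericPoint X'))] (hgen : ν (genericPoint X') = genericPoint X)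
  {t : T.presheaf.stalk t₀} (ht : maximalIdeal (T.presheaf.stalk t₀) = Ideal.span {t}) (ht0 : t ≠ 0)
  (hnn : ∀ x : X, f x ≠ t₀ → IsIntegrallyClosed (X.presheaf.stalk x))
  (ht₀ : IsClosed {t₀}) (hX : IsSurface X) (hS2 : SatisfiesS2 X)

include hgen in
lemma totalStalkMap_injective {y : f.fiber t₀} {p : (ν ≫ f).fiber t₀}
    (h : fiberMap ν f t₀ p = y) : Function.Injective (totalStalkMap h) := by
  let _ := totalAlgebra ν f t₀ y
  obtain ⟨B, _, _, _, P, hB⟩ := exists_isSemilocalModel_fiber ν f t₀ hgen y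
  obtain ⟨_, _, _, hP, _, _, _, hinj, _⟩ := hB
  have key : ∀ i : {p // fiberMap ν f t₀ p = y}, Function.Injective (totalStalkMap i.2) := by
    intro i
    have := (hP i).choose_spec
    have h1 : Function.Injective (algebraMap B (X'.presheaf.stalk ((ν ≫ f).fiberι t₀ i.1))) :=
      IsLocalization.injective _ (P i).primeCompl_le_nonZeroDivisors
    have h2 := h1.comp hinj
    rw [← RingHom.coe_comp, ← IsScalarTower.algebraMap_eq] at h2
    exact h2
  exact key ⟨p, h⟩

-- Primes over the maximal ideal are maximal by integrality of the semilocal ring; this passes to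
-- its localizations and their quotients by `t`.
include hgen in
lemma eq_maximalIdeal_of_comap_fiberStalkMap_eq {y : f.fiber t₀} {p : (ν ≫ f).fiber t₀}
    (h : fiberMap ν f t₀ p = y) (q : Ideal (((ν ≫ f).fiber t₀).presheaf.stalk p)) [hq : q.IsPrime]
    (hqm : q.comap (fiberStalkMap h) = maximalIdeal _) : q = maximalIdeal _ := by
  let _ := totalAlgebra ν f t₀ y
  obtain ⟨B, _, _, _, P, hB⟩ := exists_isSemilocalModel_fiber ν f t₀ hgen y
  obtain ⟨_, _, _, hP, _, _, _, hinj, _⟩ := hB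
  have key : ∀ (i : {p // fiberMap ν f t₀ p = y})
      (q : Ideal (((ν ≫ f).fiber t₀).presheaf.stalk i.1)) (_ : q.IsPrime),
      q.comap (fiberStalkMap i.2) = maximalIdeal _ → q = maximalIdeal _ := by
    intro i q hq hqm
    have := (hP i).choose_spec
    let σ := (((ν ≫ f).fiberι t₀).stalkMap i.1).hom
    have hσ : Function.Surjective σ := fiberι_stalkMap_surjective (ν ≫ f) t₀ i.1
    let r : Ideal (X'.presheaf.stalk ((ν ≫ f).fiberι t₀ i.1)) := q.comap σ
    have h1 : (r.comap (algebraMap B _)).comap (algebraMap (X.presheaf.stalk (f.fiberι t₀ y)) B) =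
        maximalIdeal _ := by
      rw [Ideal.comap_comap, ← IsScalarTower.algebraMap_eq]
      change (q.comap σ).comap (totalStalkMap i.2) = _
      rw [Ideal.comap_comap, ← fiberStalkMap_comp, ← Ideal.comap_comap, hqm]
      exact maximalIdeal_comap _
    have h2 : (r.comap (algebraMap B _)).IsMaximal :=
      Ideal.isMaximal_of_isIntegral_of_isMaximal_comap
        (R := X.presheaf.stalk (f.fiberι t₀ y)) _ (by rw [h1]; exact maximalIdeal.isMaximal _)
    have h3 : r.comap (algebraMap B _) = (maximalIdeal _).comap (algebraMap B
        (X'.presheaf.stalk ((ν ≫ f).fiberι t₀ i.1))) :=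
      h2.eq_of_le (Ideal.IsPrime.ne_top inferInstance)
        (Ideal.comap_mono (le_maximalIdeal (Ideal.IsPrime.ne_top inferInstance)))
    have h4 : r = maximalIdeal _ := (IsLocalization.orderEmbedding (P i).primeCompl
      (X'.presheaf.stalk ((ν ≫ f).fiberι t₀ i.1))).injective h3
    apply Ideal.comap_injective_of_surjective σ hσ
    rw [show q.comap σ = maximalIdeal _ from h4]
    exact (maximalIdeal_comap σ).symm
  exact key ⟨p, h⟩ q hq hqm

include ht ht0 in
lemma mem_minimalPrimes_stalk_fiber {y : f.fiber t₀}
    (hdim : ringKrullDim (X.presheaf.stalk (f.fiberι t₀ y)) ≤ 2)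
    (q : Ideal ((f.fiber t₀).presheaf.stalk y)) (hq : q.IsPrime) (hne : q ≠ maximalIdeal _) :
    q ∈ minimalPrimes ((f.fiber t₀).presheaf.stalk y) := by
  refine mem_minimalPrimes_of_ringKrullDim_le_two hdim
    (stalkMapOfEq_ne_zero f (apply_fiberι f t₀ y) ht0) ((f.fiberι t₀).stalkMap y).hom
    (fiberι_stalkMap_surjective f t₀ y) ?_ q hq hne
  rw [← RingHom.mem_ker, ker_fiberι_stalkMapOfEq f ht]
  exact Ideal.mem_span_singleton_self _

include hgen ht ht0 in
lemma mem_minimalPrimes_stalk_fiber_of_apply {y : f.fiber t₀} {p : (ν ≫ f).fiber t₀}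
    (h : fiberMap ν f t₀ p = y) (hdim : ringKrullDim (X.presheaf.stalk (f.fiberι t₀ y)) ≤ 2)
    (q : Ideal (((ν ≫ f).fiber t₀).presheaf.stalk p)) (hq : q.IsPrime)
    (hne : q ≠ maximalIdeal _) : q ∈ minimalPrimes (((ν ≫ f).fiber t₀).presheaf.stalk p) := by
  refine mem_minimalPrimes_of_ringKrullDim_le_two ((ringKrullDim_totalStalk_le hgen h).trans hdim)
    (t := totalStalkMap h ((f.stalkMapOfEq (apply_fiberι f t₀ y)).hom t)) ?_
    (((ν ≫ f).fiberι t₀).stalkMap p).hom (fiberι_stalkMap_surjective (ν ≫ f) t₀ p) ?_ q hq hne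
  · rw [Ne, map_eq_zero_iff _ (totalStalkMap_injective hgen h)]
    exact stalkMapOfEq_ne_zero f (apply_fiberι f t₀ y) ht0
  · rw [← RingHom.mem_ker, ker_fiberι_totalStalkMap ht h]
    exact Ideal.mem_span_singleton_self _

include ht₀ in
lemma isClosed_fiberι {y : f.fiber t₀} (hy : IsClosed {y}) : IsClosed {f.fiberι t₀ y} := by
  have h1 : Topology.IsClosedEmbedding (f.fiberι t₀) :=
    ⟨(f.fiberι t₀).isEmbedding, by
      rw [f.range_fiberι]
      exact ht₀.preimage f.continuous⟩
  have := h1.isClosedMap _ hy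
  rwa [Set.image_singleton] at this

-- The point is a generization of a closed point, whose local ring on the fibre has only minimal
-- primes besides the maximal ideal.
include ht ht0 ht₀ hX in
lemma isClosed_of_notMem_genericPoints {y : f.fiber t₀} (hy : y ∉ genericPoints (f.fiber t₀)) :
    IsClosed {y} := by
  obtain ⟨z, hz, hzc⟩ := (isClosed_closure (s := {y})).exists_closed_singleton
    ⟨y, subset_closure rfl⟩
  obtain ⟨q, hq, rfl⟩ := exists_generization_eq (specializes_iff_mem_closure.mpr hz)
  by_cases hqm : q = maximalIdeal _
  · subst hqm
    rwa [generization_maximalIdeal]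
  · exact (hy (generization_mem_genericPoints (mem_minimalPrimes_stalk_fiber ht ht0
      (hX _ (isClosed_fiberι ht₀ hzc)).le q hq hqm))).elim

include ht ht0 ht₀ hX in
lemma ringKrullDim_stalk_eq_two {y : f.fiber t₀} (hy : y ∉ genericPoints (f.fiber t₀)) :
    ringKrullDim (X.presheaf.stalk (f.fiberι t₀ y)) = 2 :=
  hX _ (isClosed_fiberι ht₀ (isClosed_of_notMem_genericPoints ht ht0 ht₀ hX hy))

include ht ht0 ht₀ hX in
lemma mem_branches_fiber_iff {y : f.fiber t₀} (hy : y ∉ genericPoints (f.fiber t₀))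
    {b : Ideal (CompletedStalk _ y)} : b ∈ branches (f.fiber t₀) y ↔
      b.IsPrime ∧ b ≠ maximalIdeal _ :=
  mem_minimalPrimes_completion_iff (maximalIdeal_notMem_minimalPrimes hy)
    (mem_minimalPrimes_stalk_fiber ht ht0 (ringKrullDim_stalk_eq_two ht ht0 ht₀ hX hy).le)

include hgen in
lemma apply_notMem_genericPoints {p : (ν ≫ f).fiber t₀}
    (hp : p ∉ genericPoints ((ν ≫ f).fiber t₀)) :
    fiberMap ν f t₀ p ∉ genericPoints (f.fiber t₀) := by
  intro hy
  refine hp (mem_genericPoints_iff.mpr fun z hz => ?_)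
  obtain ⟨q, hq, rfl⟩ := exists_generization_eq hz
  have h1 := eq_maximalIdeal_of_comap_fiberStalkMap_eq hgen (rfl : fiberMap ν f t₀ p = _) q
    (eq_maximalIdeal_of_mem_genericPoints hy _)
  subst h1
  exact generization_maximalIdeal p

include hgen ht ht0 ht₀ hX hS2 hnn in
/-- A point over a closed point of the target is closed: otherwise, it would be isolated from the
other points by the images of the branches. -/
lemma notMem_genericPoints_of_apply {y : f.fiber t₀} {p : (ν ≫ f).fiber t₀}
    (h : fiberMap ν f t₀ p = y) (hy : y ∉ genericPoints (f.fiber t₀)) :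
    p ∉ genericPoints ((ν ≫ f).fiber t₀) := by
  intro hp
  obtain ⟨rs, hrs, hreg, hlen⟩ := hS2 (f.fiberι t₀ y)
  rw [ringKrullDim_stalk_eq_two ht ht0 ht₀ hX hy, min_self] at hlen
  have hlen' : 2 ≤ rs.length := by
    have : ((2 : ℕ) : WithBot ℕ∞) ≤ ((rs.length : ℕ) : WithBot ℕ∞) := hlen
    exact_mod_cast this
  -- The completed local ring at a generic point has no nonmaximal prime, so `{p}` is saturated for
  -- lack of branches and exhausts the points over `y`. Yet the branches of `y` must come from
  -- somewhere.
  have hmem : ∀ p' : (ν ≫ f).fiber t₀, fiberMap ν f t₀ p' = y → p' ∈ ({p} : Set _) := by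
    intro p' h'
    refine mem_of_saturated ht hgen hnn hrs hreg hlen' {p} ?_ h h' rfl
    intro p₁ p₂ h₁ h₂ c c' hc hcne hc' hcne' _
    have key : ∀ (p₁ : (ν ≫ f).fiber t₀) (c : Ideal (CompletedStalk _ p₁)), c.IsPrime →
        c ≠ maximalIdeal _ → p₁ ∉ ({p} : Set ((ν ≫ f).fiber t₀)) := by
      rintro p₁ c hc hcne rfl
      exact hcne (eq_maximalIdeal_completion_of_mem_genericPoints hp c)
    exact iff_of_false (key p₁ c hc hcne) (key p₂ c' hc' hcne')
  obtain ⟨b, hb⟩ := Ideal.nonempty_minimalPrimes (I := (⊥ : Ideal (CompletedStalk _ y)))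
    bot_ne_top
  obtain ⟨hbp, hbne⟩ := (mem_branches_fiber_iff ht ht0 ht₀ hX hy).mp hb
  obtain ⟨p', h', c, hc, hcne, -⟩ := exists_comap_fiberStalkMap_eq ν f t₀ hgen ht hbp hbne
  have h1 : p' = p := hmem p' h'
  subst h1
  exact hcne (eq_maximalIdeal_completion_of_mem_genericPoints hp c)

include hgen ht ht0 ht₀ hX in
lemma mem_branches_source_fiber_iff {p : (ν ≫ f).fiber t₀}
    (hp : p ∉ genericPoints ((ν ≫ f).fiber t₀))
    {c : Ideal (CompletedStalk _ p)} : c ∈ branches ((ν ≫ f).fiber t₀) p ↔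
      c.IsPrime ∧ c ≠ maximalIdeal _ :=
  mem_minimalPrimes_completion_iff (maximalIdeal_notMem_minimalPrimes hp)
    (mem_minimalPrimes_stalk_fiber_of_apply hgen ht ht0 rfl
      (ringKrullDim_stalk_eq_two ht ht0 ht₀ hX (apply_notMem_genericPoints hgen hp)).le)

end FiberDimension

/-! ## The gluing data of a family of curves -/

/-- A branch of `C` at a point which is not the generic point of a component. -/
abbrev Branch (C : Scheme.{u}) : Type u :=
  Σ y : {y : C // y ∉ genericPoints C}, {b : Ideal (CompletedStalk C y.1) // b ∈ branches C y.1}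

namespace Branch

variable {C : Scheme.{u}}

instance isPrime (b : Branch C) : b.2.1.IsPrime := b.2.2.1.1

/-- The branch as an ideal of the completed local ring at a point. -/
def toSigma (b : Branch C) : Σ y : C, Ideal (CompletedStalk C y) := ⟨b.1.1, b.2.1⟩

lemma toSigma_injective : Function.Injective (toSigma (C := C)) := by
  rintro ⟨⟨y, hy⟩, b, hb⟩ ⟨⟨z, hz⟩, c, hc⟩ h
  simp only [toSigma, Sigma.mk.injEq] at h
  obtain ⟨rfl, h⟩ := h
  obtain rfl := eq_of_heq h
  rfl

/-- The component of a branch. -/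
noncomputable def component [∀ y : C, IsNoetherianRing (C.presheaf.stalk y)] (b : Branch C) :
    {g : C // g ∈ genericPoints C} :=
  ⟨branchPoint b.2.1, branchPoint_mem_genericPoints b.2.2⟩

lemma sum_length_le [∀ y : C, IsNoetherianRing (C.presheaf.stalk y)] {y : C}
    (hy : y ∉ genericPoints C)
    (h1 : ∀ q : Ideal (C.presheaf.stalk y), q.IsPrime → q ≠ maximalIdeal _ →
      q ∈ minimalPrimes (C.presheaf.stalk y))
    (m : {g : C // g ∈ genericPoints C} → ℕ)
    (hm : ∀ g, componentMultiplicity C g = m g) (F : Finset (Branch C))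
    (hF : ∀ b ∈ F, b.1.1 = y) :
    ((∑ b ∈ F, m b.component : ℕ) : ℝ≥0∞) ≤ pointMultiplicity C y := by
  classical
  let j : {b : Ideal (CompletedStalk C y) // b ∈ branches C y} → Branch C := fun b => ⟨⟨y, hy⟩, b⟩
  have hj : Function.Injective j := fun b c h => eq_of_heq (Sigma.mk.inj h).2
  let F' := F.preimage j hj.injOn
  have h2 : ∑ b ∈ F, m b.component = ∑ b ∈ F', m (j b).component := by
    refine (Finset.sum_preimage j F hj.injOn (fun b => m b.component) ?_).symm
    rintro ⟨⟨z, hz⟩, b⟩ hb hb'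
    obtain rfl : z = y := hF _ hb
    exact (hb' ⟨b, rfl⟩).elim
  let m' : Ideal (CompletedStalk C y) → ℕ := fun b =>
    if h : b ∈ branches C y then m (j ⟨b, h⟩).component else 0
  have h3 : ∑ b ∈ F', m (j b).component = ∑ b ∈ F'.image Subtype.val, m' b := by
    rw [Finset.sum_image Subtype.val_injective.injOn]
    refine Finset.sum_congr rfl fun b _ => ?_
    simp only [m']
    rw [dif_pos b.2]
  rw [h2, h3]
  refine sum_length_le_samuelMultiplicity _ ?_ m' ?_
  · intro b hb
    obtain ⟨b, -, rfl⟩ := Finset.mem_image.mp hb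
    exact ⟨b.2, ((mem_minimalPrimes_completion_iff (maximalIdeal_notMem_minimalPrimes hy) h1).mp
      b.2).2⟩
  · intro b hb hbp
    obtain ⟨b, -, rfl⟩ := Finset.mem_image.mp hb
    simp only [m']
    rw [dif_pos b.2]
    exact (hm _).symm.trans length_stalk_branchPoint

end Branch

/-! ### Maps on components, points and branches of the fibres -/

section FiberGluing

variable {X' X T : Scheme.{u}} {ν : X' ⟶ X} {f : X ⟶ T} {t₀ : T}
  [AlgebraicGeometry.IsIntegral X'] [AlgebraicGeometry.IsIntegral X] [AlgebraicGeometry.IsIntegral T]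
  [IsLocallyNoetherian X] [IsLocallyNoetherian X'] [Flat f] [QuasiCompact f]
  [IsFinite ν] [IsIso (ν.stalkMap (genericPoint X'))] (hgen : ν (genericPoint X') = genericPoint X)
  {t : T.presheaf.stalk t₀} (ht : maximalIdeal (T.presheaf.stalk t₀) = Ideal.span {t}) (ht0 : t ≠ 0)
  (hnn : ∀ x : X, f x ≠ t₀ → IsIntegrallyClosed (X.presheaf.stalk x))
  (ht₀ : IsClosed {t₀}) (hX : IsSurface X) (hS2 : SatisfiesS2 X)

lemma sigma_comap_fiberStalkMap_eq {y : f.fiber t₀} {p : (ν ≫ f).fiber t₀}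
    (h : fiberMap ν f t₀ p = y) (c : Ideal (CompletedStalk _ p)) :
    (⟨fiberMap ν f t₀ p, c.comap (completionMap (fiberStalkMap rfl))⟩ :
      Σ y : f.fiber t₀, Ideal (CompletedStalk _ y)) =
        ⟨y, c.comap (completionMap (fiberStalkMap h))⟩ := by
  subst h
  rfl

-- Each point over `y` has degree at least one, so points other than `p` are merely counted. With
-- zero, one or two others this gives all the degree bounds needed for multiplicity at most two.
include hgen ht ht0 hnn in
lemma card_add_residueDegree_le {y : f.fiber t₀}
    (hfin : Module.length ((f.fiber t₀).presheaf.stalk y) ((f.fiber t₀).presheaf.stalk y) ≠ ⊤)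
    (s : Finset {p // fiberMap ν f t₀ p = y}) (p : {p // fiberMap ν f t₀ p = y}) (hp : p ∉ s) :
    ((s.card + (fiberMap ν f t₀).residueDegree p.1 : ℕ) : ℕ∞) ≤
      Module.length ((f.fiber t₀).presheaf.stalk y) ((f.fiber t₀).presheaf.stalk y) := by
  classical
  have := finite_fiberMap ν f t₀ y
  have := Fintype.ofFinite {p // fiberMap ν f t₀ p = y}
  obtain ⟨h1, h2⟩ := sum_residueDegree_le hgen ht ht0 hnn y hfin
  refine le_trans ?_ h1
  rw [← Nat.cast_sum]
  refine Nat.cast_le.mpr ?_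
  refine le_trans ?_ (Finset.sum_le_sum_of_subset (Finset.subset_univ (insert p s)))
  rw [Finset.sum_insert hp, add_comm, Finset.card_eq_sum_ones]
  gcongr
  exact h2 _

-- The local ring of the fibre is then a field, so `t` generates the maximal ideal of the local
-- domain of the total space.
include ht in
lemma isIntegrallyClosed_of_length_eq_one {y : f.fiber t₀}
    (h : Module.length ((f.fiber t₀).presheaf.stalk y) ((f.fiber t₀).presheaf.stalk y) = 1) :
    IsIntegrallyClosed (X.presheaf.stalk (f.fiberι t₀ y)) := by
  refine isIntegrallyClosed_of_maximalIdeal_eq_span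
    (t := (f.stalkMapOfEq (apply_fiberι f t₀ y)).hom t) ?_
  rw [← ker_fiberι_stalkMapOfEq f ht, RingHom.ker_eq_comap_bot,
    ← maximalIdeal_eq_bot_of_length_eq_one h]
  exact (maximalIdeal_comap _).symm

/-- The map from the components of the source to those of the target. -/
noncomputable def fiberComponent (hφ : ∀ p, fiberMap ν f t₀ p ∉ genericPoints (f.fiber t₀) →
      p ∉ genericPoints ((ν ≫ f).fiber t₀))
    (g : {g : (ν ≫ f).fiber t₀ // g ∈ genericPoints ((ν ≫ f).fiber t₀)}) :
    {g : f.fiber t₀ // g ∈ genericPoints (f.fiber t₀)} :=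
  ⟨fiberMap ν f t₀ g.1, by
    by_contra h
    exact hφ _ h g.2⟩

include hgen ht ht0 ht₀ hX in
lemma comap_mem_branches (e : Branch ((ν ≫ f).fiber t₀)) :
    e.2.1.comap (completionMap (fiberStalkMap (rfl : fiberMap ν f t₀ e.1.1 = _))) ∈
      branches (f.fiber t₀) (fiberMap ν f t₀ e.1.1) :=
  (mem_branches_fiber_iff ht ht0 ht₀ hX (apply_notMem_genericPoints hgen e.1.2)).mpr
    ⟨inferInstance, comap_fiberStalkMap_ne_maximalIdeal ν f t₀ hgen rfl inferInstance
      ((mem_branches_source_fiber_iff hgen ht ht0 ht₀ hX e.1.2).mp e.2.2).2⟩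

/-- The map from the points of the source to those of the target. -/
noncomputable def fiberPoint (hφ : ∀ p, p ∉ genericPoints ((ν ≫ f).fiber t₀) →
      fiberMap ν f t₀ p ∉ genericPoints (f.fiber t₀))
    (p : {p : (ν ≫ f).fiber t₀ // p ∉ genericPoints ((ν ≫ f).fiber t₀)}) :
    {y : f.fiber t₀ // y ∉ genericPoints (f.fiber t₀)} :=
  ⟨fiberMap ν f t₀ p.1, hφ p.1 p.2⟩

/-- The map from the branches of the source to those of the target. -/
noncomputable def fiberBranch (hφ : ∀ p, p ∉ genericPoints ((ν ≫ f).fiber t₀) →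
      fiberMap ν f t₀ p ∉ genericPoints (f.fiber t₀))
    (hb : ∀ e : Branch ((ν ≫ f).fiber t₀),
      e.2.1.comap (completionMap (fiberStalkMap (rfl : fiberMap ν f t₀ e.1.1 = _))) ∈
        branches (f.fiber t₀) (fiberMap ν f t₀ e.1.1))
    (e : Branch ((ν ≫ f).fiber t₀)) : Branch (f.fiber t₀) :=
  ⟨fiberPoint hφ e.1, _, hb e⟩

variable (hφ : ∀ p, p ∉ genericPoints ((ν ≫ f).fiber t₀) →
    fiberMap ν f t₀ p ∉ genericPoints (f.fiber t₀))
  (hb : ∀ e : Branch ((ν ≫ f).fiber t₀),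
    e.2.1.comap (completionMap (fiberStalkMap (rfl : fiberMap ν f t₀ e.1.1 = _))) ∈
      branches (f.fiber t₀) (fiberMap ν f t₀ e.1.1))
  (hφ' : ∀ p, fiberMap ν f t₀ p ∉ genericPoints (f.fiber t₀) →
    p ∉ genericPoints ((ν ≫ f).fiber t₀))

lemma component_fiberBranch (e : Branch ((ν ≫ f).fiber t₀)) :
    (fiberBranch hφ hb e).component = fiberComponent hφ' e.component :=
  Subtype.ext (branchPoint_comap (fiberMap ν f t₀) rfl e.2.1)

lemma fiberBranch_eq_iff {e e' : Branch ((ν ≫ f).fiber t₀)}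
    (h : fiberMap ν f t₀ e'.1.1 = fiberMap ν f t₀ e.1.1) :
    fiberBranch hφ hb e = fiberBranch hφ hb e' ↔
      e.2.1.comap (completionMap (fiberStalkMap rfl)) =
        e'.2.1.comap (completionMap (fiberStalkMap h)) := by
  rw [← Branch.toSigma_injective.eq_iff]
  have h2 := sigma_comap_fiberStalkMap_eq h e'.2.1
  constructor
  · intro h1
    exact eq_of_heq (Sigma.mk.inj (h1.trans h2)).2
  · intro h1
    refine Eq.trans ?_ h2.symm
    exact congrArg (Sigma.mk _) h1

include hgen ht ht0 hnn ht₀ hX hS2 in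
lemma fiberBranch_surjective : Function.Surjective (fiberBranch hφ hb) := by
  rintro ⟨⟨y, hy⟩, b, hb'⟩
  obtain ⟨hbp, hbne⟩ := (mem_branches_fiber_iff ht ht0 ht₀ hX hy).mp hb'
  obtain ⟨p, h, c, hc, hcne, hcb⟩ := exists_comap_fiberStalkMap_eq ν f t₀ hgen ht hbp hbne
  have hp := notMem_genericPoints_of_apply hgen ht ht0 hnn ht₀ hX hS2 h hy
  refine ⟨⟨⟨p, hp⟩, c, (mem_branches_source_fiber_iff hgen ht ht0 ht₀ hX hp).mpr ⟨hc, hcne⟩⟩,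
    Branch.toSigma_injective ((sigma_comap_fiberStalkMap_eq h c).trans ?_)⟩
  rw [hcb]
  rfl

include hgen ht in
lemma eq_of_fiberBranch_eq {e e' : Branch ((ν ≫ f).fiber t₀)}
    (hlen : componentMultiplicity (f.fiber t₀) (fiberBranch hφ hb e).component = 1)
    (h : fiberBranch hφ hb e = fiberBranch hφ hb e') : e = e' := by
  have hP : fiberMap ν f t₀ e'.1.1 = fiberMap ν f t₀ e.1.1 :=
    (congrArg (fun e => e.1.1) h).symm
  exact Branch.toSigma_injective (sigma_eq_of_comap_fiberStalkMap_eq hgen rfl hP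
    ((fiberBranch_eq_iff hφ hb hP).mp h) (isIntegrallyClosed_of_length_eq_one ht hlen))

include hgen ht ht0 hnn in
lemma card_add_residueDegree_le_componentMultiplicity
    {h : {g : f.fiber t₀ // g ∈ genericPoints (f.fiber t₀)}}
    (hfin : componentMultiplicity (f.fiber t₀) h ≠ ⊤)
    (s : Finset {g : (ν ≫ f).fiber t₀ // g ∈ genericPoints ((ν ≫ f).fiber t₀)})
    (hs : ∀ g ∈ s, fiberComponent hφ' g = h)
    (g : {g : (ν ≫ f).fiber t₀ // g ∈ genericPoints ((ν ≫ f).fiber t₀)})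
    (hg : fiberComponent hφ' g = h) (hgs : g ∉ s) :
    ((s.card + (fiberMap ν f t₀).residueDegree g.1 : ℕ) : ℕ∞) ≤
      componentMultiplicity (f.fiber t₀) h := by
  classical
  let j : s → {p // fiberMap ν f t₀ p = h.1} := fun x => ⟨x.1.1, congrArg Subtype.val (hs x.1 x.2)⟩
  have hj : Function.Injective j := fun x y hxy =>
    Subtype.ext (Subtype.ext (congrArg
      (fun z : {p // fiberMap ν f t₀ p = h.1} => z.1) hxy))
  have h1 := card_add_residueDegree_le hgen ht ht0 hnn hfin (Finset.univ.image j)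
    ⟨g.1, congrArg Subtype.val hg⟩ (by
      intro hmem
      obtain ⟨x, -, hx⟩ := Finset.mem_image.mp hmem
      refine hgs ?_
      rw [← show x.1 = g from Subtype.ext (congrArg
        (fun z : {p // fiberMap ν f t₀ p = h.1} => z.1) hx)]
      exact x.2)
  rwa [Finset.card_image_of_injective _ hj, Finset.card_univ, Fintype.card_coe] at h1

include hgen ht ht0 hnn in
lemma residueDegree_pos {h : {g : f.fiber t₀ // g ∈ genericPoints (f.fiber t₀)}}
    (hfin : componentMultiplicity (f.fiber t₀) h ≠ ⊤)
    (g : {g : (ν ≫ f).fiber t₀ // g ∈ genericPoints ((ν ≫ f).fiber t₀)})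
    (hg : fiberComponent hφ' g = h) : 0 < (fiberMap ν f t₀).residueDegree g.1 := by
  have := finite_fiberMap ν f t₀ h.1
  have := Fintype.ofFinite {p // fiberMap ν f t₀ p = h.1}
  exact (sum_residueDegree_le hgen ht ht0 hnn h.1 hfin).2 ⟨g.1, congrArg Subtype.val hg⟩

include hgen ht ht0 hnn ht₀ hX hS2 in
lemma mem_of_saturated_branches (y : {y : f.fiber t₀ // y ∉ genericPoints (f.fiber t₀)})
    (S : Set {p : (ν ≫ f).fiber t₀ // p ∉ genericPoints ((ν ≫ f).fiber t₀)})
    (hS : ∀ e e', fiberBranch hφ hb e = fiberBranch hφ hb e' → fiberPoint hφ e.1 = y →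
      (e.1 ∈ S ↔ e'.1 ∈ S)) (p q) (hp : fiberPoint hφ p = y) (hq : fiberPoint hφ q = y)
    (hpS : p ∈ S) : q ∈ S := by
  obtain ⟨rs, hrs, hreg, hlen⟩ := hS2 (f.fiberι t₀ y.1)
  rw [ringKrullDim_stalk_eq_two ht ht0 ht₀ hX y.2, min_self] at hlen
  have hlen' : 2 ≤ rs.length := by
    have : ((2 : ℕ) : WithBot ℕ∞) ≤ ((rs.length : ℕ) : WithBot ℕ∞) := hlen
    exact_mod_cast this
  have key := mem_of_saturated ht hgen hnn hrs hreg hlen' (Subtype.val '' S) ?_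
    (congrArg Subtype.val hp) (congrArg Subtype.val hq) ⟨p, hpS, rfl⟩
  · obtain ⟨q', hq', hqq⟩ := key
    rwa [← Subtype.ext hqq]
  · intro p p' h h' c c' hc hcne hc' hcne' hcc
    have hp := notMem_genericPoints_of_apply hgen ht ht0 hnn ht₀ hX hS2 h y.2
    have hp' := notMem_genericPoints_of_apply hgen ht ht0 hnn ht₀ hX hS2 h' y.2
    let e : Branch ((ν ≫ f).fiber t₀) :=
      ⟨⟨p, hp⟩, c, (mem_branches_source_fiber_iff hgen ht ht0 ht₀ hX hp).mpr ⟨hc, hcne⟩⟩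
    let e' : Branch ((ν ≫ f).fiber t₀) :=
      ⟨⟨p', hp'⟩, c', (mem_branches_source_fiber_iff hgen ht ht0 ht₀ hX hp').mpr ⟨hc', hcne'⟩⟩
    have h1 : fiberBranch hφ hb e = fiberBranch hφ hb e' := by
      refine Branch.toSigma_injective ((sigma_comap_fiberStalkMap_eq h c).trans
        (Eq.trans ?_ (sigma_comap_fiberStalkMap_eq h' c').symm))
      rw [hcc]
    have h2 := hS e e' h1 (Subtype.ext h)
    constructor
    · rintro ⟨p₁, hp₁, hpp⟩
      refine ⟨⟨p', hp'⟩, h2.mp ?_, rfl⟩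
      have h3 : p₁ = ⟨p, hp⟩ := Subtype.ext hpp
      subst h3
      exact hp₁
    · rintro ⟨p₁, hp₁, hpp⟩
      refine ⟨⟨p, hp⟩, h2.mpr ?_, rfl⟩
      have h3 : p₁ = ⟨p', hp'⟩ := Subtype.ext hpp
      subst h3
      exact hp₁

end FiberGluing

/-! ## The intersection graph in terms of branches -/

/-- A neighbour of `u` closer to `r` is the last vertex before `u` on the unique path from `r`. -/
lemma SimpleGraph.IsTree.eq_of_dist_lt {V : Type*} {G : SimpleGraph V} (hG : G.IsTree) (r : V)
    {u v w : V} (hv : G.Adj v u) (hw : G.Adj w u) (hv' : G.dist r v < G.dist r u)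
    (hw' : G.dist r w < G.dist r u) : v = w := by
  have key : ∀ x, G.Adj x u → G.dist r x < G.dist r u →
      ∃ p : G.Walk r u, p.IsPath ∧ p.penultimate = x := by
    intro x hx hx'
    obtain ⟨p, -, hp⟩ := hG.connected.exists_path_of_dist r x
    refine ⟨p.concat hx, (p.concat hx).isPath_of_length_eq_dist ?_, p.penultimate_concat hx⟩
    rw [SimpleGraph.Walk.length_concat, hp]
    have := hG.dist_eq_dist_add_one_of_adj r hx
    omega
  obtain ⟨p, hp, rfl⟩ := key v hv hv'
  obtain ⟨q, hq, rfl⟩ := key w hw hw'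
  rw [(hG.existsUnique_path r u).unique hp hq]

-- Distance from `r` is a depth function on the tree. Points outside the tree carry at most one
-- branch, so they are attached as leaves below its component. The last clause says that only the
-- root can have depth zero among points with branches.
open Classical in
lemma SimpleGraph.IsTree.exists_isForestDepth {G P E Y : Type*} {H : SimpleGraph (G ⊕ Y)}
    (hH : H.IsTree) {gr : E → G} {pt : E → P} (ι : Y → P) (hι : Function.Injective ι)
    (hadj : ∀ e y, ι y = pt e → H.Adj (Sum.inl (gr e)) (Sum.inr y))
    (hinj : ∀ e f, pt e = pt f → gr e = gr f → e = f)
    (hsub : ∀ e f, (∀ y, ι y ≠ pt e) → pt e = pt f → e = f) (r : G ⊕ Y) :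
    ∃ d d', IsForestDepth gr pt d d' ∧ (∀ g, d g = H.dist r (Sum.inl g)) ∧
      ∀ e, d' (pt e) = 0 → ∃ y, ι y = pt e ∧ r = Sum.inr y := by
  let d : G → ℕ := fun g => H.dist r (Sum.inl g)
  let d' : P → ℕ := fun p =>
    -- The default zero occurs only for points without branches, which no clause concerns.
    if h : ∃ y, ι y = p then H.dist r (Sum.inr h.choose)
    else if h : ∃ e, pt e = p then d (gr h.choose) + 1 else 0
  have h1 : ∀ y, d' (ι y) = H.dist r (Sum.inr y) := fun y => by
    have hex : ∃ z, ι z = ι y := ⟨y, rfl⟩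
    simp only [d']
    rw [dif_pos hex, hι hex.choose_spec]
  have h2 : ∀ e, (∀ y, ι y ≠ pt e) → d' (pt e) = d (gr e) + 1 := by
    intro e he
    have hex : ∃ f, pt f = pt e := ⟨e, rfl⟩
    simp only [d']
    rw [dif_neg (by simpa using he), dif_pos hex, ← hsub e hex.choose he hex.choose_spec.symm]
  have hcase : ∀ e, (∃ y, ι y = pt e ∧ H.Adj (Sum.inl (gr e)) (Sum.inr y) ∧
      d' (pt e) = H.dist r (Sum.inr y)) ∨ ((∀ y, ι y ≠ pt e) ∧ d' (pt e) = d (gr e) + 1) := by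
    intro e
    by_cases he : ∃ y, ι y = pt e
    · obtain ⟨y, hy⟩ := he
      exact Or.inl ⟨y, hy, hadj e y hy, by rw [← hy, h1]⟩
    · push Not at he
      exact Or.inr ⟨he, h2 e he⟩
  refine ⟨d, d', ⟨fun e => ?_, fun e f hef he hf => ?_, fun e f hef he hf => ?_⟩, fun g => rfl,
    fun e he => ?_⟩
  · rcases hcase e with ⟨y, hy, ha, hd⟩ | ⟨-, hd⟩
    · rw [hd]
      exact hH.dist_ne_of_adj r ha
    · omega
  · rcases hcase e with ⟨y, hy, ha, hd⟩ | ⟨-, hd⟩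
    · rcases hcase f with ⟨z, hz, hb, hc⟩ | ⟨-, hc⟩
      · rw [hd] at he
        rw [hc, ← hef] at hf
        rw [← hef] at hb
        have := Sum.inr_injective (hH.eq_of_dist_lt r ha.symm hb.symm he hf)
        subst this
        exact hinj e f (hy.symm.trans hz) hef
      · omega
    · omega
  · rcases hcase e with ⟨y, hy, ha, hd⟩ | ⟨h, hd⟩
    · rcases hcase f with ⟨z, hz, hb, hc⟩ | ⟨h, -⟩
      · obtain rfl : y = z := hι (hy.trans (hef.trans hz.symm))
        rw [hd] at he
        rw [hc] at hf
        exact hinj e f hef (Sum.inl_injective (hH.eq_of_dist_lt r ha hb he hf))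
      · exact (h y (hy.trans hef)).elim
    · exact hsub e f h hef
  · rcases hcase e with ⟨y, hy, ha, hd⟩ | ⟨h, hd⟩
    · rw [hd] at he
      exact ⟨y, hy, hH.connected.dist_eq_zero_iff.mp he⟩
    · omega

namespace BipartiteMultigraph

lemma toSimpleGraph_adj_inl_inr {Γ : BipartiteMultigraph.{u}} {g : Γ.Green} {y : Γ.Yellow} :
    Γ.toSimpleGraph.Adj (Sum.inl g) (Sum.inr y) ↔ ∃ e, Γ.green e = g ∧ Γ.yellow e = y := by
  simp [toSimpleGraph, eq_comm]

lemma not_toSimpleGraph_adj_inl_inl {Γ : BipartiteMultigraph.{u}} {g g' : Γ.Green} :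
    ¬ Γ.toSimpleGraph.Adj (Sum.inl g) (Sum.inl g') := by
  simp [toSimpleGraph]

lemma exists_edges_of_greenDist_eq_two {Γ : BipartiteMultigraph.{u}} {g g' : Γ.Green}
    (h : Γ.greenDist g g' = 2) :
    ∃ e e', Γ.green e = g ∧ Γ.green e' = g' ∧ Γ.yellow e = Γ.yellow e' := by
  have h' : Γ.toSimpleGraph.dist (Sum.inl g) (Sum.inl g') = 2 := h
  obtain ⟨p, hp⟩ := SimpleGraph.exists_walk_of_dist_ne_zero (by rw [h']; decide)
  rw [h'] at hp
  rcases p with _ | @⟨_, v, _, h1, _ | @⟨_, w, _, h2, q⟩⟩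
  · simp at hp
  · simp at hp
  · obtain rfl := SimpleGraph.Walk.eq_of_length_eq_zero (p := q) (by simpa using hp)
    rcases v with v | y
    · exact (not_toSimpleGraph_adj_inl_inl h1).elim
    · obtain ⟨e, he, rfl⟩ := toSimpleGraph_adj_inl_inr.mp h1
      obtain ⟨e', he', hy⟩ := toSimpleGraph_adj_inl_inr.mp h2.symm
      exact ⟨e, e', he, he', hy.symm⟩

end BipartiteMultigraph

/-! ### Edges of the intersection graph as branches -/

section IntersectionGraph

variable {C : Scheme.{u}} [∀ y : C, IsNoetherianRing (C.presheaf.stalk y)]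

lemma notMem_genericPoints_of_nontrivial_branches {y : C} (h : (branches C y).Nontrivial) :
    y ∉ genericPoints C :=
  fun hy => not_nontrivial_branches_of_mem_genericPoints hy h

lemma nontrivial_branches_iff {y : {y : C // y ∉ genericPoints C}} :
    (branches C y.1).Nontrivial ↔ ∃ b c : Branch C, b ≠ c ∧ b.1 = y ∧ c.1 = y := by
  constructor
  · rintro ⟨b, hb, c, hc, hbc⟩
    refine ⟨⟨y, b, hb⟩, ⟨y, c, hc⟩, fun h => hbc ?_, rfl, rfl⟩
    exact congrArg Subtype.val (eq_of_heq (Sigma.mk.inj h).2)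
  · rintro ⟨⟨y, b, hb⟩, ⟨z, c, hc⟩, hbc, rfl, h⟩
    dsimp only at h
    subst h
    exact ⟨b, hb, c, hc, fun h => hbc (by subst h; rfl)⟩

/-- The branch that is an edge of the intersection graph. -/
noncomputable def edgeBranch (e : (intersectionGraph C).Edge) : Branch C :=
  ⟨⟨e.2.1.1, notMem_genericPoints_of_nontrivial_branches e.2.1.2⟩, e.2.2.1, e.2.2.2.1⟩

lemma component_edgeBranch (e : (intersectionGraph C).Edge) :
    (edgeBranch e).component = (intersectionGraph C).green e := by
  have := (edgeBranch e).isPrime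
  exact Subtype.ext ((isBranchOf_iff (edgeBranch e).2.1 e.1.1).mp e.2.2.2.2)

lemma edgeBranch_injective : Function.Injective (edgeBranch (C := C)) := by
  intro e e' h
  have h1 : e.1 = e'.1 := by
    have := congrArg Branch.component h
    rwa [component_edgeBranch, component_edgeBranch] at this
  obtain ⟨g, ⟨y, hy⟩, b, hb, hb'⟩ := e
  obtain ⟨g', ⟨y', hy'⟩, c, hc, hc'⟩ := e'
  dsimp only at h1
  subst h1
  have h2 := congrArg Branch.toSigma h
  simp only [Branch.toSigma, edgeBranch, Sigma.mk.injEq] at h2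
  obtain ⟨rfl, h2⟩ := h2
  obtain rfl := eq_of_heq h2
  rfl

lemma exists_edgeBranch_eq (b : Branch C) (h : (branches C b.1.1).Nontrivial) :
    ∃ e, edgeBranch e = b ∧ (intersectionGraph C).yellow e = ⟨b.1.1, h⟩ :=
  ⟨⟨b.component, ⟨b.1.1, h⟩, b.2.1, b.2.2, (isBranchOf_iff _ _).mpr rfl⟩, rfl, rfl⟩

lemma exists_branch_of_greenDist_eq_two {g g' : (intersectionGraph C).Green}
    (h : (intersectionGraph C).greenDist g g' = 2) :
    ∃ b c : Branch C, b.1 = c.1 ∧ b.component = g ∧ c.component = g' := by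
  obtain ⟨e, e', rfl, rfl, hy⟩ := BipartiteMultigraph.exists_edges_of_greenDist_eq_two h
  exact ⟨edgeBranch e, edgeBranch e', Subtype.ext (congrArg (fun z => z.1) hy), component_edgeBranch e,
    component_edgeBranch e'⟩

lemma branch_adj (b : Branch C) (h : (branches C b.1.1).Nontrivial) :
    (intersectionGraph C).toSimpleGraph.Adj (Sum.inl b.component) (Sum.inr ⟨b.1.1, h⟩) := by
  obtain ⟨e, rfl, he⟩ := exists_edgeBranch_eq b h
  exact BipartiteMultigraph.toSimpleGraph_adj_inl_inr.mpr ⟨e, (component_edgeBranch e).symm, he⟩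

lemma branch_eq_of_isTree (hT : (intersectionGraph C).IsTree) {b c : Branch C} (h : b.1 = c.1)
    (h' : b.component = c.component) : b = c := by
  by_contra hbc
  have hb : (branches C b.1.1).Nontrivial := nontrivial_branches_iff.mpr ⟨b, c, hbc, rfl, h.symm⟩
  have hc : (branches C c.1.1).Nontrivial := nontrivial_branches_iff.mpr ⟨b, c, hbc, h, rfl⟩
  obtain ⟨e, rfl, he⟩ := exists_edgeBranch_eq b hb
  obtain ⟨e', rfl, he'⟩ := exists_edgeBranch_eq c hc
  refine hbc (congrArg edgeBranch (hT.2 (Prod.ext ?_ ?_)))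
  · rwa [component_edgeBranch, component_edgeBranch] at h'
  · exact Subtype.ext (congrArg (fun z => z.1) h)

/-- The intersection graph omits points with a single branch, whereas the gluing data include all
nongeneric points; the missing ones become leaves. The root stays free, so that it can be put at a
point of branch failure. -/
lemma exists_isForestDepth (hT : (intersectionGraph C).IsTree)
    (r : (intersectionGraph C).Green ⊕ (intersectionGraph C).Yellow) :
    ∃ (d : {g : C // g ∈ genericPoints C} → ℕ) (d' : {y : C // y ∉ genericPoints C} → ℕ),
      IsForestDepth (fun b : Branch C => b.component) (fun b => b.1) d d' ∧
      (∀ g, d g = (intersectionGraph C).toSimpleGraph.dist r (Sum.inl g)) ∧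
      ∀ b : Branch C, d' b.1 = 0 → ∃ h, r = Sum.inr ⟨b.1.1, h⟩ := by
  let ι : (intersectionGraph C).Yellow → {y : C // y ∉ genericPoints C} := fun y =>
    ⟨y.1, notMem_genericPoints_of_nontrivial_branches y.2⟩
  have hι : Function.Injective ι := fun y z h => Subtype.ext (congrArg (fun z => z.1) h)
  have hadj : ∀ (b : Branch C) y, ι y = b.1 →
      (intersectionGraph C).toSimpleGraph.Adj (Sum.inl b.component) (Sum.inr y) := by
    intro b y hy
    have hy' : y.1 = b.1.1 := congrArg (fun z => z.1) hy
    have h := branch_adj b (hy' ▸ y.2)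
    rwa [← show y = ⟨b.1.1, hy' ▸ y.2⟩ from Subtype.ext hy'] at h
  have hsub : ∀ b c : Branch C, (∀ y, ι y ≠ b.1) → b.1 = c.1 → b = c := by
    intro b c hb hbc
    by_contra hne
    exact hb ⟨b.1.1, nontrivial_branches_iff.mpr ⟨b, c, hne, rfl, hbc.symm⟩⟩ rfl
  obtain ⟨d, d', h1, h2, h3⟩ := hT.1.exists_isForestDepth (gr := fun b : Branch C => b.component)
    (pt := fun b => b.1) ι hι hadj (fun b c h h' => branch_eq_of_isTree hT h h') hsub r
  refine ⟨d, d', h1, h2, fun b hb => ?_⟩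
  obtain ⟨y, hy, hr⟩ := h3 b hb
  have hy' : y.1 = b.1.1 := congrArg (fun z => z.1) hy
  exact ⟨hy' ▸ y.2, hr.trans (congrArg Sum.inr (Subtype.ext hy'))⟩

/-- Isomorphisms are more easily described from the model to the curve, with branches in place of
edges; the required one consists of the inverse maps. -/
lemma hasGraph_of_bijOn {Γ : BipartiteMultigraph.{0}} {m : Γ.Green → ℕ∞}
    (φ : Γ.Green → {g : C // g ∈ genericPoints C}) (ψ : Γ.Yellow → {y : C // y ∉ genericPoints C})
    (χ : Γ.Edge → Branch C) (hφ : Function.Bijective φ) (hψ : Function.Injective ψ)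
    (hψ' : ∀ y, (branches C y.1).Nontrivial ↔ y ∈ Set.range ψ) (hχ : Function.Injective χ)
    (hχ' : ∀ b : Branch C, b.1 ∈ Set.range ψ → b ∈ Set.range χ)
    (h1 : ∀ e, (χ e).component = φ (Γ.green e)) (h2 : ∀ e, (χ e).1 = ψ (Γ.yellow e))
    (hm : ∀ g, componentMultiplicity C (φ g) = m g) : HasGraph C Γ m := by
  let ψ₁ : Γ.Yellow → (intersectionGraph C).Yellow := fun y => ⟨(ψ y).1, (hψ' _).mpr ⟨y, rfl⟩⟩
  have hψ₁ : Function.Bijective ψ₁ := by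
    constructor
    · intro y z h
      exact hψ (Subtype.ext (congrArg (fun z => z.1) h))
    · rintro ⟨y, hy⟩
      obtain ⟨z, hz⟩ := (hψ' ⟨y, notMem_genericPoints_of_nontrivial_branches hy⟩).mp hy
      exact ⟨z, Subtype.ext (congrArg (fun z => z.1) hz)⟩
  have hex : ∀ e, ∃ e', edgeBranch e' = χ e ∧ (intersectionGraph C).yellow e' = ψ₁ (Γ.yellow e) := by
    intro e
    obtain ⟨e', he, he'⟩ := exists_edgeBranch_eq (χ e) ((hψ' _).mpr ⟨_, (h2 e).symm⟩)
    exact ⟨e', he, he'.trans (Subtype.ext (congrArg (fun z => z.1) (h2 e)))⟩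
  choose χ₁ hχ₁ hχ₁' using hex
  have hbij : Function.Bijective χ₁ := by
    constructor
    · intro e e' h
      exact hχ (by rw [← hχ₁, h, hχ₁])
    · intro e
      obtain ⟨e', he'⟩ := hχ' (edgeBranch e) ((hψ' _).mp e.2.1.2)
      exact ⟨e', edgeBranch_injective ((hχ₁ e').trans he')⟩
  refine ⟨(Equiv.ofBijective φ hφ).symm, (Equiv.ofBijective ψ₁ hψ₁).symm,
    (Equiv.ofBijective χ₁ hbij).symm, ?_, ?_, ?_⟩
  · intro e
    obtain ⟨e, rfl⟩ := hbij.2 e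
    rw [Equiv.ofBijective_symm_apply_apply, ← component_edgeBranch, hχ₁, h1]
    exact (Equiv.ofBijective_symm_apply_apply φ hφ _).symm
  · intro e
    obtain ⟨e, rfl⟩ := hbij.2 e
    rw [Equiv.ofBijective_symm_apply_apply, hχ₁']
    exact (Equiv.ofBijective_symm_apply_apply ψ₁ hψ₁ _).symm
  · intro g
    obtain ⟨g, rfl⟩ := hφ.2 g
    rw [← hm]
    exact congrArg (fun x => componentMultiplicity C (φ x))
      (Equiv.ofBijective_symm_apply_apply φ hφ g)

lemma hasGraph_point [Subsingleton {g : C // g ∈ genericPoints C}]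
    (h : ∀ b c : Branch C, b.1 = c.1 → b = c) (g : {g : C // g ∈ genericPoints C})
    (hg : componentMultiplicity C g = 1) : HasGraph C .point ![1] := by
  refine hasGraph_of_bijOn (Γ := .point) (fun _ => g) Empty.elim Empty.elim ⟨?_, ?_⟩ ?_ ?_ ?_ ?_
    ?_ ?_ ?_
  · intro i j _
    exact Subsingleton.elim (α := Fin 1) i j
  · intro k
    exact ⟨(0 : Fin 1), Subsingleton.elim _ _⟩
  · intro i
    exact i.elim
  · intro y
    constructor
    · intro hy
      obtain ⟨b, c, hbc, hb, hc⟩ := nontrivial_branches_iff.mp hy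
      exact (hbc (h b c (hb.trans hc.symm))).elim
    · rintro ⟨i, -⟩
      exact i.elim
  · intro i
    exact i.elim
  · rintro b ⟨i, -⟩
    exact i.elim
  · intro i
    exact i.elim
  · intro i
    exact i.elim
  · intro i
    rw [hg]
    obtain rfl : i = (0 : Fin 1) := Subsingleton.elim (α := Fin 1) _ _
    rfl

lemma hasGraph_star {n : ℕ} (hn : 2 ≤ n) (φ : Fin n → {g : C // g ∈ genericPoints C})
    (hφ : Function.Bijective φ) (m : Fin n → ℕ∞) (hm : ∀ i, componentMultiplicity C (φ i) = m i)
    (y : {y : C // y ∉ genericPoints C})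
    (h1 : ∀ b c : Branch C, b ≠ c → b.1 = c.1 → b.1 = y)
    (h2 : ∀ k, ∃! b : Branch C, b.1 = y ∧ b.component = k) : HasGraph C (.star n) m := by
  choose χ hχ hχ' using fun k => (h2 k).exists
  have hχi : Function.Injective χ := fun k l h => by rw [← hχ' k, h, hχ']
  have hne : φ ⟨0, by omega⟩ ≠ φ ⟨1, by omega⟩ := fun h => by
    have := hφ.1 h
    simp at this
  refine hasGraph_of_bijOn (Γ := .star n) φ (fun _ => y) (fun i => χ (φ i)) hφ
    (fun _ _ _ => rfl) ?_ (hχi.comp hφ.1) ?_ (fun i => hχ' _) (fun i => hχ _) hm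
  · intro z
    constructor
    · intro hz
      obtain ⟨b, c, hbc, rfl, hc⟩ := nontrivial_branches_iff.mp hz
      exact ⟨(), (h1 b c hbc hc.symm).symm⟩
    · rintro ⟨-, rfl⟩
      exact nontrivial_branches_iff.mpr ⟨_, _, hχi.ne hne, hχ _, hχ _⟩
  · rintro b ⟨_, hb⟩
    obtain ⟨i, hi⟩ := hφ.2 b.component
    refine ⟨i, ?_⟩
    exact (h2 (φ i)).unique ⟨hχ _, hχ' _⟩ ⟨hb.symm, hi.symm⟩

end IntersectionGraph

lemma injective_vec_two {α : Type*} {a b : α} (h : b ≠ a) : Function.Injective ![a, b] := by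
  intro i j hij
  match i, j with
  | 0, 0 => rfl
  | 0, 1 => exact (h hij.symm).elim
  | 1, 0 => exact (h hij).elim
  | 1, 1 => rfl

lemma injective_vec_three {α : Type*} {a b c : α} (h : b ≠ a) (h' : c ≠ a) (h'' : c ≠ b) :
    Function.Injective ![a, b, c] := by
  intro i j hij
  match i, j with
  | 0, 0 => rfl
  | 0, 1 => exact (h hij.symm).elim
  | 0, 2 => exact (h' hij.symm).elim
  | 1, 0 => exact (h hij).elim
  | 1, 1 => rfl
  | 1, 2 => exact (h'' hij.symm).elim
  | 2, 0 => exact (h' hij).elim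
  | 2, 1 => exact (h'' hij).elim
  | 2, 2 => rfl

lemma bijective_vec_two {α : Type*} {a b : α} (h : b ≠ a) (hall : ∀ k, k = a ∨ k = b) :
    Function.Bijective ![a, b] := by
  refine ⟨injective_vec_two h, fun k => ?_⟩
  rcases hall k with rfl | rfl
  exacts [⟨0, rfl⟩, ⟨1, rfl⟩]

lemma bijective_vec_three {α : Type*} {a b c : α} (h : b ≠ a) (h' : c ≠ a) (h'' : c ≠ b)
    (hall : ∀ k, k = a ∨ k = b ∨ k = c) : Function.Bijective ![a, b, c] := by
  refine ⟨injective_vec_three h h' h'', fun k => ?_⟩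
  rcases hall k with rfl | rfl | rfl
  exacts [⟨0, rfl⟩, ⟨1, rfl⟩, ⟨2, rfl⟩]

section IntersectionGraph

variable {C : Scheme.{u}} [∀ y : C, IsNoetherianRing (C.presheaf.stalk y)]

lemma hasGraph_hexagon (φ : Fin 3 → {g : C // g ∈ genericPoints C}) (hφ : Function.Bijective φ)
    (m : Fin 3 → ℕ∞) (hm : ∀ i, componentMultiplicity C (φ i) = m i)
    (ψ : Fin 3 → {y : C // y ∉ genericPoints C}) (hψ : Function.Injective ψ)
    (h1 : ∀ b c : Branch C, b ≠ c → b.1 = c.1 → b.1 ∈ Set.range ψ)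
    (h2 : ∀ i, ∃! b : Branch C, b.1 = ψ i ∧ b.component = φ i)
    (h3 : ∀ i, ∃! b : Branch C, b.1 = ψ (i + 1) ∧ b.component = φ i)
    (h4 : ∀ (b : Branch C) i, b.1 = ψ (i + 1) → b.component = φ i ∨ b.component = φ (i + 1)) :
    HasGraph C .hexagon m := by
  choose α hα hα' using fun i => (h2 i).exists
  choose β hβ hβ' using fun i => (h3 i).exists
  have hs : ∀ i : Fin 3, i ≠ i + 1 := by decide
  have hp : ∀ i : Fin 3, ∃ j, i = j + 1 := by decide
  have hcomp : ∀ e : Fin 3 × Fin 2, (if e.2 = 0 then α e.1 else β e.1).component = φ e.1 := by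
    intro e
    split_ifs
    exacts [hα' _, hβ' _]
  have hpt : ∀ e : Fin 3 × Fin 2, (if e.2 = 0 then α e.1 else β e.1).1 =
      ψ (if e.2 = 0 then e.1 else e.1 + 1) := by
    intro e
    split_ifs
    exacts [hα _, hβ _]
  refine hasGraph_of_bijOn (Γ := .hexagon) φ ψ (fun e => if e.2 = 0 then α e.1 else β e.1) hφ hψ
    ?_ ?_ ?_ hcomp hpt hm
  · intro z
    constructor
    · intro hz
      obtain ⟨b, c, hbc, rfl, hc⟩ := nontrivial_branches_iff.mp hz
      exact h1 b c hbc hc.symm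
    · rintro ⟨i, rfl⟩
      obtain ⟨j, rfl⟩ := hp i
      refine nontrivial_branches_iff.mpr ⟨α (j + 1), β j, fun h => hs j (hφ.1 ?_), hα _, hβ _⟩
      rw [← hβ' j, ← h, hα']
  · rintro e e' h
    dsimp only at h
    have h5 : e.1 = e'.1 := hφ.1 ((hcomp e).symm.trans ((congrArg Branch.component h).trans (hcomp e')))
    have h6 := hψ ((hpt e).symm.trans ((congrArg (fun b => b.1) h).trans (hpt e')))
    refine Prod.ext h5 ?_
    have : ∀ (i : Fin 3) (j k : Fin 2),
        (if j = 0 then i else i + 1) = (if k = 0 then i else i + 1) → j = k := by decide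
    exact this e.1 _ _ (h6.trans (by rw [h5]))
  · rintro b ⟨i, hi⟩
    obtain ⟨j, rfl⟩ := hp i
    rcases h4 b j hi.symm with h | h
    · exact ⟨(j, 1), (h3 j).unique ⟨hβ _, hβ' _⟩ ⟨hi.symm, h⟩⟩
    · exact ⟨(j + 1, 0), (h2 (j + 1)).unique ⟨hα _, hα' _⟩ ⟨hi.symm, h⟩⟩

end IntersectionGraph

/-! ### From shapes of gluing data to labelled graphs -/

namespace GluingData

variable {C : Scheme.{u}} [∀ y : C, IsNoetherianRing (C.presheaf.stalk y)] {G P E : Type*}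
  {D : GluingData G P E {g : C // g ∈ genericPoints C} {y : C // y ∉ genericPoints C} (Branch C)}
  (hgr : D.gr' = Branch.component) (hpt : D.pt' = fun b => b.1)
  (hm : ∀ g : {g : C // g ∈ genericPoints C}, componentMultiplicity C g = D.m g)

include hgr hpt hm in
lemma IsStarCentre.hasGraph {y : {y : C // y ∉ genericPoints C}} (hy : D.IsStarCentre y)
    {n : ℕ} (hn : 2 ≤ n) (φ : Fin n → {g : C // g ∈ genericPoints C}) (hφ : Function.Bijective φ)
    (l : Fin n → ℕ∞) (hl : ∀ i, (D.m (φ i) : ℕ∞) = l i) : HasGraph C (.star n) l := by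
  unfold IsStarCentre at hy
  rw [hgr, hpt] at hy
  exact hasGraph_star hn φ hφ l (fun i => (hm _).trans (hl i)) y hy.1 hy.2

include hgr hpt hm in
/-- The graph of the target, if all components have multiplicity one. -/
lemma exists_hasGraph_of_forall_m_eq_one [Nonempty {g : C // g ∈ genericPoints C}]
    (h1 : ∀ k, D.m k = 1) :
    (Nat.card {g : C // g ∈ genericPoints C} = 1 ∧ HasGraph C .point ![1]) ∨
      ∃ n, 2 ≤ n ∧ n ≤ 4 ∧ Nat.card {g : C // g ∈ genericPoints C} = n ∧
        (∀ l : Fin n → ℕ∞, (∀ i, l i = 1) → HasGraph C (.star n) l) ∧ ∃ y, D.IsStarCentre y := by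
  rcases D.isStarCentre_of_forall_m_eq_one h1 with ⟨h2, h3⟩ | ⟨h2, h3, h4, y, hy⟩
  · rw [hpt] at h3
    refine Or.inl ⟨Nat.card_unique, hasGraph_point h3 (Classical.arbitrary _) ?_⟩
    exact (hm _).trans (by rw [h1, Nat.cast_one])
  · refine Or.inr ⟨_, Finite.one_lt_card, h4, rfl, fun l hl => IsStarCentre.hasGraph hgr hpt hm hy
      Finite.one_lt_card _ (Finite.equivFin _).symm.bijective _ ?_, y, hy⟩
    intro i
    rw [h1, Nat.cast_one, hl]

include hgr hpt hm in
/-- The graph of the target, if there is a component of multiplicity two. -/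
lemma DoubledShape.hasGraph (hD : D.DoubledShape) :
    (Nat.card {g : C // g ∈ genericPoints C} = 2 ∧ HasGraph C (.star 2) ![2, 1]) ∨
    (Nat.card {g : C // g ∈ genericPoints C} = 3 ∧
      (HasGraph C (.star 3) ![2, 1, 1] ∨ HasGraph C .hexagon ![2, 2, 1])) := by
  have hcard : ∀ {n} {φ : Fin n → {g : C // g ∈ genericPoints C}}, Function.Bijective φ →
      Nat.card {g : C // g ∈ genericPoints C} = n := fun hφ => by
    rw [← Nat.card_congr (Equiv.ofBijective _ hφ), Nat.card_fin]
  rcases hD with ⟨h, r, hh, hr, hrh, ⟨y, hy⟩, hall | ⟨r', hr', hrh', hrr, hall⟩⟩ |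
    ⟨h, k, r, hh, hk, hkh, hr, hall, y₁, y₂, y₃, h1, h2, h3, h4⟩
  · have hφ := bijective_vec_two hrh hall
    refine Or.inl ⟨hcard hφ, IsStarCentre.hasGraph hgr hpt hm hy le_rfl _ hφ _ ?_⟩
    intro i
    fin_cases i <;> simp [hh, hr]
  · have hφ := bijective_vec_three hrh hrh' hrr hall
    refine Or.inr ⟨hcard hφ, Or.inl (IsStarCentre.hasGraph hgr hpt hm hy (by decide) _ hφ _ ?_)⟩
    intro i
    fin_cases i <;> simp [hh, hr, hr']
  · have hrh : r ≠ h := by rintro rfl; omega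
    have hrk : r ≠ k := by rintro rfl; omega
    have hφ := bijective_vec_three hkh hrh hrk fun l => hall l
    unfold IsNode at h1 h2 h3
    rw [hgr, hpt] at h1 h2 h3
    rw [hpt] at h4
    obtain ⟨h11, h12, h13⟩ := h1
    obtain ⟨h21, h22, h23⟩ := h2
    obtain ⟨h31, h32, h33⟩ := h3
    -- In the cyclic order `h`, `k`, `r`, the yellow vertex `i + 1` lies between the green vertices
    -- `i` and `i + 1`. This forces the order `y₁` (`h` and `r`), `y₃` (`h` and `k`), `y₂` (`k` and
    -- `r`).
    refine Or.inr ⟨hcard hφ, Or.inr (hasGraph_hexagon _ hφ _ ?_ ![y₁, y₃, y₂] ?_ ?_ ?_ ?_ ?_)⟩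
    · intro i
      refine (hm _).trans ?_
      fin_cases i <;> simp [hh, hr, hk]
    · have h13' : y₁ ≠ y₃ := by
        rintro rfl
        obtain ⟨b, hb, hb'⟩ := h33.exists
        rcases h11 b hb with h | h
        exacts [hkh (hb'.symm.trans h), hrk (h.symm.trans hb')]
      have h12' : y₁ ≠ y₂ := by
        rintro rfl
        obtain ⟨b, hb, hb'⟩ := h12.exists
        rcases h21 b hb with h | h
        exacts [hkh (h.symm.trans hb'), hrh (h.symm.trans hb')]
      have h32' : y₃ ≠ y₂ := by
        rintro rfl
        obtain ⟨b, hb, hb'⟩ := h32.exists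
        rcases h21 b hb with h | h
        exacts [hkh (h.symm.trans hb'), hrh (h.symm.trans hb')]
      exact injective_vec_three h13'.symm h12'.symm h32'.symm
    · intro b c hbc hb
      rcases h4 b c hbc hb with h | h | h
      exacts [⟨0, h.symm⟩, ⟨2, h.symm⟩, ⟨1, h.symm⟩]
    · intro i
      fin_cases i
      exacts [h12, h33, h23]
    · intro i
      fin_cases i
      exacts [h32, h22, h13]
    · intro b i hb
      fin_cases i
      exacts [h31 b hb, h21 b hb, (h11 b hb).symm]

end GluingData

lemma numComponents_eq (C : Scheme.{u}) :
    numComponents C = ENat.card {g : C // g ∈ genericPoints C} := by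
  rw [numComponents, Set.encard, ENat.card_congr (genericPoints.equiv (α := C))]

/-! ### Gluing data of the family and the classification -/

section FiberGluing

variable {X' X T : Scheme.{u}} {ν : X' ⟶ X} {f : X ⟶ T} {t₀ : T}
  [AlgebraicGeometry.IsIntegral X'] [AlgebraicGeometry.IsIntegral X] [AlgebraicGeometry.IsIntegral T]
  [IsLocallyNoetherian X] [IsLocallyNoetherian X'] [Flat f] [QuasiCompact f]
  [IsFinite ν] [IsIso (ν.stalkMap (genericPoint X'))]

/-- The gluing data of a finite birational map of families of curves. -/
noncomputable def fiberGluingData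
    (hφ : ∀ p, p ∉ genericPoints ((ν ≫ f).fiber t₀) →
      fiberMap ν f t₀ p ∉ genericPoints (f.fiber t₀))
    (hb : ∀ e : Branch ((ν ≫ f).fiber t₀),
      e.2.1.comap (completionMap (fiberStalkMap (rfl : fiberMap ν f t₀ e.1.1 = _))) ∈
        branches (f.fiber t₀) (fiberMap ν f t₀ e.1.1))
    (hφ' : ∀ p, fiberMap ν f t₀ p ∉ genericPoints (f.fiber t₀) →
      p ∉ genericPoints ((ν ≫ f).fiber t₀))
    (m : {g : f.fiber t₀ // g ∈ genericPoints (f.fiber t₀)} → ℕ)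
    (surjective : Function.Surjective (fiberBranch hφ hb))
    (m_eq : ∀ h, m h = 1 ∨ m h = 2)
    (eq_of_m_eq_one : ∀ e e', m (fiberBranch hφ hb e).component = 1 →
      fiberBranch hφ hb e = fiberBranch hφ hb e' → e = e')
    (eq_of_component : ∀ g g', m (fiberComponent hφ' g) = 1 →
      fiberComponent hφ' g = fiberComponent hφ' g' → g = g')
    (eq_of_three : ∀ g₁ g₂ g₃, fiberComponent hφ' g₁ = fiberComponent hφ' g₂ →
      fiberComponent hφ' g₁ = fiberComponent hφ' g₃ → g₁ = g₂ ∨ g₁ = g₃ ∨ g₂ = g₃)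
    (connected : ∀ (y : {y : f.fiber t₀ // y ∉ genericPoints (f.fiber t₀)})
      (S : Set {p : (ν ≫ f).fiber t₀ // p ∉ genericPoints ((ν ≫ f).fiber t₀)}),
      (∀ e e', fiberBranch hφ hb e = fiberBranch hφ hb e' → fiberPoint hφ e.1 = y →
        (e.1 ∈ S ↔ e'.1 ∈ S)) →
      ∀ p q, fiberPoint hφ p = y → fiberPoint hφ q = y → p ∈ S → q ∈ S)
    (sum_le : ∀ y (F : Finset (Branch (f.fiber t₀))), (∀ b ∈ F, b.1 = y) →
      ∑ b ∈ F, m b.component ≤ 4)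
    (meet : ∀ h k, h ≠ k → ∃ b c : Branch (f.fiber t₀), b.1 = c.1 ∧ b.component = h ∧
      c.component = k)
    (one : ∃ h, m h = 1)
    (depth : ∃ d d', IsForestDepth (fun b : Branch ((ν ≫ f).fiber t₀) => b.component)
      (fun b => b.1) d d') :
    GluingData {g : (ν ≫ f).fiber t₀ // g ∈ genericPoints ((ν ≫ f).fiber t₀)}
      {p : (ν ≫ f).fiber t₀ // p ∉ genericPoints ((ν ≫ f).fiber t₀)} (Branch ((ν ≫ f).fiber t₀))
      {g : f.fiber t₀ // g ∈ genericPoints (f.fiber t₀)}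
      {p : f.fiber t₀ // p ∉ genericPoints (f.fiber t₀)} (Branch (f.fiber t₀)) where
  gr := fun b => b.component
  pt := fun b => b.1
  gr' := fun b => b.component
  pt' := fun b => b.1
  νG := fiberComponent hφ'
  νP := fiberPoint hφ
  νE := fiberBranch hφ hb
  m := m
  gr'_νE := component_fiberBranch hφ hb hφ'
  pt'_νE := fun _ => rfl
  surjective := surjective
  m_eq := m_eq
  eq_of_m_eq_one := eq_of_m_eq_one
  gr_eq_of_m_eq_one := fun e f => eq_of_component e.component f.component
  gr_eq_of_three := fun e f g => eq_of_three e.component f.component g.component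
  connected := connected
  sum_le := sum_le
  meet := meet
  exists_m_eq_one := one
  exists_forestDepth := depth

end FiberGluing

lemma comap_completionMap_congr {A B : Type u} [CommRing A] [CommRing B] [IsLocalRing A]
    [IsLocalRing B] {φ ψ : A →+* B} [IsLocalHom φ] [IsLocalHom ψ] (h : φ = ψ)
    (b : Ideal (AdicCompletion (maximalIdeal B) B)) :
    b.comap (completionMap φ) = b.comap (completionMap ψ) := by
  subst h
  rfl

section FiberGluing

variable {X' X T : Scheme.{u}} {ν : X' ⟶ X} {f : X ⟶ T} {t₀ : T}
  [AlgebraicGeometry.IsIntegral X'] [AlgebraicGeometry.IsIntegral X] [AlgebraicGeometry.IsIntegral T]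
  [IsLocallyNoetherian X] [IsLocallyNoetherian X'] [Flat f] [QuasiCompact f]
  [IsFinite ν] [IsIso (ν.stalkMap (genericPoint X'))] (hgen : ν (genericPoint X') = genericPoint X)
  {t : T.presheaf.stalk t₀} (ht : maximalIdeal (T.presheaf.stalk t₀) = Ideal.span {t}) (ht0 : t ≠ 0)
  (hnn : ∀ x : X, f x ≠ t₀ → IsIntegrallyClosed (X.presheaf.stalk x))
  (ht₀ : IsClosed {t₀}) (hX : IsSurface X) (hS2 : SatisfiesS2 X)

include ht ht0 ht₀ hX in
lemma sum_length_le_pointMultiplicity (y : {y : f.fiber t₀ // y ∉ genericPoints (f.fiber t₀)})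
    (m : {g : f.fiber t₀ // g ∈ genericPoints (f.fiber t₀)} → ℕ)
    (hm : ∀ g : {g : f.fiber t₀ // g ∈ genericPoints (f.fiber t₀)},
      componentMultiplicity (f.fiber t₀) g = m g)
    (F : Finset (Branch (f.fiber t₀))) (hF : ∀ b ∈ F, b.1 = y) {n : ℕ}
    (hn : ∀ p : f.fiber t₀, IsClosed {p} → pointMultiplicity (f.fiber t₀) p ≤ n) :
    ∑ b ∈ F, m b.component ≤ n := by
  have h := Branch.sum_length_le y.2 (mem_minimalPrimes_stalk_fiber ht ht0
    (ringKrullDim_stalk_eq_two ht ht0 ht₀ hX y.2).le) m hm F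
    fun b hb => congrArg (fun z => z.1) (hF b hb)
  exact_mod_cast h.trans (hn _ (isClosed_of_notMem_genericPoints ht ht0 ht₀ hX y.2))

include hgen ht ht0 hnn ht₀ hX hS2 in
/-- The gluing data of a finite birational map of families of curves exist. -/
theorem exists_gluingData (hT : (intersectionGraph ((ν ≫ f).fiber t₀)).IsTree)
    (m : {g : f.fiber t₀ // g ∈ genericPoints (f.fiber t₀)} → ℕ)
    (hm : ∀ g : {g : f.fiber t₀ // g ∈ genericPoints (f.fiber t₀)},
      componentMultiplicity (f.fiber t₀) g = m g)
    (m_eq : ∀ h, m h = 1 ∨ m h = 2)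
    (hpt : ∀ p : f.fiber t₀, IsClosed {p} → pointMultiplicity (f.fiber t₀) p ≤ (4 : ℕ))
    (hdist : ∀ g₁ g₂, g₁ ≠ g₂ → (intersectionGraph (f.fiber t₀)).greenDist g₁ g₂ = 2)
    (one : ∃ h, m h = 1)
    (hfail : (∃ g, 0 < componentFailure (fiberMap ν f t₀) g) ∨
      (∃ y, 0 < branchFailure (fiberMap ν f t₀) y) ∨ ∀ h, m h = 1) :
    ∃ D : GluingData {g : (ν ≫ f).fiber t₀ // g ∈ genericPoints ((ν ≫ f).fiber t₀)}
      {p : (ν ≫ f).fiber t₀ // p ∉ genericPoints ((ν ≫ f).fiber t₀)} (Branch ((ν ≫ f).fiber t₀))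
      {g : f.fiber t₀ // g ∈ genericPoints (f.fiber t₀)}
      {p : f.fiber t₀ // p ∉ genericPoints (f.fiber t₀)} (Branch (f.fiber t₀)),
      D.gr' = Branch.component ∧ D.pt' = (fun b => b.1) ∧ D.m = m ∧
        (D.HasFailure ∨ ∀ h, m h = 1) := by
  have hφ : ∀ p, p ∉ genericPoints ((ν ≫ f).fiber t₀) →
      fiberMap ν f t₀ p ∉ genericPoints (f.fiber t₀) := fun p hp =>
    apply_notMem_genericPoints hgen hp
  have hb := comap_mem_branches (ν := ν) (f := f) hgen ht ht0 ht₀ hX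
  have hφ' : ∀ p, fiberMap ν f t₀ p ∉ genericPoints (f.fiber t₀) →
      p ∉ genericPoints ((ν ≫ f).fiber t₀) := fun p hp =>
    notMem_genericPoints_of_apply hgen ht ht0 hnn ht₀ hX hS2 rfl hp
  have hfin : ∀ h : {g : f.fiber t₀ // g ∈ genericPoints (f.fiber t₀)},
      componentMultiplicity (f.fiber t₀) h ≠ ⊤ := fun h => by
    rw [hm h]
    exact ENat.natCast_ne_top _
  have hle : ∀ h
      (s : Finset {g : (ν ≫ f).fiber t₀ // g ∈ genericPoints ((ν ≫ f).fiber t₀)}) g, (∀ g' ∈ s, fiberComponent hφ' g' = h) → fiberComponent hφ' g = h → g ∉ s →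
      s.card + (fiberMap ν f t₀).residueDegree g.1 ≤ m h := by
    intro h s g hs hg hgs
    have := card_add_residueDegree_le_componentMultiplicity hgen ht ht0 hnn hφ' (hfin h) s hs g hg
      hgs
    rw [hm h] at this
    exact_mod_cast this
  have hpos : ∀ g : {g : (ν ≫ f).fiber t₀ // g ∈ genericPoints ((ν ≫ f).fiber t₀)}, 0 < (fiberMap ν f t₀).residueDegree g.1 := fun g =>
    residueDegree_pos hgen ht ht0 hnn hφ' (hfin _) g rfl
  have htwo : ∀ g g', fiberComponent hφ' g = fiberComponent hφ' g' → g ≠ g' →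
      1 + (fiberMap ν f t₀).residueDegree g.1 ≤ m (fiberComponent hφ' g) := by
    intro g g' h hne
    have := hle _ {g'} g (by simp [h]) rfl (by simpa using hne)
    rwa [Finset.card_singleton] at this
  have eq_of_component : ∀ g g', m (fiberComponent hφ' g) = 1 →
      fiberComponent hφ' g = fiberComponent hφ' g' → g = g' := by
    intro g g' h1 h
    by_contra hne
    have h2 := htwo g g' h hne
    have h3 := hpos g
    omega
  have eq_of_three : ∀ g₁ g₂ g₃, fiberComponent hφ' g₁ = fiberComponent hφ' g₂ →
      fiberComponent hφ' g₁ = fiberComponent hφ' g₃ → g₁ = g₂ ∨ g₁ = g₃ ∨ g₂ = g₃ := by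
    classical
    intro g₁ g₂ g₃ h12 h13
    by_contra! hne
    obtain ⟨n12, n13, n23⟩ := hne
    have h1 := hle _ {g₂, g₃} g₁ (by simp [h12.symm, h13.symm]) rfl (by simp [n12, n13])
    rw [Finset.card_pair n23] at h1
    have h2 := hpos g₁
    have h3 := m_eq (fiberComponent hφ' g₁)
    omega
  have depth : ∃ d d', IsForestDepth (fun b : Branch ((ν ≫ f).fiber t₀) => b.component)
      (fun b => b.1) d d' := by
    obtain ⟨r⟩ := hT.1.connected.nonempty
    obtain ⟨d, d', h, -⟩ := exists_isForestDepth hT r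
    exact ⟨d, d', h⟩
  let D := fiberGluingData hφ hb hφ' m
    (fiberBranch_surjective hgen ht ht0 hnn ht₀ hX hS2 hφ hb) m_eq
    (fun e e' h1 h => eq_of_fiberBranch_eq hgen ht hφ hb (by rw [hm, h1, Nat.cast_one]) h)
    eq_of_component eq_of_three
    (fun y S hS p q hp hq hpS =>
      mem_of_saturated_branches hgen ht ht0 hnn ht₀ hX hS2 hφ hb y S hS p q hp hq hpS)
    (fun y F hF => sum_length_le_pointMultiplicity ht ht0 ht₀ hX y m hm F hF hpt)
    (fun h k hhk => exists_branch_of_greenDist_eq_two (hdist h k hhk)) one depth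
  refine ⟨D, rfl, rfl, rfl, ?_⟩
  rcases hfail with ⟨g, hg⟩ | ⟨y, hy⟩ | hfail
  -- A degree of at least two uses up the whole multiplicity two, so no other component lies over
  -- the same one.
  · have hg' : 0 < (fiberMap ν f t₀).residueDegree g.1 - 1 := hg
    refine Or.inl (Or.inl ⟨fiberComponent hφ' g, ?_, ?_⟩)
    · have h1 := hle _ ∅ g (fun _ h => (Finset.notMem_empty _ h).elim) rfl (Finset.notMem_empty _)
      have h2 := m_eq (fiberComponent hφ' g)
      rw [Finset.card_empty] at h1
      change m _ = 2
      omega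
    · have key : ∀ e : Branch ((ν ≫ f).fiber t₀),
          fiberComponent hφ' e.component = fiberComponent hφ' g → e.component = g := by
        intro e he
        by_contra hne
        have h1 := htwo g e.component he.symm fun h => hne h.symm
        have h2 := m_eq (fiberComponent hφ' g)
        omega
      exact fun e e' he he' => (key e he).trans (key e' he').symm
  · refine Or.inl (Or.inr ?_)
    rw [branchFailure] at hy
    split_ifs at hy with hy'
    -- A positive difference of cardinalities rules out injectivity on the branches at `y`, so two
    -- of them share an image.
    · have hinj : ¬ Set.InjOn (Ideal.comap (completionMap ((fiberMap ν f t₀).stalkMap y.1).hom))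
          (branches ((ν ≫ f).fiber t₀) y.1) := by
        intro h
        rw [branchImage, h.ncard_image, Nat.sub_self] at hy
        exact lt_irrefl _ hy
      simp only [Set.InjOn, not_forall] at hinj
      obtain ⟨b, hb1, c, hc1, hbc, hne⟩ := hinj
      have hyg := notMem_genericPoints_of_nontrivial_branches y.2
      let e₁ : Branch ((ν ≫ f).fiber t₀) := ⟨⟨y.1, hyg⟩, b, hb1⟩
      let e₂ : Branch ((ν ≫ f).fiber t₀) := ⟨⟨y.1, hyg⟩, c, hc1⟩
      -- Rooting the tree at the point of failure puts the two components to be glued at depth one.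
      obtain ⟨d, d', h1, h2, h3⟩ := exists_isForestDepth hT (Sum.inr y)
      refine ⟨e₁, e₂, ?_, rfl, ?_, d, d', h1, ?_, ?_, ?_⟩
      · intro h
        exact hne (congrArg (fun z => z.1) (eq_of_heq (Sigma.mk.inj h).2))
      · refine (fiberBranch_eq_iff (e := e₁) (e' := e₂) hφ hb rfl).mpr ?_
        have h : ((fiberMap ν f t₀).stalkMap y.1).hom = fiberStalkMap rfl :=
          congrArg CommRingCat.Hom.hom ((fiberMap ν f t₀).stalkMapOfEq_rfl y.1).symm
        exact (comap_completionMap_congr h b).symm.trans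
          (hbc.trans (comap_completionMap_congr h c))
      · intro e he
        obtain ⟨h, hr⟩ := h3 e he
        exact Subtype.ext (congrArg (fun z => z.1) (Sum.inr_injective hr)).symm
      · refine (h2 e₁.component).trans (SimpleGraph.dist_eq_one_iff_adj.mpr ?_)
        exact (branch_adj e₁ y.2).symm
      · refine (h2 e₂.component).trans (SimpleGraph.dist_eq_one_iff_adj.mpr ?_)
        exact (branch_adj e₂ y.2).symm
    · exact (lt_irrefl _ hy).elim
  · exact Or.inr hfail

include hgen ht ht0 hnn ht₀ hX hS2 in
lemma hasGraph_fiber_of_doubleCurveHypotheses (H : DoubleCurveHypotheses (fiberMap ν f t₀)) :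
    ∃ n : ℕ, numComponents (f.fiber t₀) = n ∧
      ((n = 1 ∧ HasGraph (f.fiber t₀) .point ![1]) ∨
      (n = 2 ∧ (HasGraph (f.fiber t₀) (.star 2) ![1, 1] ∨
        HasGraph (f.fiber t₀) (.star 2) ![2, 1])) ∨
      (n = 3 ∧ (HasGraph (f.fiber t₀) (.star 3) ![1, 1, 1] ∨
        HasGraph (f.fiber t₀) (.star 3) ![2, 1, 1] ∨
        HasGraph (f.fiber t₀) .hexagon ![2, 2, 1])) ∨
      (n = 4 ∧ HasGraph (f.fiber t₀) (.star 4) ![1, 1, 1, 1])) := by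
  let m : {g : f.fiber t₀ // g ∈ genericPoints (f.fiber t₀)} → ℕ := fun g =>
    (componentMultiplicity (f.fiber t₀) g).toNat
  have hm : ∀ g : {g : f.fiber t₀ // g ∈ genericPoints (f.fiber t₀)},
      componentMultiplicity (f.fiber t₀) g = m g := fun g =>
    (ENat.natCast_toNat (ne_top_of_le_ne_top (by decide) (H.componentMultiplicity_le g))).symm
  have m_eq : ∀ h, m h = 1 ∨ m h = 2 := by
    intro h
    have h1 : (m h : ℕ∞) ≤ (2 : ℕ) := (hm h).symm.le.trans (H.componentMultiplicity_le h)
    have h2 : m h ≤ 2 := by exact_mod_cast h1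
    have h3 : m h ≠ 0 := by
      intro h3
      have h4 := hm h
      rw [h3] at h4
      exact not_subsingleton ((f.fiber t₀).presheaf.stalk h.1) (Module.length_eq_zero_iff.mp h4)
    omega
  obtain ⟨g, hg⟩ := H.exists_reduced
  have one : ∃ h, m h = 1 := ⟨g, by exact_mod_cast (hm g).symm.trans hg⟩
  have hfail : (∃ g, 0 < componentFailure (fiberMap ν f t₀) g) ∨
      (∃ y, 0 < branchFailure (fiberMap ν f t₀) y) ∨ ∀ h, m h = 1 := by
    -- A reduced fibre needs no injectivity failure, since all its multiplicities are one.
    by_cases hr : IsReduced (f.fiber t₀)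
    · refine Or.inr (Or.inr fun h => ?_)
      exact_mod_cast (hm h).symm.trans (length_stalk_eq_one_of_isReduced h.2)
    · rcases H.failure hr with h | h
      exacts [Or.inl h, Or.inr (Or.inl h)]
  obtain ⟨D, hgr, hpt, hDm, hD⟩ := exists_gluingData hgen ht ht0 hnn ht₀ hX hS2 H.tree m hm m_eq
    H.pointMultiplicity_le H.greenDist_eq one hfail
  have hcard : ∀ {n : ℕ}, n ≠ 0 → Nat.card {g : f.fiber t₀ // g ∈ genericPoints (f.fiber t₀)} = n →
      numComponents (f.fiber t₀) = n := by
    rintro n hn rfl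
    have := Nat.finite_of_card_ne_zero hn
    rw [numComponents_eq, ENat.card_eq_coe_natCard]
  rcases hD with hD | h1
  · rcases GluingData.DoubledShape.hasGraph hgr hpt (by rw [hDm]; exact hm) hD.doubledShape with ⟨hn, h⟩ | ⟨hn, h⟩
    · exact ⟨2, hcard (by decide) hn, Or.inr (Or.inl ⟨rfl, Or.inr h⟩)⟩
    · exact ⟨3, hcard (by decide) hn, Or.inr (Or.inr (Or.inl ⟨rfl, Or.inr h⟩))⟩
  · have : Nonempty {g : f.fiber t₀ // g ∈ genericPoints (f.fiber t₀)} := ⟨g⟩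
    rcases GluingData.exists_hasGraph_of_forall_m_eq_one (D := D) hgr hpt (by rw [hDm]; exact hm)
      (by rw [hDm]; exact h1) with
      ⟨hn, h⟩ | ⟨n, hn2, hn4, hn, h, -⟩
    · exact ⟨1, hcard (by decide) hn, Or.inl ⟨rfl, h⟩⟩
    · refine ⟨n, hcard (by omega) hn, ?_⟩
      obtain rfl | rfl | rfl : n = 2 ∨ n = 3 ∨ n = 4 := by omega
      · refine Or.inr (Or.inl ⟨rfl, Or.inl (h _ fun i => by fin_cases i <;> rfl)⟩)
      · refine Or.inr (Or.inr (Or.inl ⟨rfl, Or.inl (h _ fun i => by fin_cases i <;> rfl)⟩))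
      · refine Or.inr (Or.inr (Or.inr ⟨rfl, h _ fun i => by fin_cases i <;> rfl⟩))

include hgen ht ht0 hnn ht₀ hX hS2 in
lemma hasGraph_fiber_of_reducedCurveHypotheses (H : ReducedCurveHypotheses (fiberMap ν f t₀)) :
    ∃ n : ℕ, numComponents (f.fiber t₀) = n ∧
      ((n = 1 ∧ HasGraph (f.fiber t₀) .point ![1]) ∨
      (n = 2 ∧ HasGraph (f.fiber t₀) (.star 2) ![1, 1]) ∨
      (n = 3 ∧ HasGraph (f.fiber t₀) (.star 3) ![1, 1, 1])) := by
  have hr := H.reduced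
  have hm : ∀ g : {g : f.fiber t₀ // g ∈ genericPoints (f.fiber t₀)},
      componentMultiplicity (f.fiber t₀) g = (1 : ℕ) := fun g =>
    (length_stalk_eq_one_of_isReduced g.2).trans Nat.cast_one.symm
  obtain ⟨g, -⟩ := H.exists_reduced
  obtain ⟨D, hgr, hpt, hDm, -⟩ := exists_gluingData hgen ht ht0 hnn ht₀ hX hS2 H.tree (fun _ => 1) hm
    (fun _ => Or.inl rfl) (fun p hp => (H.pointMultiplicity_le p hp).trans (by norm_num))
    H.greenDist_eq ⟨g, rfl⟩ (Or.inr (Or.inr fun _ => rfl))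
  have hcard : ∀ {n : ℕ}, n ≠ 0 → Nat.card {g : f.fiber t₀ // g ∈ genericPoints (f.fiber t₀)} = n →
      numComponents (f.fiber t₀) = n := by
    rintro n hn rfl
    have := Nat.finite_of_card_ne_zero hn
    rw [numComponents_eq, ENat.card_eq_coe_natCard]
  have : Nonempty {g : f.fiber t₀ // g ∈ genericPoints (f.fiber t₀)} := ⟨g⟩
  rcases GluingData.exists_hasGraph_of_forall_m_eq_one (D := D) hgr hpt (by rw [hDm]; exact hm)
    (fun k => by rw [hDm]) with ⟨hn, h⟩ | ⟨n, hn2, hn4, hn, h, y, hy⟩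
  · exact ⟨1, hcard (by decide) hn, Or.inl ⟨rfl, h⟩⟩
  · refine ⟨n, hcard (by omega) hn, ?_⟩
    -- Every component has a branch at the centre of the star, where the multiplicity is now at most
    -- three.
    have hn3 : n ≤ 3 := by
      classical
      have := Nat.finite_of_card_ne_zero (by omega :
        Nat.card {g : f.fiber t₀ // g ∈ genericPoints (f.fiber t₀)} ≠ 0)
      have := Fintype.ofFinite {g : f.fiber t₀ // g ∈ genericPoints (f.fiber t₀)}
      obtain ⟨-, hy⟩ := hy
      rw [hgr, hpt] at hy
      choose β hβ hβ' using fun k => (hy k).exists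
      have hβi : Function.Injective β := fun k l h => by rw [← hβ' k, h, hβ']
      have h1 := sum_length_le_pointMultiplicity ht ht0 ht₀ hX y (fun _ => 1) hm
        (Finset.univ.image β) (by
          intro b hb
          obtain ⟨k, -, rfl⟩ := Finset.mem_image.mp hb
          exact hβ k) (n := 3)
        (fun p hp => (H.pointMultiplicity_le p hp).trans (by norm_num))
      rwa [Finset.sum_const, Finset.card_image_of_injective _ hβi, smul_eq_mul, mul_one,
        Finset.card_univ, ← Nat.card_eq_fintype_card, hn] at h1
    obtain rfl | rfl : n = 2 ∨ n = 3 := by omega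
    · refine Or.inr (Or.inl ⟨rfl, h _ fun i => by fin_cases i <;> rfl⟩)
    · refine Or.inr (Or.inr ⟨rfl, h _ fun i => by fin_cases i <;> rfl⟩)

end FiberGluing

theorem mainTheorem11
    -- a smooth complex curve `T` with a closed point `t₀`
    {T : Scheme.{0}} [AlgebraicGeometry.IsIntegral T]
    (p : T ⟶ Spec (CommRingCat.of ℂ)) [IsSeparated p] [LocallyOfFiniteType p] [QuasiCompact p]
    [SmoothOfRelativeDimension 1 p] (t₀ : T) (ht₀ : IsClosed {t₀})
    -- an S2 surface `X`, proper and flat over `T`, whose nonnormal locus lies over `t₀`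
    {X : Scheme.{0}} [AlgebraicGeometry.IsIntegral X] (f : X ⟶ T) [IsProper f] [Flat f]
    (hX : IsSurface X) (hS2 : SatisfiesS2 X) (hnn : ∀ x : X, f x ≠ t₀ → IsNormalAt X x)
    -- its normalization, with reduced central fibre
    {X' : Scheme.{0}} [AlgebraicGeometry.IsIntegral X'] (ν : X' ⟶ X) (hν : IsNormalization ν)
    (hred : IsReduced ((ν ≫ f).fiber t₀)) :
    (DoubleCurveHypotheses (fiberMap ν f t₀) →
      (1 ≤ numComponents (f.fiber t₀) ∧ numComponents (f.fiber t₀) ≤ 4) ∧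
      (HasGraph (f.fiber t₀) .point ![1] ∨
        HasGraph (f.fiber t₀) (.star 2) ![1, 1] ∨
        HasGraph (f.fiber t₀) (.star 2) ![2, 1] ∨
        HasGraph (f.fiber t₀) (.star 3) ![1, 1, 1] ∨
        HasGraph (f.fiber t₀) (.star 3) ![2, 1, 1] ∨
        HasGraph (f.fiber t₀) .hexagon ![2, 2, 1] ∨
        HasGraph (f.fiber t₀) (.star 4) ![1, 1, 1, 1])) ∧
    (ReducedCurveHypotheses (fiberMap ν f t₀) →
      (1 ≤ numComponents (f.fiber t₀) ∧ numComponents (f.fiber t₀) ≤ 3) ∧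
      (HasGraph (f.fiber t₀) .point ![1] ∨
        HasGraph (f.fiber t₀) (.star 2) ![1, 1] ∨
        HasGraph (f.fiber t₀) (.star 3) ![1, 1, 1])) := by
  have := hν.finite
  have := hν.birational
  have : IsLocallyNoetherian X := LocallyOfFiniteType.isLocallyNoetherian (f ≫ p)
  have : IsLocallyNoetherian X' := LocallyOfFiniteType.isLocallyNoetherian ν
  obtain ⟨t, ht, ht0⟩ := exists_maximalIdeal_stalk_eq_span p ht₀
  have hnn' : ∀ x : X, f x ≠ t₀ → IsIntegrallyClosed (X.presheaf.stalk x) := fun x hx =>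
    (hnn x hx).2
  constructor
  · intro H
    obtain ⟨n, hn, h⟩ := hasGraph_fiber_of_doubleCurveHypotheses hν.map_genericPoint ht ht0 hnn' ht₀
      hX hS2 H
    rw [hn]
    norm_cast
    refine ⟨by omega, by tauto⟩
  · intro H
    obtain ⟨n, hn, h⟩ := hasGraph_fiber_of_reducedCurveHypotheses hν.map_genericPoint ht ht0 hnn'
      ht₀ hX hS2 H
    rw [hn]
    norm_cast
    refine ⟨by omega, by tauto⟩
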